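/- Conventions. A prederivator is a strict 2-functor $\mathscr D\colon \mathrm{Cat}^{\mathrm{op}}\to \mathrm{CAT}$ (small categories to categories, reversing 1-cells only). A derivator is a prederivator satisfying the usual axioms: coproducts of small categories are sent to products, isomorphisms are detected pointwise, restriction functors $u^*$ have left and right adjoints $u_!,u_*$ (Kan extensions), and these are computed pointwise by the canonical mates of slice squares. Let $\square=[1]\times[1]$. A coherent square $X\in\mathscr D(\square)$ is cocartesian (cartesian) if it lies in the essential image of the left (right) Kan extension along the inclusion of $\square$ without its terminal (initial) vertex. A derivator is stable if $\mathscr D(\ast)$ has a zero object and a square is cartesian if and only if it is cocartesian. Morphisms of prederivators are pseudonatural transformations, and transformations between them are modifications; a morphism of stable derivators is exact if it preserves initial objects, terminal objects, cocartesian squares and cartesian squares. For a small category $B$, $\mathscr D^B$ denotes the shifted derivator $\mathscr D^B(A)=\mathscr D(B\times A)$. The repetitive quiver $\widehat Q$ of a quiver $Q$ has vertices $(k,q)$, $k\in\mathbb Z$, $q\in Q$, and for every arrow $\alpha\colon q_1\to q_2$ of $Q$ and every $k$ arrows $\alpha\colon(k,q_1)\to(k,q_2)$ and $\alpha^*\colon(k,q_2)\to(k+1,q_1)$.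 Let $n\ge 1$ and let $Q_n=(0\to1\to\dots\to n+1)$. The mesh category $M_n$ is the quotient of the free category on $\widehat{Q_n}$ by the relations making all squares $$(k,l)\to(k,l+1)\to(k+1,l),\qquad (k,l)\to(k+1,l-1)\to(k+1,l)\qquad(k\in\mathbb Z,\ 1\le l\le n)$$ commute. For a stable derivator $\mathscr D$, let $\mathscr D^{M_n,\mathrm{ex}}\subseteq\mathscr D^{M_n}$ (the prederivator of coherent Auslander--Reiten quivers) be the full subprederivator consisting of those $X\in\mathscr D(M_n\times A)$ such that for every $a\in A$ the diagram $X_a\in\mathscr D(M_n)$ vanishes at $(k,0)$ and $(k,n+1)$ for all $k\in\mathbb Z$, and the restrictions of $X_a$ to all the above squares are cocartesian and cartesian. An $A_n$-quiver is a quiver whose underlying graph is the Dynkin graph $A_n$ (a path on $n$ vertices), with an arbitrary orientation. Let $Q$ be an $A_n$-quiver with end vertices $e_1,e_2$ (which coincide if $n=1$), and let $Q_{\mathrm{ext}}$ be obtained from $Q$ by attaching two new arrows, starting at $e_1$ and $e_2$ and ending at two new vertices. We also write $Q$ for the free category on $Q$. For an isomorphism of quivers $\varphi\colon\widehat{Q_{\mathrm{ext}}}\to\widehat{Q_n}$,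 let $i_Q=i_{Q,\varphi}$ be the functor $$i_Q\colon Q\to Q_{\mathrm{ext}}\xrightarrow{\ q\mapsto(0,q)\ }\widehat{Q_{\mathrm{ext}}}\xrightarrow{\ \varphi\ }\widehat{Q_n}\to M_n .$$ Theorem. Let $n\geq 1$ and let $Q$ be an $A_n$-quiver with arbitrary orientation. (1) There is an isomorphism of quivers $\varphi\colon\widehat{Q_{\mathrm{ext}}}\cong\widehat{Q_n}$, and for every such $\varphi$ the functor $i_Q\colon Q\to M_n$ is fully faithful and injective on objects. (2) For every stable derivator $\mathscr D$, the prederivators $\mathscr D^Q$ and $\mathscr D^{M_n,\mathrm{ex}}$ are stable derivators. (3) For every such $\varphi$ there is an (adjoint) equivalence $$(F_Q,i_Q^*)\colon\ \mathscr D^Q\rightleftarrows\mathscr D^{M_n,\mathrm{ex}}$$ whose right-hand component is restriction along $i_Q$, natural in the stable derivator $\mathscr D$ with respect to exact morphisms: it is an adjoint equivalence between the 2-functors $\mathscr D\mapsto\mathscr D^Q$ and $\mathscr D\mapsto\mathscr D^{M_n,\mathrm{ex}}$, in the 2-category of pseudofunctors, pseudonatural transformations and modifications from the 2-category of stable derivators,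 exact morphisms and modifications to the 2-category of prederivators. In particular, up to natural equivalence, $\mathscr D^Q$ does not depend on the orientation of the $A_n$-quiver $Q$, and $\mathscr D^{M_n,\mathrm{ex}}$ is the stable derivator of coherent Auslander--Reiten quivers for every orientation. -/

import Mathlib

open CategoryTheory Bicategory Opposite
open scoped CategoryTheory.Pseudofunctor.StrongTrans

universe u v w

namespace ARDerivator

/-! ### Transformations of pseudofunctors: precomposition, strictness, full subcategories -/

section Aux

universe w₁ w₂ w₃ v₁ v₂ v₃ u₁ u₂ u₃

variable {B : Type u₁} [Bicategory.{w₁, v₁} B] {B' : Type u₂} [Bicategory.{w₂, v₂} B']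
  {C : Type u₃} [Bicategory.{w₃, v₃} C]

/-- Precomposition of a pseudonatural transformation with a pseudofunctor. -/
def precompTrans (P : B ⥤ᵖ B') {F G : B' ⥤ᵖ C} (θ : F ⟶ G) : P.comp F ⟶ P.comp G where
  app a := θ.app (P.obj a)
  naturality f := θ.naturality (P.map f)
  naturality_naturality η := θ.naturality_naturality (P.map₂ η)
  naturality_id a := by
    change (θ.naturality (P.map (𝟙 a))).hom ≫
        θ.app (P.obj a) ◁ (G.map₂ (P.mapId a).hom ≫ (G.mapId (P.obj a)).hom) =
      (F.map₂ (P.mapId a).hom ≫ (F.mapId (P.obj a)).hom) ▷ θ.app (P.obj a) ≫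
        (λ_ (θ.app (P.obj a))).hom ≫ (ρ_ (θ.app (P.obj a))).inv
    rw [Bicategory.whiskerLeft_comp, comp_whiskerRight, Category.assoc, ← θ.naturality_id,
      ← θ.naturality_naturality_assoc]
  naturality_comp {a b c} f g := by
    change (θ.naturality (P.map (f ≫ g))).hom ≫
        θ.app (P.obj a) ◁ (G.map₂ (P.mapComp f g).hom ≫ (G.mapComp (P.map f) (P.map g)).hom) =
      (F.map₂ (P.mapComp f g).hom ≫ (F.mapComp (P.map f) (P.map g)).hom) ▷ θ.app (P.obj c) ≫ _
    rw [Bicategory.whiskerLeft_comp, ← θ.naturality_naturality_assoc, θ.naturality_comp]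
    exact ((congrArg (· ≫ _) (comp_whiskerRight _ _ _)).trans (Category.assoc _ _ _)).symm

/-- Precomposition of a modification with a pseudofunctor. -/
def precompModif (P : B ⥤ᵖ B') {F G : B' ⥤ᵖ C} {θ θ' : F ⟶ G} (m : θ ⟶ θ') :
    precompTrans P θ ⟶ precompTrans P θ' where
  as :=
    { app a := m.as.app (P.obj a)
      naturality f := m.as.naturality (P.map f) }

/-- A strictly natural transformation of strict 2-functors, as a pseudonatural one. -/
def mkStrictTrans [Bicategory.Strict C] {F G : StrictPseudofunctor B C}
    (app : ∀ a, F.obj a ⟶ G.obj a)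
    (nat : ∀ {a b : B} (f : a ⟶ b), F.map f ≫ app b = app a ≫ G.map f)
    (nat₂ : ∀ {a b : B} {f g : a ⟶ b} (η : f ⟶ g),
      F.map₂ η ▷ app b ≫ eqToHom (nat g) = eqToHom (nat f) ≫ app a ◁ G.map₂ η) :
    F.toPseudofunctor ⟶ G.toPseudofunctor where
  app := app
  naturality f := eqToIso (nat f)
  naturality_naturality η := nat₂ η
  naturality_id a := by
    simp [F.mapId_eq_eqToIso, G.mapId_eq_eqToIso, Strict.leftUnitor_eqToIso,
      Strict.rightUnitor_eqToIso]
  naturality_comp f g := by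
    simp [F.mapComp_eq_eqToIso, G.mapComp_eq_eqToIso, Strict.associator_eqToIso]

theorem eqToIso_app {X Y : Cat.{v, w}} {K L : X ⟶ Y} (h : K = L) (M : X) :
    (eqToIso h).hom.toNatTrans.app M = eqToHom (by rw [h]) := by
  subst h
  rfl

theorem eqToIso_app_hom {X : Cat.{v, w}} {Y : Type w} [Category.{v} Y] {P : ObjectProperty Y}
    {K L : X ⟶ Cat.of P.FullSubcategory} (h : K = L) (M : X) :
    P.ι.map ((eqToIso h).hom.toNatTrans.app M) =
      eqToHom (congrArg (fun T => P.ι.obj (T.toFunctor.obj M)) h) := by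
  subst h
  rfl

/-- The full sub-2-functor of a strict 2-functor to categories. -/
def strictFullSub (F : StrictPseudofunctor B Cat.{v, w}) (P : F.toPseudofunctor.ObjectProperty)
    [P.IsClosedUnderMapObj] : StrictPseudofunctor B Cat.{v, w} :=
  have hid : ∀ X, P.fullsubcategory.map (𝟙 X) = 𝟙 (P.fullsubcategory.obj X) := fun X => by
    have key : ∀ (K : F.obj X ⟶ F.obj X) (hK : ∀ M, P.prop X M → P.prop X (K.toFunctor.obj M)),
        K = 𝟙 _ → (P.prop X).lift ((P.prop X).ι ⋙ K.toFunctor) (fun M => hK _ M.2) = 𝟭 _ := by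
      rintro _ hK rfl
      rfl
    exact Cat.ext (key _ (fun M hM => P.map_obj hM _) (F.map_id X))
  have hcomp : ∀ {X Y Z : B} (f : X ⟶ Y) (g : Y ⟶ Z), P.fullsubcategory.map (f ≫ g) =
      P.fullsubcategory.map f ≫ P.fullsubcategory.map g := fun {X Y Z} f g => by
    have key : ∀ (K : F.obj X ⟶ F.obj Z) (hK : ∀ M, P.prop X M → P.prop Z (K.toFunctor.obj M)),
        K = F.map f ≫ F.map g →
          (P.prop Z).lift ((P.prop X).ι ⋙ K.toFunctor) (fun M => hK _ M.2) =
            P.map f ⋙ P.map g := by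
      rintro _ hK rfl
      rfl
    exact Cat.ext (key _ (fun M hM => P.map_obj hM _) (F.map_comp f g))
  { toPseudofunctor := P.fullsubcategory
    map_id := hid
    mapId_eq_eqToIso X := by
      ext M
      refine ObjectProperty.hom_ext _ (Eq.trans ?_ (eqToIso_app_hom (hid X) M).symm)
      exact (congrArg (fun t => t.hom.toNatTrans.app M.obj) (F.mapId_eq_eqToIso X)).trans
        (eqToIso_app (F.map_id X) M.obj)
    map_comp := hcomp
    mapComp_eq_eqToIso f g := by
      ext M
      refine ObjectProperty.hom_ext _ (Eq.trans ?_ (eqToIso_app_hom (hcomp f g) M).symm)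
      exact (congrArg (fun t => t.hom.toNatTrans.app M.obj) (F.mapComp_eq_eqToIso f g)).trans
        (eqToIso_app (F.map_comp f g) M.obj) }

/-- Restriction of a pseudonatural transformation to full sub-2-functors. -/
def restrictTrans {F G : B ⥤ᵖ Cat.{v, w}} (P : F.ObjectProperty) (Q : G.ObjectProperty)
    [P.IsClosedUnderMapObj] [Q.IsClosedUnderMapObj] (θ : F ⟶ G)
    (h : ∀ X M, P.prop X M → Q.prop X ((θ.app X).toFunctor.obj M)) :
    P.fullsubcategory ⟶ Q.fullsubcategory where
  app X := ((Q.prop X).lift ((P.prop X).ι ⋙ (θ.app X).toFunctor) fun M => h X _ M.2).toCatHom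
  naturality {X Y} f := Cat.Hom.isoMk (((Q.prop Y).fullyFaithfulι.whiskeringRight _).preimageIso
      (Functor.isoWhiskerLeft (P.prop X).ι (Cat.Hom.toNatIso (θ.naturality f))))
  naturality_naturality η := by
    ext M
    have := congrArg (fun t => t.toNatTrans.app M.obj) (θ.naturality_naturality η)
    exact ObjectProperty.hom_ext _ this
  naturality_id X := by
    ext M
    have := congrArg (fun t => t.toNatTrans.app M.obj) (θ.naturality_id X)
    exact ObjectProperty.hom_ext _ this
  naturality_comp f g := by
    ext M
    have := congrArg (fun t => t.toNatTrans.app M.obj) (θ.naturality_comp f g)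
    exact ObjectProperty.hom_ext _ this

/-- Restriction of a modification to full sub-2-functors. -/
def restrictModif {F G : B ⥤ᵖ Cat.{v, w}} (P : F.ObjectProperty) (Q : G.ObjectProperty)
    [P.IsClosedUnderMapObj] [Q.IsClosedUnderMapObj] {θ θ' : F ⟶ G} (m : θ ⟶ θ')
    (h : ∀ X M, P.prop X M → Q.prop X ((θ.app X).toFunctor.obj M))
    (h' : ∀ X M, P.prop X M → Q.prop X ((θ'.app X).toFunctor.obj M)) :
    restrictTrans P Q θ h ⟶ restrictTrans P Q θ' h' where
  as :=
    { app X := Cat.Hom₂.ofNatTrans (((Q.prop X).fullyFaithfulι.whiskeringRight _).preimage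
        (Functor.whiskerLeft (P.prop X).ι (m.as.app X).toNatTrans))
      naturality f := by
        ext M
        have := congrArg (fun t => t.toNatTrans.app M.obj) (m.as.naturality f)
        exact ObjectProperty.hom_ext _ this }

end Aux

/-! ### Prederivators and derivators -/

/-- A prederivator: a strict 2-functor from small categories to categories which reverses
1-cells and preserves the direction of 2-cells. -/
abbrev Prederivator := StrictPseudofunctor Cat.{u, u}ᵒᵖ Cat.{v, w}

/-- The 2-category of prederivators, pseudonatural transformations and modifications. -/
abbrev PDer := InducedBicategory (Pseudofunctor Cat.{u, u}ᵒᵖ Cat.{v, w})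
  (fun D : Prederivator.{u, v, w} => D.toPseudofunctor)

/-- The terminal category. -/
abbrev Pt : Type u := Discrete PUnit.{u + 1}

/-- The square `[1] × [1]`. -/
abbrev Square : Type u := ULift.{u} (Fin 2 × Fin 2)

/-- The full subcategory of the square obtained by removing the terminal object. -/
abbrev UpperCorner : Type u := {x : Square.{u} // x.down ≠ (1, 1)}

/-- The full subcategory of the square obtained by removing the initial object. -/
abbrev LowerCorner : Type u := {x : Square.{u} // x.down ≠ (0, 0)}

def upperIncl : UpperCorner.{u} ⥤ Square.{u} :=
  Monotone.functor (f := Subtype.val) fun _ _ h => h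

def lowerIncl : LowerCorner.{u} ⥤ Square.{u} :=
  Monotone.functor (f := Subtype.val) fun _ _ h => h

/-- The transformation `f ∘ p ⟶ b ∘ π` of the slice square of `(f/b)`. -/
def sliceTrans {A B : Type u} [Category.{u} A] [Category.{u} B] (f : A ⥤ B) (b : B) :
    CostructuredArrow.proj f b ⋙ f ⟶
      Functor.star.{u} (CostructuredArrow f b) ⋙ Functor.fromPUnit b where
  app x := x.hom
  naturality _ _ g := g.w

/-- The transformation `b ∘ π ⟶ f ∘ q` of the slice square of `(b/f)`. -/
def cosliceTrans {A B : Type u} [Category.{u} A] [Category.{u} B] (f : A ⥤ B) (b : B) :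
    Functor.star.{u} (StructuredArrow b f) ⋙ Functor.fromPUnit b ⟶
      StructuredArrow.proj b f ⋙ f where
  app x := x.hom
  naturality _ _ g := (Category.id_comp _).trans (StructuredArrow.w g).symm

namespace Prederivator

variable (D : Prederivator.{u, v, w})

/-- The category of coherent diagrams of shape `A`. -/
abbrev Diag (A : Type u) [Category.{u} A] : Cat.{v, w} := D.obj (op (Cat.of A))

/-- The restriction functor `f^*`. -/
abbrev restr {A B : Type u} [Category.{u} A] [Category.{u} B] (f : A ⥤ B) :
    D.Diag B ⥤ D.Diag A :=
  (D.map f.toCatHom.op).toFunctor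

/-- The transformation `f^* ⟶ g^*` induced by `α : f ⟶ g`. -/
abbrev restrTrans {A B : Type u} [Category.{u} A] [Category.{u} B] {f g : A ⥤ B} (α : f ⟶ g) :
    D.restr f ⟶ D.restr g :=
  (D.map₂ (Bicategory.Opposite.op2 α.toCatHom₂)).toNatTrans

/-- The identification of `(g ∘ f)^*` with `f^* ∘ g^*`. -/
abbrev restrComp {A B C : Type u} [Category.{u} A] [Category.{u} B] [Category.{u} C]
    (f : A ⥤ B) (g : B ⥤ C) : D.restr (f ⋙ g) ≅ D.restr g ⋙ D.restr f :=
  Cat.Hom.toNatIso (D.mapComp g.toCatHom.op f.toCatHom.op)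

/-- Evaluation `a^*` at an object `a`. -/
abbrev eval {A : Type u} [Category.{u} A] (a : A) : D.Diag A ⥤ D.Diag Pt.{u} :=
  D.restr (Functor.fromPUnit a)

/-- A square of categories with a 2-cell `α : f ∘ p ⟶ g ∘ q` induces `p^* f^* ⟶ q^* g^*`. -/
def squareTrans {E A B C : Type u} [Category.{u} E] [Category.{u} A] [Category.{u} B]
    [Category.{u} C] {p : E ⥤ A} {q : E ⥤ B} {f : A ⥤ C} {g : B ⥤ C} (α : p ⋙ f ⟶ q ⋙ g) :
    D.restr f ⋙ D.restr p ⟶ D.restr g ⋙ D.restr q :=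
  (D.restrComp p f).inv ≫ D.restrTrans α ≫ (D.restrComp q g).hom

/-- The axioms of a derivator. In `der4_left` and `der4_right` the Kan extension functors are
arbitrary left and right adjoints of the restriction functors. -/
structure IsDerivator : Prop where
  der1 : ∀ {I : Type u} (A : I → Type u) [∀ i, Category.{u} (A i)],
    (Functor.pi' fun i => D.restr (Sigma.incl (C := A) i)).IsEquivalence
  der2 : ∀ {A : Type u} [Category.{u} A] {X Y : D.Diag A} (f : X ⟶ Y),
    IsIso f ↔ ∀ a : A, IsIso ((D.eval a).map f)
  der3_left : ∀ {A B : Type u} [Category.{u} A] [Category.{u} B] (f : A ⥤ B),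
    (D.restr f).IsRightAdjoint
  der3_right : ∀ {A B : Type u} [Category.{u} A] [Category.{u} B] (f : A ⥤ B),
    (D.restr f).IsLeftAdjoint
  /-- The canonical mate `π_! p^* ⟶ b^* f_!` is invertible. -/
  der4_left : ∀ {A B : Type u} [Category.{u} A] [Category.{u} B] (f : A ⥤ B) (b : B)
    (lan : D.Diag A ⥤ D.Diag B) (adj : lan ⊣ D.restr f)
    (colim : D.Diag (CostructuredArrow f b) ⥤ D.Diag Pt.{u})
    (adj' : colim ⊣ D.restr (Functor.star.{u} (CostructuredArrow f b))),
    IsIso ((mateEquiv adj adj').symm (.mk _ _ _ _ (D.squareTrans (sliceTrans f b)))).natTrans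
  /-- The canonical mate `b^* f_* ⟶ π_* q^*` is invertible. -/
  der4_right : ∀ {A B : Type u} [Category.{u} A] [Category.{u} B] (f : A ⥤ B) (b : B)
    (ran : D.Diag A ⥤ D.Diag B) (adj : D.restr f ⊣ ran)
    (lim : D.Diag (StructuredArrow b f) ⥤ D.Diag Pt.{u})
    (adj' : D.restr (Functor.star.{u} (StructuredArrow b f)) ⊣ lim),
    IsIso (mateEquiv adj adj' (.mk _ _ _ _ (D.squareTrans (cosliceTrans f b)))).natTrans

variable {D} in
/-- A square is cocartesian if it is in the essential image of left Kan extension along the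
inclusion of the upper corner. -/
def IsCocartesian (X : D.Diag Square.{u}) : Prop :=
  ∃ (lan : D.Diag UpperCorner.{u} ⥤ D.Diag Square.{u}) (_ : lan ⊣ D.restr upperIncl.{u}),
    lan.essImage X

variable {D} in
/-- A square is cartesian if it is in the essential image of right Kan extension along the
inclusion of the lower corner. -/
def IsCartesian (X : D.Diag Square.{u}) : Prop :=
  ∃ (ran : D.Diag LowerCorner.{u} ⥤ D.Diag Square.{u}) (_ : D.restr lowerIncl.{u} ⊣ ran),
    ran.essImage X

/-- A stable derivator: a pointed derivator in which a square is cartesian if and only if it is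
cocartesian. -/
structure IsStableDerivator : Prop extends IsDerivator D where
  pointed : Limits.HasZeroObject (D.Diag Pt.{u})
  cartesian_iff : ∀ X : D.Diag Square.{u}, IsCartesian X ↔ IsCocartesian X

end Prederivator

open Prederivator

/-- The component at `A` of a morphism of prederivators. -/
abbrev component {D E : Prederivator.{u, v, w}} (G : D.toPseudofunctor ⟶ E.toPseudofunctor)
    (A : Type u) [Category.{u} A] : D.Diag A ⥤ E.Diag A :=
  (G.app (op (Cat.of A))).toFunctor

/-- Exact morphisms: right exact (initial objects and cocartesian squares are preserved) and left
exact (terminal objects and cartesian squares are preserved). -/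
structure IsExact {D E : Prederivator.{u, v, w}}
    (G : D.toPseudofunctor ⟶ E.toPseudofunctor) : Prop where
  initial : ∀ X : D.Diag Pt.{u}, Nonempty (Limits.IsInitial X) →
    Nonempty (Limits.IsInitial ((component G Pt).obj X))
  cocartesian : ∀ X : D.Diag Square.{u}, IsCocartesian X →
    IsCocartesian ((component G Square).obj X)
  terminal : ∀ X : D.Diag Pt.{u}, Nonempty (Limits.IsTerminal X) →
    Nonempty (Limits.IsTerminal ((component G Pt).obj X))
  cartesian : ∀ X : D.Diag Square.{u}, IsCartesian X →
    IsCartesian ((component G Square).obj X)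

theorem IsExact.id (D : Prederivator.{u, v, w}) : IsExact (𝟙 D.toPseudofunctor) where
  initial _ h := h
  cocartesian _ h := h
  terminal _ h := h
  cartesian _ h := h

theorem IsExact.comp {D E E' : Prederivator.{u, v, w}}
    {G : D.toPseudofunctor ⟶ E.toPseudofunctor} {H : E.toPseudofunctor ⟶ E'.toPseudofunctor}
    (hG : IsExact G) (hH : IsExact H) : IsExact (G ≫ H) where
  initial _ h := hH.initial _ (hG.initial _ h)
  cocartesian _ h := hH.cocartesian _ (hG.cocartesian _ h)
  terminal _ h := hH.terminal _ (hG.terminal _ h)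
  cartesian _ h := hH.cartesian _ (hG.cartesian _ h)

/-! ### The 2-category of stable derivators and exact morphisms -/

structure StableDerivator where
  pre : Prederivator.{u, v, w}
  isStable : pre.IsStableDerivator

namespace StableDerivator

structure ExactMor (D E : StableDerivator.{u, v, w}) where
  mor : D.pre.toPseudofunctor ⟶ E.pre.toPseudofunctor
  exact : IsExact mor

/-- 2-cells between exact morphisms are arbitrary modifications. -/
@[ext]
structure ExactMor.Hom {D E : StableDerivator.{u, v, w}} (G H : ExactMor D E) where
  modif : G.mor ⟶ H.mor

instance : CategoryStruct StableDerivator.{u, v, w} where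
  Hom := ExactMor
  id D := ⟨𝟙 _, IsExact.id D.pre⟩
  comp G H := ⟨G.mor ≫ H.mor, G.exact.comp H.exact⟩

instance (D E : StableDerivator.{u, v, w}) : Category (D ⟶ E) where
  Hom G H := ExactMor.Hom G H
  id G := ⟨𝟙 G.mor⟩
  comp s t := ⟨s.modif ≫ t.modif⟩

@[ext]
theorem hom₂_ext {D E : StableDerivator.{u, v, w}} {G H : D ⟶ E} {s t : G ⟶ H}
    (h : s.modif = t.modif) : s = t :=
  ExactMor.Hom.ext h

/-- An invertible modification as an invertible 2-cell. -/
def isoMk {D E : StableDerivator.{u, v, w}} {G H : D ⟶ E} (e : G.mor ≅ H.mor) : G ≅ H where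
  hom := ⟨e.hom⟩
  inv := ⟨e.inv⟩
  hom_inv_id := hom₂_ext e.hom_inv_id
  inv_hom_id := hom₂_ext e.inv_hom_id

instance : Bicategory StableDerivator.{u, v, w} where
  whiskerLeft G _ _ t := ExactMor.Hom.mk (ExactMor.mor G ◁ ExactMor.Hom.modif t)
  whiskerRight s H := ExactMor.Hom.mk (ExactMor.Hom.modif s ▷ ExactMor.mor H)
  associator G H K := isoMk (α_ G.mor H.mor K.mor)
  leftUnitor G := isoMk (λ_ G.mor)
  rightUnitor G := isoMk (ρ_ G.mor)
  whiskerLeft_id _ _ := hom₂_ext (Bicategory.whiskerLeft_id _ _)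
  whiskerLeft_comp _ _ _ _ _ _ := hom₂_ext (Bicategory.whiskerLeft_comp _ _ _)
  id_whiskerLeft _ := hom₂_ext (Bicategory.id_whiskerLeft _)
  comp_whiskerLeft _ _ _ _ _ := hom₂_ext (Bicategory.comp_whiskerLeft _ _ _)
  id_whiskerRight _ _ := hom₂_ext (Bicategory.id_whiskerRight _ _)
  comp_whiskerRight _ _ _ := hom₂_ext (Bicategory.comp_whiskerRight _ _ _)
  whiskerRight_id _ := hom₂_ext (Bicategory.whiskerRight_id _)
  whiskerRight_comp _ _ _ := hom₂_ext (Bicategory.whiskerRight_comp _ _ _)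
  whisker_assoc _ _ _ _ _ := hom₂_ext (Bicategory.whisker_assoc _ _ _)
  whisker_exchange _ _ := hom₂_ext (Bicategory.whisker_exchange _ _)
  pentagon _ _ _ _ := hom₂_ext (Bicategory.pentagon _ _ _ _)
  triangle _ _ := hom₂_ext (Bicategory.triangle _ _)

end StableDerivator

/-! ### Shifted derivators -/

/-- The strict 2-functor `A ↦ B × A`. -/
def prodOp (B : Type u) [Category.{u} B] : StrictPseudofunctor Cat.{u, u}ᵒᵖ Cat.{u, u}ᵒᵖ :=
  StrictPseudofunctor.mk'
    { obj A := op (Cat.of (B × A.unop))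
      map f := ((𝟭 B).prod f.unop.toFunctor).toCatHom.op
      map₂ η := Bicategory.Opposite.op2 (NatTrans.prod (𝟙 (𝟭 B)) η.unop2.toNatTrans).toCatHom₂
      map₂_id f := rfl
      map₂_comp {A A' f g h} η θ := by
        refine congrArg Bicategory.Opposite.op2 (Cat.Hom₂.ext (NatTrans.ext (funext fun x => ?_)))
        exact Prod.ext (Category.id_comp _).symm rfl
      map_id _ := by exact rfl
      map_comp _ _ := by exact rfl
      map₂_whisker_left f _ _ η := ((Category.id_comp _).trans (Category.comp_id _)).symm
      map₂_whisker_right η g := by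
        refine Eq.trans ?_ ((Category.id_comp _).trans (Category.comp_id _)).symm
        refine congrArg Bicategory.Opposite.op2 (Cat.Hom₂.ext (NatTrans.ext (funext fun x => ?_)))
        rfl
      map₂_left_unitor f := (Category.id_comp _).symm
      map₂_right_unitor f := (Category.id_comp _).symm
      map₂_associator f g h := ((Category.id_comp _).trans (Category.comp_id _)).symm }

/-- The shifted prederivator `D^B`, with `D^B(A) = D(B × A)`. -/
def Prederivator.shift (D : Prederivator.{u, v, w}) (B : Type u) [Category.{u} B] :
    Prederivator.{u, v, w} :=
  (prodOp B).comp D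

/-- The morphism `G^B : D^B ⟶ E^B` induced by `G : D ⟶ E`. -/
def shiftMor (B : Type u) [Category.{u} B] {D E : Prederivator.{u, v, w}}
    (G : D.toPseudofunctor ⟶ E.toPseudofunctor) :
    (D.shift B).toPseudofunctor ⟶ (E.shift B).toPseudofunctor :=
  precompTrans (prodOp B).toPseudofunctor G

/-- The modification `G^B ⟶ H^B` induced by `G ⟶ H`. -/
def shiftModif (B : Type u) [Category.{u} B] {D E : Prederivator.{u, v, w}}
    {G H : D.toPseudofunctor ⟶ E.toPseudofunctor} (m : G ⟶ H) : shiftMor B G ⟶ shiftMor B H :=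
  precompModif (prodOp B).toPseudofunctor m

theorem PDer.ext₂ {D E : PDer.{u, v, w}} {G H : D ⟶ E} {s t : G ⟶ H}
    (h : ∀ A M, (s.hom.as.app A).toNatTrans.app M = (t.hom.as.app A).toNatTrans.app M) :
    s = t :=
  InducedBicategory.hom₂_ext (Pseudofunctor.StrongTrans.homCategory.ext fun A =>
    Cat.Hom₂.ext (NatTrans.ext (funext fun M => h A M)))

section

variable {C : Type w} [Category.{v} C] {C' : Type w} [Category.{v} C']

theorem id_comp_id {X Y : C} (f : X ⟶ Y) : 𝟙 X ≫ f ≫ 𝟙 Y = f := by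
  simp

theorem id_comp_eq_comp_map_id (F : C ⥤ C') {X : C} {Y : C'} (f : Y ⟶ F.obj X) :
    𝟙 _ ≫ f = f ≫ F.map (𝟙 X) := by
  simp

theorem id_left_id (F : C ⥤ C') (X : C) :
    𝟙 (F.obj X) ≫ F.map (𝟙 X) ≫ 𝟙 (F.obj X) = 𝟙 (F.obj X) := by
  simp

theorem id_assoc_id (F : C ⥤ C') (X : C) :
    𝟙 (F.obj X) ≫ F.map (𝟙 X) ≫ 𝟙 (F.obj X) ≫ 𝟙 (F.obj X) ≫ 𝟙 (F.obj X) = 𝟙 (F.obj X) := by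
  simp

end

/-- Action on objects of the 2-functor `D ↦ D^B`. -/
abbrev shiftObj (B : Type u) [Category.{u} B] (D : StableDerivator.{u, v, w}) :
    PDer.{u, v, w} := D.pre.shift B

/-- Action on 1-cells of the 2-functor `D ↦ D^B`. -/
def shiftHom (B : Type u) [Category.{u} B] {D E : StableDerivator.{u, v, w}} (G : D ⟶ E) :
    shiftObj B D ⟶ shiftObj B E :=
  InducedBicategory.mkHom (shiftMor B (StableDerivator.ExactMor.mor G))

/-- Action on 2-cells of the 2-functor `D ↦ D^B`. -/
def shiftHom₂ (B : Type u) [Category.{u} B] {D E : StableDerivator.{u, v, w}} {G H : D ⟶ E}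
    (m : G ⟶ H) :
    shiftHom B G ⟶ shiftHom B H :=
  InducedBicategory.mkHom₂ (shiftModif B (StableDerivator.ExactMor.Hom.modif m))

def shiftHomId (B : Type u) [Category.{u} B] (D : StableDerivator.{u, v, w}) :
    shiftHom B (𝟙 D) ≅ 𝟙 (shiftObj B D) :=
  InducedBicategory.isoMk (Pseudofunctor.StrongTrans.isoMk (fun _ => Iso.refl _) fun f =>
    Cat.Hom₂.ext (NatTrans.ext (funext fun _ => id_comp_eq_comp_map_id
      ((shiftObj B D).map f).toFunctor _)))

def shiftHomComp (B : Type u) [Category.{u} B] {D E E' : StableDerivator.{u, v, w}}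
    (G : D ⟶ E) (H : E ⟶ E') :
    shiftHom B (G ≫ H) ≅ shiftHom B G ≫ shiftHom B H :=
  InducedBicategory.isoMk (Pseudofunctor.StrongTrans.isoMk (fun _ => Iso.refl _) fun f =>
    Cat.Hom₂.ext (NatTrans.ext (funext fun _ => id_comp_eq_comp_map_id
      ((shiftObj B E').map f).toFunctor _)))

/-- The 2-functor `D ↦ D^B` on stable derivators and exact morphisms. -/
def shiftFunctor (B : Type u) [Category.{u} B] : StableDerivator.{u, v, w} ⥤ᵖ PDer.{u, v, w} where
  obj := shiftObj B
  map := shiftHom B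
  map₂ := shiftHom₂ B
  map₂_id _ := rfl
  map₂_comp _ _ := rfl
  mapId := shiftHomId B
  mapComp := shiftHomComp B
  map₂_whisker_left _ _ _ _ := PDer.ext₂ fun _ _ => (id_comp_id _).symm
  map₂_whisker_right _ _ := PDer.ext₂ fun _ _ => (id_comp_id _).symm
  map₂_associator _ _ K := PDer.ext₂ fun A _ =>
    (id_assoc_id ((shiftHom B K).hom.app A).toFunctor _).symm
  map₂_left_unitor G := PDer.ext₂ fun A _ =>
    (id_left_id ((shiftHom B G).hom.app A).toFunctor _).symm
  map₂_right_unitor _ := PDer.ext₂ fun _ _ => (id_comp_id _).symm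

/-! ### Quivers of type A, repetitive quivers and mesh categories -/

/-- Vertices `(k, q)` of the repetitive quiver of `V`. -/
@[ext]
structure Repetitive (V : Type u) : Type u where
  k : ℤ
  q : V

/-- Arrows of the repetitive quiver: `α : (k, a) ⟶ (k, b)` and `α^* : (k, b) ⟶ (k + 1, a)` for
every arrow `α : a ⟶ b`. -/
inductive Repetitive.Arrow {V : Type u} [Quiver.{u} V] : Repetitive V → Repetitive V → Type u
  | arr (k : ℤ) {a b : V} (α : a ⟶ b) : Repetitive.Arrow ⟨k, a⟩ ⟨k, b⟩
  | star (k : ℤ) {a b : V} (α : a ⟶ b) : Repetitive.Arrow ⟨k, b⟩ ⟨k + 1, a⟩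

instance {V : Type u} [Quiver.{u} V] : Quiver.{u} (Repetitive V) := ⟨Repetitive.Arrow⟩

namespace Repetitive

variable {V : Type u} [Quiver.{u} V]

def arr (k : ℤ) {a b : V} (α : a ⟶ b) : (⟨k, a⟩ : Repetitive V) ⟶ ⟨k, b⟩ := Arrow.arr k α

def star (k : ℤ) {a b : V} (α : a ⟶ b) : (⟨k, b⟩ : Repetitive V) ⟶ ⟨k + 1, a⟩ := Arrow.star k α

/-- The embedding `q ↦ (0, q)`. -/
def incl (V : Type u) [Quiver.{u} V] : V ⥤q Repetitive V where
  obj q := ⟨0, q⟩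
  map α := arr 0 α

end Repetitive

/-- The linearly oriented quiver `0 → 1 → ⋯ → m - 1`. -/
def Linear (m : ℕ) : Type u := ULift.{u} (Fin m)

instance (m : ℕ) : Quiver.{u} (Linear.{u} m) :=
  ⟨fun a b => ULift.{u} (PLift (a.down.val + 1 = b.down.val))⟩

/-- The relations making the squares of the repetitive quiver of a linear quiver commute. -/
inductive MeshRel (V : Type u) [Quiver.{u} V] : HomRel (Paths (Repetitive V))
  | comm (k : ℤ) {a b c : V} (α : a ⟶ b) (β : b ⟶ c) :
    MeshRel V
      ((Paths.of _).map (Repetitive.arr k β) ≫ (Paths.of _).map (Repetitive.star k β))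
      ((Paths.of _).map (Repetitive.star k α) ≫ (Paths.of _).map (Repetitive.arr (k + 1) α))

/-- The mesh category `M_n`, with objects `(k, l)` for `k ∈ ℤ` and `0 ≤ l ≤ n + 1`. -/
abbrev Mesh (n : ℕ) : Type u := CategoryTheory.Quotient (MeshRel (Linear.{u} (n + 2)))

namespace Mesh

variable {n : ℕ}

/-- The canonical map of quivers to the mesh category. -/
def proj (n : ℕ) : Repetitive (Linear.{u} (n + 2)) ⥤q Mesh.{u} n :=
  Paths.of _ ⋙q (CategoryTheory.Quotient.functor (MeshRel (Linear.{u} (n + 2)))).toPrefunctor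

/-- The object `(k, l)`. -/
def vertex (k : ℤ) (l : Fin (n + 2)) : Mesh.{u} n := (proj n).obj ⟨k, ULift.up l⟩

theorem square_comm (k : ℤ) {a b c : Linear.{u} (n + 2)} (α : a ⟶ b) (β : b ⟶ c) :
    (proj n).map (Repetitive.arr k β) ≫ (proj n).map (Repetitive.star k β) =
      (proj n).map (Repetitive.star k α) ≫ (proj n).map (Repetitive.arr (k + 1) α) :=
  CategoryTheory.Quotient.sound (MeshRel (Linear.{u} (n + 2))) (MeshRel.comm k α β)

end Mesh

/-- The functor on the square given by a commutative square. -/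
def squareFunctor {C : Type u} [Category.{u} C] {x₀₀ x₁₀ x₀₁ x₁₁ : C} (t : x₀₀ ⟶ x₁₀)
    (r : x₁₀ ⟶ x₁₁) (l : x₀₀ ⟶ x₀₁) (b : x₀₁ ⟶ x₁₁) (h : t ≫ r = l ≫ b) : Square.{u} ⥤ C :=
  (Monotone.functor (f := fun x : Square.{u} => x.down.1) (fun _ _ hxy => And.left hxy)).prod'
      (Monotone.functor (f := fun x : Square.{u} => x.down.2) (fun _ _ hxy => And.right hxy)) ⋙
    Functor.uncurry.obj (ComposableArrows.mk₁ (ComposableArrows.homMk₁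
      (F := ComposableArrows.mk₁ l) (G := ComposableArrows.mk₁ r) t b h.symm))

/-- The square with corners `(k, l)`, `(k, l + 1)`, `(k + 1, l - 1)`, `(k + 1, l)`, where
`α : l - 1 ⟶ l` and `β : l ⟶ l + 1`. -/
def Mesh.square {n : ℕ} (k : ℤ) {a b c : Linear.{u} (n + 2)} (α : a ⟶ b) (β : b ⟶ c) :
    Square.{u} ⥤ Mesh.{u} n :=
  squareFunctor _ _ _ _ (Mesh.square_comm k α β)

/-- A labelling exhibiting `Q` as an `A_n`-quiver, that is, a quiver whose underlying graph is the
Dynkin graph `0 - 1 - ⋯ - (n - 1)`: there is exactly one arrow between neighbouring vertices, in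
one of the two directions, and there are no other arrows. -/
structure TypeALabelling (n : ℕ) (Q : Type u) [Quiver.{u} Q] where
  label : Q ≃ Fin n
  unique_arrow : ∀ a b : Q, (label a).val + 1 = (label b).val →
    Nonempty (Unique ((a ⟶ b) ⊕ (b ⟶ a)))
  no_arrow : ∀ a b : Q, (label a).val + 1 ≠ (label b).val → (label b).val + 1 ≠ (label a).val →
    IsEmpty (a ⟶ b)

/-- The two end vertices `e₁, e₂` of an `A_n`-quiver; they coincide for `n = 1`. -/
def TypeALabelling.ends {n : ℕ} {Q : Type u} [Quiver.{u} Q] (lab : TypeALabelling n Q)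
    (hn : 1 ≤ n) : Fin 2 → Q :=
  ![lab.label.symm ⟨0, hn⟩, lab.label.symm ⟨n - 1, Nat.sub_lt hn Nat.one_pos⟩]

/-- Vertices of the quiver obtained from `Q` by attaching two new arrows, starting at `e 0` and
`e 1` and ending at two new vertices. -/
inductive Ext {Q : Type u} (e : Fin 2 → Q) : Type u
  | old (q : Q) : Ext e
  | new (i : Fin 2) : Ext e

def Ext.Arrow {Q : Type u} [Quiver.{u} Q] (e : Fin 2 → Q) : Ext e → Ext e → Type u
  | .old a, .old b => a ⟶ b
  | .old a, .new i => ULift.{u} (PLift (a = e i))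
  | .new _, _ => PEmpty.{u + 1}

instance {Q : Type u} [Quiver.{u} Q] (e : Fin 2 → Q) : Quiver.{u} (Ext e) := ⟨Ext.Arrow e⟩

/-- The embedding of `Q` in the extended quiver. -/
def Ext.incl {Q : Type u} [Quiver.{u} Q] (e : Fin 2 → Q) : Q ⥤q Ext e where
  obj q := .old q
  map {a b} α := show Ext.Arrow e (.old a) (.old b) from α

/-- Isomorphisms of quivers. -/
structure QuiverIso (V : Type u) [Quiver.{u} V] (W : Type u) [Quiver.{u} W] where
  hom : V ⥤q W
  inv : W ⥤q V
  hom_inv : hom ⋙q inv = 𝟭q V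
  inv_hom : inv ⋙q hom = 𝟭q W

/-- The functor `i_Q : Q ⟶ M_n` on the free category of `Q`, depending on an isomorphism `φ`
between the repetitive quivers of the extended quiver of `Q` and of `0 → 1 → ⋯ → n + 1`. -/
def embedding {n : ℕ} {Q : Type u} [Quiver.{u} Q] {e : Fin 2 → Q}
    (φ : QuiverIso (Repetitive (Ext e)) (Repetitive (Linear.{u} (n + 2)))) :
    Paths Q ⥤ Mesh.{u} n :=
  Paths.lift (Ext.incl e ⋙q Repetitive.incl (Ext e) ⋙q φ.hom ⋙q Mesh.proj n)

/-! ### Coherent Auslander–Reiten quivers -/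

/-- The defining conditions of coherent Auslander–Reiten quivers: vanishing on the boundary, and
all mesh squares are bicartesian. -/
structure IsExactAR {D : Prederivator.{u, v, w}} (n : ℕ) (X : D.Diag (Mesh.{u} n)) : Prop where
  zero_bot : ∀ k : ℤ, Limits.IsZero ((D.eval (Mesh.vertex k 0)).obj X)
  zero_top : ∀ k : ℤ, Limits.IsZero ((D.eval (Mesh.vertex k (Fin.last (n + 1)))).obj X)
  cocartesian : ∀ (k : ℤ) {a b c : Linear.{u} (n + 2)} (α : a ⟶ b) (β : b ⟶ c),
    IsCocartesian ((D.restr (Mesh.square k α β)).obj X)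
  cartesian : ∀ (k : ℤ) {a b c : Linear.{u} (n + 2)} (α : a ⟶ b) (β : b ⟶ c),
    IsCartesian ((D.restr (Mesh.square k α β)).obj X)

theorem Prederivator.IsCocartesian.of_iso {D : Prederivator.{u, v, w}} {X Y : D.Diag Square.{u}}
    (h : IsCocartesian X) (i : X ≅ Y) : IsCocartesian Y := by
  obtain ⟨L, adj, hL⟩ := h
  exact ⟨L, adj, L.essImage.prop_of_iso i hL⟩

theorem Prederivator.IsCartesian.of_iso {D : Prederivator.{u, v, w}} {X Y : D.Diag Square.{u}}
    (h : IsCartesian X) (i : X ≅ Y) : IsCartesian Y := by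
  obtain ⟨R, adj, hR⟩ := h
  exact ⟨R, adj, R.essImage.prop_of_iso i hR⟩

theorem IsExactAR.of_iso {D : Prederivator.{u, v, w}} {n : ℕ} {X Y : D.Diag (Mesh.{u} n)}
    (h : IsExactAR n X) (i : X ≅ Y) : IsExactAR n Y where
  zero_bot k := (h.zero_bot k).of_iso ((D.eval _).mapIso i.symm)
  zero_top k := (h.zero_top k).of_iso ((D.eval _).mapIso i.symm)
  cocartesian k _ _ _ α β := (h.cocartesian k α β).of_iso ((D.restr _).mapIso i)
  cartesian k _ _ _ α β := (h.cartesian k α β).of_iso ((D.restr _).mapIso i)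

/-- Morphisms of prederivators commute with restriction functors up to isomorphism. -/
def compRestrIso {D E : Prederivator.{u, v, w}} (G : D.toPseudofunctor ⟶ E.toPseudofunctor)
    {A B : Type u} [Category.{u} A] [Category.{u} B] (f : A ⥤ B) (X : D.Diag B) :
    (component G A).obj ((D.restr f).obj X) ≅ (E.restr f).obj ((component G B).obj X) :=
  (Cat.Hom.toNatIso (G.naturality f.toCatHom.op)).app X

theorem IsExact.isZero {D E : Prederivator.{u, v, w}}
    {G : D.toPseudofunctor ⟶ E.toPseudofunctor} (hG : IsExact G) {X : D.Diag Pt.{u}}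
    (hX : Limits.IsZero X) : Limits.IsZero ((component G Pt).obj X) := by
  obtain ⟨hi⟩ := hG.initial X ⟨hX.isInitial⟩
  obtain ⟨ht⟩ := hG.terminal X ⟨hX.isTerminal⟩
  exact ⟨fun Y => ⟨⟨⟨hi.to Y⟩, fun _ => hi.hom_ext _ _⟩⟩,
    fun Y => ⟨⟨⟨ht.from Y⟩, fun _ => ht.hom_ext _ _⟩⟩⟩

theorem IsExactAR.map {D E : Prederivator.{u, v, w}}
    {G : D.toPseudofunctor ⟶ E.toPseudofunctor} (hG : IsExact G) {n : ℕ}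
    {X : D.Diag (Mesh.{u} n)} (h : IsExactAR n X) :
    IsExactAR n ((component G (Mesh.{u} n)).obj X) where
  zero_bot k := (hG.isZero (h.zero_bot k)).of_iso (compRestrIso G _ X).symm
  zero_top k := (hG.isZero (h.zero_top k)).of_iso (compRestrIso G _ X).symm
  cocartesian k _ _ _ α β :=
    (hG.cocartesian _ (h.cocartesian k α β)).of_iso (compRestrIso G _ X)
  cartesian k _ _ _ α β := (hG.cartesian _ (h.cartesian k α β)).of_iso (compRestrIso G _ X)

/-- An object `X` of `D^{M_n}(A) = D(M_n × A)` belongs to `D^{M_n,ex}(A)` if every `X_a`, `a ∈ A`,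
satisfies the vanishing and exactness conditions. -/
def arProp (D : Prederivator.{u, v, w}) (n : ℕ) :
    (D.shift (Mesh.{u} n)).toPseudofunctor.ObjectProperty where
  prop A X := ∀ a : A.unop,
    IsExactAR (D := D) n ((D.restr (Prod.sectL (Mesh.{u} n) a)).obj X)

instance (D : Prederivator.{u, v, w}) (n : ℕ) : (arProp D n).IsClosedUnderMapObj where
  map_obj {A A'} X hX f a := by
    have e : Prod.sectL (Mesh.{u} n) (f.unop.toFunctor.obj a) =
        Prod.sectL (Mesh.{u} n) a ⋙ (𝟭 (Mesh.{u} n)).prod f.unop.toFunctor := by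
      refine Functor.hext (fun _ => rfl) fun _ _ g => heq_of_eq (Prod.ext rfl ?_)
      exact (f.unop.toFunctor.map_id a).symm
    have h := hX (f.unop.toFunctor.obj a)
    rw [e] at h
    exact h.of_iso ((D.restrComp (Prod.sectL (Mesh.{u} n) a)
      ((𝟭 (Mesh.{u} n)).prod f.unop.toFunctor)).app X)

/-- The prederivator `D^{M_n,ex}` of coherent Auslander–Reiten quivers, a full subprederivator of
`D^{M_n}`. -/
def Prederivator.ar (D : Prederivator.{u, v, w}) (n : ℕ) : Prederivator.{u, v, w} :=
  strictFullSub (D.shift (Mesh.{u} n)) (arProp D n)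

theorem arProp_map {D E : Prederivator.{u, v, w}} (n : ℕ)
    {G : D.toPseudofunctor ⟶ E.toPseudofunctor} (hG : IsExact G) (A : Cat.{u, u}ᵒᵖ)
    (X : (D.shift (Mesh.{u} n)).obj A) (hX : (arProp D n).prop A X) :
    (arProp E n).prop A (((shiftMor (Mesh.{u} n) G).app A).toFunctor.obj X) := fun a =>
  ((hX a).map hG).of_iso (compRestrIso G (Prod.sectL (Mesh.{u} n) a) X)

/-- The morphism `D^{M_n,ex} ⟶ E^{M_n,ex}` induced by an exact morphism. -/
def arMor (n : ℕ) {D E : Prederivator.{u, v, w}} (G : D.toPseudofunctor ⟶ E.toPseudofunctor)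
    (hG : IsExact G) : (D.ar n).toPseudofunctor ⟶ (E.ar n).toPseudofunctor :=
  restrictTrans (arProp D n) (arProp E n) (shiftMor (Mesh.{u} n) G) (arProp_map n hG)

def arModif (n : ℕ) {D E : Prederivator.{u, v, w}} {G H : D.toPseudofunctor ⟶ E.toPseudofunctor}
    (hG : IsExact G) (hH : IsExact H) (m : G ⟶ H) : arMor n G hG ⟶ arMor n H hH :=
  restrictModif (arProp D n) (arProp E n) (shiftModif (Mesh.{u} n) m) (arProp_map n hG)
    (arProp_map n hH)

/-- Action on objects of the 2-functor `D ↦ D^{M_n,ex}`. -/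
abbrev arObj (n : ℕ) (D : StableDerivator.{u, v, w}) : PDer.{u, v, w} := D.pre.ar n

/-- Action on 1-cells of the 2-functor `D ↦ D^{M_n,ex}`. -/
def arHom (n : ℕ) {D E : StableDerivator.{u, v, w}} (G : D ⟶ E) : arObj n D ⟶ arObj n E :=
  InducedBicategory.mkHom
    (arMor n (StableDerivator.ExactMor.mor G) (StableDerivator.ExactMor.exact G))

/-- Action on 2-cells of the 2-functor `D ↦ D^{M_n,ex}`. -/
def arHom₂ (n : ℕ) {D E : StableDerivator.{u, v, w}} {G H : D ⟶ E} (m : G ⟶ H) :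
    arHom n G ⟶ arHom n H :=
  InducedBicategory.mkHom₂
    (arModif n (StableDerivator.ExactMor.exact G) (StableDerivator.ExactMor.exact H)
      (StableDerivator.ExactMor.Hom.modif m))

def arHomId (n : ℕ) (D : StableDerivator.{u, v, w}) : arHom n (𝟙 D) ≅ 𝟙 (arObj n D) :=
  InducedBicategory.isoMk (Pseudofunctor.StrongTrans.isoMk (fun _ => Iso.refl _) fun f =>
    Cat.Hom₂.ext (NatTrans.ext (funext fun _ => id_comp_eq_comp_map_id
      ((arObj n D).map f).toFunctor _)))

def arHomComp (n : ℕ) {D E E' : StableDerivator.{u, v, w}} (G : D ⟶ E) (H : E ⟶ E') :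
    arHom n (G ≫ H) ≅ arHom n G ≫ arHom n H :=
  InducedBicategory.isoMk (Pseudofunctor.StrongTrans.isoMk (fun _ => Iso.refl _) fun f =>
    Cat.Hom₂.ext (NatTrans.ext (funext fun _ => id_comp_eq_comp_map_id
      ((arObj n E').map f).toFunctor _)))

/-- The 2-functor `D ↦ D^{M_n,ex}` on stable derivators and exact morphisms. -/
def arFunctor (n : ℕ) : StableDerivator.{u, v, w} ⥤ᵖ PDer.{u, v, w} where
  obj := arObj n
  map := arHom n
  map₂ := arHom₂ n
  map₂_id _ := rfl
  map₂_comp _ _ := rfl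
  mapId := arHomId n
  mapComp := arHomComp n
  map₂_whisker_left _ _ _ _ := PDer.ext₂ fun _ _ => (id_comp_id _).symm
  map₂_whisker_right _ _ := PDer.ext₂ fun _ _ => (id_comp_id _).symm
  map₂_associator G H K := PDer.ext₂ fun A M =>
    (id_assoc_id ((arHom n K).hom.app A).toFunctor
      (((arHom n G ≫ arHom n H).hom.app A).toFunctor.obj M)).symm
  map₂_left_unitor G := PDer.ext₂ fun A _ =>
    (id_left_id ((arHom n G).hom.app A).toFunctor _).symm
  map₂_right_unitor _ := PDer.ext₂ fun _ _ => (id_comp_id _).symm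

/-! ### Restriction along `i_Q` -/

section

variable {X Y Z Y' : Cat.{u, u}ᵒᵖ} {D E : Prederivator.{u, v, w}}
  (G : D.toPseudofunctor ⟶ E.toPseudofunctor)

theorem naturality_comp_app (f : X ⟶ Y) (g : Y ⟶ Z) (M : D.obj X) :
    (G.naturality (f ≫ g)).hom.toNatTrans.app M ≫
        eqToHom (by rw [E.map_comp]; rfl) =
      eqToHom (by rw [D.map_comp]; rfl) ≫
        (G.naturality g).hom.toNatTrans.app ((D.map f).toFunctor.obj M) ≫
          (E.map g).toFunctor.map ((G.naturality f).hom.toNatTrans.app M) := by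
  have key := congrArg (fun t => t.toNatTrans.app M) (G.naturality_comp f g)
  rw [D.mapComp_eq_eqToIso, E.mapComp_eq_eqToIso] at key
  simpa [eqToIso_app, eqToHom_map] using key

theorem naturality_eq_app {f g : X ⟶ Y} (h : f = g) (M : D.obj X) :
    (G.naturality f).hom.toNatTrans.app M ≫ eqToHom (by rw [h]) =
      eqToHom (by rw [h]) ≫ (G.naturality g).hom.toNatTrans.app M := by
  subst h
  simp

theorem naturality_square_app (f : X ⟶ Y) (g : Y ⟶ Z) (f' : X ⟶ Y') (g' : Y' ⟶ Z)
    (h : f ≫ g = f' ≫ g') (h₁ : D.map f ≫ D.map g = D.map f' ≫ D.map g')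
    (h₂ : E.map f ≫ E.map g = E.map f' ≫ E.map g') (M : D.obj X) :
    (G.naturality g).hom.toNatTrans.app ((D.map f).toFunctor.obj M) ≫
      (E.map g).toFunctor.map ((G.naturality f).hom.toNatTrans.app M) ≫
        (eqToIso h₂).hom.toNatTrans.app ((G.app X).toFunctor.obj M) =
    (G.app Z).toFunctor.map ((eqToIso h₁).hom.toNatTrans.app M) ≫
      (G.naturality g').hom.toNatTrans.app ((D.map f').toFunctor.obj M) ≫
        (E.map g').toFunctor.map ((G.naturality f').hom.toNatTrans.app M) := by
  have e₁ := naturality_comp_app G f g M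
  have e₂ := naturality_comp_app G f' g' M
  have e₃ := naturality_eq_app G h M
  rw [eqToIso_app, eqToIso_app, eqToHom_map]
  have e₁' := (eqToHom_comp_iff _ _ _).mp e₁.symm
  have e₂' := (eqToHom_comp_iff _ _ _).mp e₂.symm
  have e₃' := (comp_eqToHom_iff _ _ _).mp e₃
  rw [e₂', ← Category.assoc, e₁', e₃']
  simp only [Category.assoc, eqToHom_trans, eqToHom_trans_assoc]

theorem map₂_square {f f' : X ⟶ Y} {t' : Y ⟶ Z} {t : X ⟶ Y'} {g g' : Y' ⟶ Z} (η : f ⟶ f')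
    (θ : g ⟶ g') (h : f ≫ t' = t ≫ g) (h' : f' ≫ t' = t ≫ g')
    (hη : η ▷ t' ≫ eqToHom h' = eqToHom h ≫ t ◁ θ)
    (h₁ : D.map f ≫ D.map t' = D.map t ≫ D.map g)
    (h₁' : D.map f' ≫ D.map t' = D.map t ≫ D.map g') :
    D.map₂ η ▷ D.map t' ≫ eqToHom h₁' = eqToHom h₁ ≫ D.map t ◁ D.map₂ θ := by
  have hm : ∀ {k l : X ⟶ Z} (e : k = l), D.map₂ (eqToHom e) = eqToHom (congrArg D.map e) := by
    rintro k _ rfl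
    simp
  have key := congrArg (fun t => D.map₂ t) hη
  simp only [D.map₂_comp, D.map₂_whisker_left, D.map₂_whisker_right, D.mapComp_eq_eqToIso,
    eqToIso.hom, eqToIso.inv, hm, Category.assoc, eqToHom_trans, eqToHom_trans_assoc] at key
  have key' := (eqToHom_comp_iff _ _ _).mp key
  simp only [← Category.assoc] at key'
  have key'' := (comp_eqToHom_iff _ _ _).mp key'
  rw [key'']
  simp only [Category.assoc, eqToHom_trans, eqToHom_refl, Category.comp_id]

end

theorem pad_left {C : Type w} [Category.{v} C] {X Y Z W : C} (f : X ⟶ Y) (g : Y ⟶ Z) (h : Z ⟶ W) :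
    f ≫ 𝟙 _ ≫ g ≫ 𝟙 _ ≫ h ≫ 𝟙 _ = f ≫ g ≫ h := by
  simp

theorem pad_right {C : Type w} [Category.{v} C] {X Y Z W : C} (f : X ⟶ Y) (g : Y ⟶ Z)
    (h : Z ⟶ W) : (𝟙 _ ≫ f ≫ 𝟙 _ ≫ g ≫ 𝟙 _) ≫ h = f ≫ g ≫ h := by
  simp

/-- Restriction `u^* : D^C ⟶ D^B` along `u : B ⥤ C`. -/
def Prederivator.shiftRestr (D : Prederivator.{u, v, w}) {B C : Type u} [Category.{u} B]
    [Category.{u} C] (u : B ⥤ C) : (D.shift C).toPseudofunctor ⟶ (D.shift B).toPseudofunctor :=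
  mkStrictTrans (F := D.shift C) (G := D.shift B)
    (fun A => D.map (u.prod (𝟭 A.unop)).toCatHom.op)
    (fun {A A'} f => by
      exact (D.map_comp _ _).symm.trans (D.map_comp (u.prod (𝟭 A.unop)).toCatHom.op
        ((prodOp B).map f)))
    (fun {A A' f g} η => map₂_square (t := (u.prod (𝟭 A.unop)).toCatHom.op)
      (t' := (u.prod (𝟭 A'.unop)).toCatHom.op) ((prodOp C).map₂ η) ((prodOp B).map₂ η) rfl rfl
      (by
        refine (Category.comp_id _).trans (Eq.trans ?_ (Category.id_comp _).symm)
        refine congrArg Bicategory.Opposite.op2 (Cat.Hom₂.ext (NatTrans.ext (funext fun x => ?_)))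
        exact Prod.ext (u.map_id _).symm rfl) _ _)

/-- Restriction along `u` commutes with the morphisms induced by `G`. -/
def shiftRestrNat {B C : Type u} [Category.{u} B] [Category.{u} C] (u : B ⥤ C)
    {D E : Prederivator.{u, v, w}} (G : D.toPseudofunctor ⟶ E.toPseudofunctor) :
    shiftMor C G ≫ E.shiftRestr u ≅ D.shiftRestr u ≫ shiftMor B G :=
  (Pseudofunctor.StrongTrans.isoMk
    (fun A => G.naturality (u.prod (𝟭 A.unop)).toCatHom.op) fun {A A'} f => by
    ext M
    have key := naturality_square_app G ((prodOp C).map f) (u.prod (𝟭 A'.unop)).toCatHom.op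
      (u.prod (𝟭 A.unop)).toCatHom.op ((prodOp B).map f) rfl
      ((D.map_comp _ _).symm.trans (D.map_comp (u.prod (𝟭 A.unop)).toCatHom.op
        ((prodOp B).map f)))
      ((E.map_comp _ _).symm.trans (E.map_comp (u.prod (𝟭 A.unop)).toCatHom.op
        ((prodOp B).map f))) M
    exact (pad_left _ _ _).trans (key.trans (pad_right _ _ _).symm)).symm

section

variable {C : Type w} [Category.{v} C] {C' : Type w} [Category.{v} C']

theorem incl_nat {C'' : Type w} [Category.{v} C''] (F : C ⥤ C') (K : C'' ⥤ C') {X : C} {Y : C''}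
    (s : F.obj X ⟶ K.obj Y) :
    𝟙 _ ≫ 𝟙 _ ≫ F.map (𝟙 X) ≫ 𝟙 _ ≫ s ≫ 𝟙 _ =
      (𝟙 _ ≫ s ≫ 𝟙 _ ≫ 𝟙 _ ≫ 𝟙 _) ≫ K.map (𝟙 Y) := by
  simp

theorem restr_nat {X X' Y Y' : C} (e : X ≅ Y) (e' : X' ≅ Y') {s : X ⟶ X'} {t : Y ⟶ Y'}
    (h : s ≫ e'.hom = e.hom ≫ t) : t ≫ e'.inv = e.inv ≫ s := by
  rw [Iso.comp_inv_eq, Category.assoc, h, Iso.inv_hom_id_assoc]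

theorem restr_id (F : C ⥤ C') (X : C) :
    (𝟙 _ ≫ 𝟙 _) ≫ 𝟙 _ = F.map (𝟙 X) ≫ 𝟙 _ ≫ 𝟙 _ := by
  simp

theorem id_id_id (C : Type w) [Category.{v} C] (X : C) : 𝟙 X ≫ 𝟙 X = 𝟙 X ≫ 𝟙 X ≫ 𝟙 X := by
  simp

theorem incl_comp (F : C ⥤ C') (X : C) :
    𝟙 (F.obj X) ≫ 𝟙 _ = 𝟙 _ ≫ 𝟙 _ ≫ 𝟙 _ ≫ 𝟙 _ ≫ F.map (𝟙 X) ≫ 𝟙 _ := by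
  simp

theorem restr_comp (F : C ⥤ C') {X : C} {Y Z : C'} (r : F.obj X ⟶ Y) (t : Y ⟶ Z) :
    ((((𝟙 _ ≫ r) ≫ 𝟙 _) ≫ t) ≫ 𝟙 _) ≫ 𝟙 _ = F.map (𝟙 X) ≫ 𝟙 _ ≫ r ≫ 𝟙 _ ≫ t ≫ 𝟙 _ := by
  simp

end

/-- The inclusion `D^{M_n,ex} ⟶ D^{M_n}`. -/
def Prederivator.arIncl (D : Prederivator.{u, v, w}) (n : ℕ) :
    (D.ar n).toPseudofunctor ⟶ (D.shift (Mesh.{u} n)).toPseudofunctor :=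
  (arProp D n).ι

/-- The inclusions commute with the morphisms induced by an exact `G`. -/
def arInclNat (n : ℕ) {D E : Prederivator.{u, v, w}} (G : D.toPseudofunctor ⟶ E.toPseudofunctor)
    (hG : IsExact G) : arMor n G hG ≫ E.arIncl n ≅ D.arIncl n ≫ shiftMor (Mesh.{u} n) G :=
  Pseudofunctor.StrongTrans.isoMk (fun _ => Iso.refl _) fun {A A'} f => by
    ext M
    exact incl_nat ((shiftMor (Mesh.{u} n) G).app A').toFunctor
      ((E.shift (Mesh.{u} n)).map f).toFunctor
      (((shiftMor (Mesh.{u} n) G).naturality f).hom.toNatTrans.app M.obj)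

/-- Restriction along `u : B ⥤ C`, as a pseudonatural transformation between the 2-functors
`D ↦ D^C` and `D ↦ D^B`. -/
def shiftRestr {B C : Type u} [Category.{u} B] [Category.{u} C] (u : B ⥤ C) :
    shiftFunctor.{u, v, w} C ⟶ shiftFunctor B where
  app D := InducedBicategory.mkHom (D.pre.shiftRestr u)
  naturality G := InducedBicategory.isoMk (shiftRestrNat u (StableDerivator.ExactMor.mor G))
  naturality_naturality {D E G H} m := PDer.ext₂ fun A M => by
    have := congrArg (fun t => t.toNatTrans.app M)
      (m.modif.as.naturality (u.prod (𝟭 A.unop)).toCatHom.op)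
    exact restr_nat ((Cat.Hom.toNatIso (G.mor.naturality (u.prod (𝟭 A.unop)).toCatHom.op)).app M)
      ((Cat.Hom.toNatIso (H.mor.naturality (u.prod (𝟭 A.unop)).toCatHom.op)).app M) this
  naturality_id D := PDer.ext₂ fun A M => by
    exact restr_id _ _
  naturality_comp {D E E'} G H := PDer.ext₂ fun A M => by
    exact restr_comp (E'.pre.map (u.prod (𝟭 A.unop)).toCatHom.op).toFunctor
      ((H.mor.naturality (u.prod (𝟭 A.unop)).toCatHom.op).inv.toNatTrans.app
        ((G.mor.app (op (Cat.of (C × A.unop)))).toFunctor.obj M))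
      ((H.mor.app (op (Cat.of (B × A.unop)))).toFunctor.map
        ((G.mor.naturality (u.prod (𝟭 A.unop)).toCatHom.op).inv.toNatTrans.app M))

/-- The inclusions `D^{M_n,ex} ⟶ D^{M_n}`, pseudonaturally in `D`. -/
def arIncl (n : ℕ) : arFunctor.{u, v, w} n ⟶ shiftFunctor (Mesh.{u} n) where
  app D := InducedBicategory.mkHom (D.pre.arIncl n)
  naturality G := InducedBicategory.isoMk
    (arInclNat n (StableDerivator.ExactMor.mor G) (StableDerivator.ExactMor.exact G))
  naturality_naturality {D E G H} m := PDer.ext₂ fun A M => by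
    exact (Category.comp_id _).trans (Category.id_comp _).symm
  naturality_id D := PDer.ext₂ fun A M => by
    exact id_id_id (((shiftFunctor (Mesh.{u} n)).obj D).obj A) M.obj
  naturality_comp {D E E'} G H := PDer.ext₂ fun A M => by
    exact incl_comp ((shiftMor (Mesh.{u} n) H.mor).app A).toFunctor
      (((shiftMor (Mesh.{u} n) G.mor).app A).toFunctor.obj M.obj)

/-- The restriction `i_Q^* : D^{M_n,ex} ⟶ D^Q`, pseudonaturally in `D`. -/
def restrAlong {n : ℕ} {Q : Type u} [Quiver.{u} Q] {e : Fin 2 → Q}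
    (φ : QuiverIso (Repetitive (Ext e)) (Repetitive (Linear.{u} (n + 2)))) :
    arFunctor.{u, v, w} n ⟶ shiftFunctor (Paths Q) :=
  arIncl n ≫ shiftRestr (embedding φ)

end ARDerivator

/-! The mesh category is thin: `2k + l` grades it, and two paths with the same ends are related by
mesh squares. Sending `(k, l)` to `(k, k + l)` identifies it, up to equivalence, with the poset of
points `x ≤ y ≤ x + n + 1` of the plane. The vertices `(k, 0)` and `(k, n + 1)` become the two
boundary lines, and the mesh squares become the unit squares whose lower left corner is an interior
point.

The extended quiver gives every vertex `q` of `Q` at least two neighbours. This forces any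
isomorphism `φ` of repetitive quivers to commute with the translation `k ↦ k + 1` on the copies of
`q`. Hence `i_Q` meets each level `y - x = 1, …, n` exactly once, and it moves by one step between
neighbouring levels: the image is a section of the strip. The free category on `Q` is equivalent to
the full subposet on the section, and only the shape of the section remembers the orientation
(`TypeALabelling.isQuiverSection`, `IsQuiverSection.exists_equivalence`). An isomorphism `φ` exists
because the reversed arrows can be absorbed by a height function (`IsLineQuiver.nonempty_iso`).

Exact diagrams on the strip are determined by their values on a section
(`IsStableDerivator.restrictsToEquiv_section`). Right Kan extension adds zeros at the boundary
points lying below no point of the section. Left Kan extension then adds zeros on the rest of the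
boundary and fills the part of the strip after the section by cocartesian squares. Right Kan
extension finally fills the part before the section by cartesian squares. These inclusions are fully
faithful, so the Kan extensions are too. The images consist of exact diagrams by a detection
criterion for squares. They contain all exact diagrams because a map of exact diagrams that is
invertible on the smaller shape is invertible everywhere, by induction over unit squares. Stability
lets cartesian and cocartesian squares be exchanged between the steps.

The parameter category `A` is dealt with by applying this to the shifted derivator `D.shift A`,
which is again stable. So `i_Q^*` is an equivalence of categories at every `D` and every `A`.
Stability of `D.ar n` is transported along this equivalence, and a pseudonatural transformation
which is pointwise an equivalence is part of an adjoint equivalence; its inverse supplies `F_Q`.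

Kan extensions are handled one object at a time, through universal arrows (`IsUniv`, `IsCouniv`)
instead of chosen adjoint functors. The pointwise axiom then says that universal arrows along `f`
induce universal arrows over the slices. -/

namespace ARDerivator

/-! ### Equivalences in bicategories from pointwise equivalences. -/

namespace Bicat
universe w₁ w₂ v₁ v₂ u₁ u₂

variable {B : Type u₁} [Bicategory.{w₁, v₁} B] {C : Type u₂} [Bicategory.{w₂, v₂} C]

/-- The adjunction underlying an adjoint equivalence. -/
def equivAdj {a b : C} (e : a ≌ b) : Bicategory.Adjunction e.hom e.inv where
  unit := e.unit.hom
  counit := e.counit.hom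
  left_triangle := e.left_triangle_hom
  right_triangle := e.right_triangle_hom

variable {a b c d : C} {l₁ : a ⟶ b} {r₁ : b ⟶ a} {l₂ : c ⟶ d} {r₂ : d ⟶ c}

theorem mateEquiv_naturality_left (adj₁ : l₁ ⊣ r₁) (adj₂ : l₂ ⊣ r₂) {g g' : a ⟶ c} {h : b ⟶ d}
    (η : g ⟶ g') (α : g' ≫ l₂ ⟶ l₁ ≫ h) :
    mateEquiv adj₁ adj₂ (η ▷ l₂ ≫ α) = r₁ ◁ η ≫ mateEquiv adj₁ adj₂ α := by
  rw [mateEquiv_apply', mateEquiv_apply']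
  calc
    _ = 𝟙 _ ⊗≫ r₁ ◁ (g ◁ adj₂.unit ≫ η ▷ (l₂ ≫ r₂)) ⊗≫ r₁ ◁ α ▷ r₂ ⊗≫
        adj₁.counit ▷ h ▷ r₂ ⊗≫ 𝟙 _ := by bicategory
    _ = _ := by
      rw [whisker_exchange]
      bicategory

theorem mateEquiv_naturality_right (adj₁ : l₁ ⊣ r₁) (adj₂ : l₂ ⊣ r₂) {g : a ⟶ c} {h h' : b ⟶ d}
    (η : h ⟶ h') (α : g ≫ l₂ ⟶ l₁ ≫ h) :
    mateEquiv adj₁ adj₂ (α ≫ l₁ ◁ η) = mateEquiv adj₁ adj₂ α ≫ η ▷ r₂ := by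
  rw [mateEquiv_apply', mateEquiv_apply']
  calc
    _ = 𝟙 _ ⊗≫ r₁ ◁ g ◁ adj₂.unit ⊗≫ r₁ ◁ α ▷ r₂ ⊗≫ ((r₁ ≫ l₁) ◁ η ≫
        adj₁.counit ▷ h') ▷ r₂ ⊗≫ 𝟙 _ := by bicategory
    _ = _ := by
      rw [whisker_exchange]
      bicategory

/-- This is what makes the units form a modification in `EquivTrans.unitIso`. Once the mate is
unfolded and interchange is applied, the only input is the left triangle identity of `adj₁`. For the
counits below it is the left triangle identity of `adj₂`. -/
theorem unit_comp_mateEquiv (adj₁ : l₁ ⊣ r₁) (adj₂ : l₂ ⊣ r₂) {g : a ⟶ c} {h : b ⟶ d}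
    (α : g ≫ l₂ ⟶ l₁ ≫ h) :
    adj₁.unit ▷ g ≫ (α_ _ _ _).hom ≫ l₁ ◁ mateEquiv adj₁ adj₂ α =
      (λ_ g).hom ≫ (ρ_ g).inv ≫ g ◁ adj₂.unit ≫ (α_ _ _ _).inv ≫ α ▷ r₂ ≫ (α_ _ _ _).hom := by
  rw [mateEquiv_apply']
  calc
    _ = 𝟙 _ ⊗≫ (adj₁.unit ▷ (g ≫ 𝟙 _) ≫ (l₁ ≫ r₁) ◁ g ◁ adj₂.unit) ⊗≫ l₁ ◁ r₁ ◁ α ▷ r₂ ⊗≫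
        l₁ ◁ adj₁.counit ▷ h ▷ r₂ ⊗≫ 𝟙 _ := by bicategory
    _ = 𝟙 _ ⊗≫ g ◁ adj₂.unit ⊗≫ (adj₁.unit ▷ (g ≫ l₂) ≫ (l₁ ≫ r₁) ◁ α) ▷ r₂ ⊗≫
        l₁ ◁ adj₁.counit ▷ h ▷ r₂ ⊗≫ 𝟙 _ := by
      rw [← whisker_exchange]
      bicategory
    _ = 𝟙 _ ⊗≫ g ◁ adj₂.unit ⊗≫ α ▷ r₂ ⊗≫
        leftZigzag adj₁.unit adj₁.counit ▷ (h ≫ r₂) ⊗≫ 𝟙 _ := by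
      rw [← whisker_exchange]
      bicategory
    _ = _ := by
      rw [adj₁.left_triangle]
      bicategory

theorem mateEquiv_comp_counit (adj₁ : l₁ ⊣ r₁) (adj₂ : l₂ ⊣ r₂) {g : a ⟶ c} {h : b ⟶ d}
    (α : g ≫ l₂ ⟶ l₁ ≫ h) :
    mateEquiv adj₁ adj₂ α ▷ l₂ ≫ (α_ _ _ _).hom ≫ h ◁ adj₂.counit =
      (α_ _ _ _).hom ≫ r₁ ◁ α ≫ (α_ _ _ _).inv ≫ adj₁.counit ▷ h ≫ (λ_ h).hom ≫ (ρ_ h).inv := by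
  rw [mateEquiv_apply']
  calc
    _ = 𝟙 _ ⊗≫ r₁ ◁ g ◁ adj₂.unit ▷ l₂ ⊗≫ r₁ ◁ α ▷ (r₂ ≫ l₂) ⊗≫
        (adj₁.counit ▷ (h ≫ r₂ ≫ l₂) ≫ 𝟙 _ ◁ h ◁ adj₂.counit) ⊗≫ 𝟙 _ := by bicategory
    _ = 𝟙 _ ⊗≫ r₁ ◁ g ◁ adj₂.unit ▷ l₂ ⊗≫ r₁ ◁ (α ▷ (r₂ ≫ l₂) ≫ (l₁ ≫ h) ◁ adj₂.counit) ⊗≫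
        adj₁.counit ▷ h ⊗≫ 𝟙 _ := by
      rw [← whisker_exchange]
      bicategory
    _ = 𝟙 _ ⊗≫ (r₁ ≫ g) ◁ leftZigzag adj₂.unit adj₂.counit ⊗≫ r₁ ◁ α ⊗≫
        adj₁.counit ▷ h ⊗≫ 𝟙 _ := by
      rw [← whisker_exchange]
      bicategory
    _ = _ := by
      rw [adj₂.left_triangle]
      bicategory

/-- The mate is `α` pasted with a unit and a counit, and these are invertible for an equivalence. -/
theorem isIso_mateEquiv (e₁ : a ≌ b) (e₂ : c ≌ d) {g : a ⟶ c} {h : b ⟶ d}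
    (α : g ≫ e₂.hom ⟶ e₁.hom ≫ h) [IsIso α] : IsIso (mateEquiv (equivAdj e₁) (equivAdj e₂) α) := by
  rw [mateEquiv_apply']
  dsimp only [equivAdj, bicategoricalComp]
  infer_instance

section Pointwise

variable {F G : B ⥤ᵖ C} (e : ∀ a, F.obj a ≌ G.obj a)

/-- A strong transformation whose components underlie the adjoint equivalences `e`. -/
structure EquivTrans where
  nat {a b : B} (f : a ⟶ b) : F.map f ≫ (e b).hom ≅ (e a).hom ≫ G.map f
  nat_nat {a b : B} {f g : a ⟶ b} (η : f ⟶ g) :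
    F.map₂ η ▷ (e b).hom ≫ (nat g).hom = (nat f).hom ≫ (e a).hom ◁ G.map₂ η
  nat_id (a : B) : (nat (𝟙 a)).hom ≫ (e a).hom ◁ (G.mapId a).hom =
    (F.mapId a).hom ▷ (e a).hom ≫ (λ_ _).hom ≫ (ρ_ _).inv
  nat_comp {a b c : B} (f : a ⟶ b) (g : b ⟶ c) :
    (nat (f ≫ g)).hom ≫ (e a).hom ◁ (G.mapComp f g).hom =
      (F.mapComp f g).hom ▷ (e c).hom ≫ leftAdjointSquare.vcomp (nat f).hom (nat g).hom

namespace EquivTrans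

variable {e} (θ : EquivTrans e)

def trans : F ⟶ G where
  app a := (e a).hom
  naturality := θ.nat
  naturality_naturality := θ.nat_nat
  naturality_id := θ.nat_id
  naturality_comp f g := by
    rw [θ.nat_comp]
    rfl

/-- The mate of the structure 2-cell at `f`. -/
def mate {a b : B} (f : a ⟶ b) : (e a).inv ≫ F.map f ⟶ G.map f ≫ (e b).inv :=
  mateEquiv (equivAdj (e a)) (equivAdj (e b)) (θ.nat f).hom

instance {a b : B} (f : a ⟶ b) : IsIso (θ.mate f) :=
  isIso_mateEquiv _ _ _

theorem mate_nat {a b : B} {f g : a ⟶ b} (η : f ⟶ g) :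
    (e a).inv ◁ F.map₂ η ≫ θ.mate g = θ.mate f ≫ G.map₂ η ▷ (e b).inv :=
  (mateEquiv_naturality_left (equivAdj (e a)) (equivAdj (e b)) _ _).symm.trans
    ((congrArg _ (θ.nat_nat η)).trans (mateEquiv_naturality_right _ _ _ _))

theorem mate_id (a : B) :
    θ.mate (𝟙 a) ≫ (G.mapId a).hom ▷ (e a).inv =
      (e a).inv ◁ (F.mapId a).hom ≫ (ρ_ _).hom ≫ (λ_ _).inv := by
  refine (mateEquiv_naturality_right _ _ _ _).symm.trans ?_
  rw [θ.nat_id, mateEquiv_naturality_left, mateEquiv_leftUnitor_hom_rightUnitor_inv]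

theorem mate_comp {a b c : B} (f : a ⟶ b) (g : b ⟶ c) :
    θ.mate (f ≫ g) ≫ (G.mapComp f g).hom ▷ (e c).inv =
      (e a).inv ◁ (F.mapComp f g).hom ≫ (α_ _ _ _).inv ≫ θ.mate f ▷ F.map g ≫ (α_ _ _ _).hom ≫
        G.map f ◁ θ.mate g ≫ (α_ _ _ _).inv := by
  refine (mateEquiv_naturality_right _ _ _ _).symm.trans ?_
  rw [θ.nat_comp, mateEquiv_naturality_left, mateEquiv_vcomp (equivAdj (e a)) (equivAdj (e b))]
  rfl

/-- The inverse transformation. -/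
noncomputable def inv : G ⟶ F where
  app a := (e a).inv
  naturality f := (asIso (θ.mate f)).symm
  naturality_naturality η := by
    rw [Iso.symm_hom, Iso.symm_hom, Iso.comp_inv_eq, Category.assoc, Iso.eq_inv_comp]
    exact (θ.mate_nat η).symm
  naturality_id a := by
    rw [Iso.symm_hom, Iso.inv_comp_eq, asIso_hom, ← Category.assoc, θ.mate_id]
    simp
  naturality_comp f g := by
    rw [Iso.symm_hom, Iso.symm_hom, Iso.symm_hom, Iso.inv_comp_eq, asIso_hom, ← Category.assoc,
      θ.mate_comp]
    simp

noncomputable def unitIso : 𝟙 F ≅ θ.trans ≫ θ.inv :=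
  Pseudofunctor.StrongTrans.isoMk (fun a => (e a).unit) fun {a b} f => by
    have key := unit_comp_mateEquiv (equivAdj (e a)) (equivAdj (e b)) (θ.nat f).hom
    change F.map f ◁ (e b).unit.hom ≫ (α_ _ _ _).inv ≫ (θ.nat f).hom ▷ (e b).inv ≫
      (α_ _ _ _).hom ≫ (e a).hom ◁ CategoryTheory.inv (θ.mate f) ≫ (α_ _ _ _).inv =
        ((ρ_ _).hom ≫ (λ_ _).inv) ≫ (e a).unit.hom ▷ F.map f
    change (e a).unit.hom ▷ F.map f ≫ (α_ _ _ _).hom ≫ (e a).hom ◁ θ.mate f = _ at key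
    -- The structure 2-cells of `inv` are inverses of mates, so the equation is tested after
    -- composing with the mate itself.
    rw [← inv_whiskerLeft, ← cancel_mono ((α_ _ _ _).hom ≫ (e a).hom ◁ θ.mate f)]
    simp only [Category.assoc, key]
    simp [equivAdj]

noncomputable def counitIso : θ.inv ≫ θ.trans ≅ 𝟙 G :=
  Pseudofunctor.StrongTrans.isoMk (fun a => (e a).counit) fun {a b} f => by
    have key := mateEquiv_comp_counit (equivAdj (e a)) (equivAdj (e b)) (θ.nat f).hom
    change G.map f ◁ (e b).counit.hom ≫ (ρ_ _).hom ≫ (λ_ _).inv =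
      ((α_ _ _ _).inv ≫ CategoryTheory.inv (θ.mate f) ▷ (e b).hom ≫ (α_ _ _ _).hom ≫
        (e a).inv ◁ (θ.nat f).hom ≫ (α_ _ _ _).inv) ≫ (e a).counit.hom ▷ G.map f
    change θ.mate f ▷ (e b).hom ≫ _ = _ at key
    rw [← inv_whiskerRight]
    have key' := (IsIso.eq_inv_comp _).mpr key
    have key'' := (Iso.eq_inv_comp _).mpr key'
    dsimp only [equivAdj] at key''
    rw [key'']
    simp

end EquivTrans

/-- A strong transformation whose components are equivalences is an equivalence. -/
theorem exists_equivalence (θ : F ⟶ G) (h : ∀ a, ∃ e : F.obj a ≌ G.obj a, e.hom = θ.app a) :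
    ∃ e : F ≌ G, e.hom = θ := by
  obtain ⟨app, nat, nn, ni, nc⟩ := θ
  choose e he using h
  obtain rfl : (fun a => (e a).hom) = app := funext he
  let θ' : EquivTrans e := ⟨nat, nn, ni, nc⟩
  -- Only the counit is corrected to obtain the triangle identities; both 1-cells are kept, hence
  -- `rfl`.
  exact ⟨.mkOfAdjointifyCounit θ'.unitIso θ'.counitIso, rfl⟩

end Pointwise

/-- A functor which is an equivalence, as an equivalence in the 2-category of categories. -/
theorem exists_equivalence_cat {X Y : Cat.{v₁, u₁}} (F : X ⟶ Y) (h : F.toFunctor.IsEquivalence) :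
    ∃ e : Bicategory.Equivalence X Y, e.hom = F := by
  let E := F.toFunctor.asEquivalence
  exact ⟨.mkOfAdjointifyCounit (f := F) (g := E.inverse.toCatHom)
    (Cat.Hom.isoMk E.unitIso) (Cat.Hom.isoMk E.counitIso), rfl⟩

theorem exists_equivalence_induced {A : Type*} {K : A → C} {X Y : InducedBicategory C K}
    (f : X ⟶ Y) (h : ∃ e : K X ≌ K Y, e.hom = f.hom) : ∃ e : X ≌ Y, e.hom = f := by
  obtain ⟨e, he⟩ := h
  exact ⟨.mkOfAdjointifyCounit (f := f) (g := InducedBicategory.mkHom e.inv)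
    (InducedBicategory.isoMk (e.unit ≪≫ eqToIso (by rw [he]; rfl)))
    (InducedBicategory.isoMk (eqToIso (by rw [he]; rfl) ≪≫ e.counit)), rfl⟩

theorem exists_equivalence_symm {a b : C} {f : a ⟶ b} (h : ∃ e : a ≌ b, e.hom = f) :
    ∃ e : b ≌ a, e.inv = f := by
  obtain ⟨e, rfl⟩ := h
  exact ⟨.mkOfAdjointifyCounit (f := e.inv) (g := e.hom) e.counit.symm e.unit.symm, rfl⟩

end Bicat

/-- A morphism of 2-functors to prederivators is an equivalence if it is so pointwise. -/
theorem exists_pder_equivalence {F G : StableDerivator.{u, v, w} ⥤ᵖ PDer.{u, v, w}} (θ : F ⟶ G)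
    (h : ∀ D A, (((θ.app D).hom.app A).toFunctor).IsEquivalence) :
    ∃ e : Bicategory.Equivalence G F, e.inv = θ :=
  Bicat.exists_equivalence_symm (Bicat.exists_equivalence θ fun D =>
    Bicat.exists_equivalence_induced _ (Bicat.exists_equivalence _ fun A =>
      Bicat.exists_equivalence_cat _ (h D A)))


/-! ### Universal arrows and adjunctions. -/

section Universal

universe v₁ v₂ v₃ u₁ u₂ u₃

variable {𝒞 : Type u₁} [Category.{v₁} 𝒞] {𝒟 : Type u₂} [Category.{v₂} 𝒟]
  {ℰ : Type u₃} [Category.{v₃} ℰ]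

/-- `η : X ⟶ R L` is a universal arrow from `X` to `R`. -/
def IsUniv (R : 𝒞 ⥤ 𝒟) {X : 𝒟} {L : 𝒞} (η : X ⟶ R.obj L) : Prop :=
  ∀ Z, Function.Bijective fun g : L ⟶ Z => η ≫ R.map g

/-- `c : R L ⟶ X` is a universal arrow from `R` to `X`. -/
def IsCouniv (R : 𝒞 ⥤ 𝒟) {X : 𝒟} {L : 𝒞} (c : R.obj L ⟶ X) : Prop :=
  ∀ Z, Function.Bijective fun g : Z ⟶ L => R.map g ≫ c

namespace IsUniv

variable {R : 𝒞 ⥤ 𝒟} {X : 𝒟} {L : 𝒞}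

theorem of_adj {F : 𝒟 ⥤ 𝒞} (adj : F ⊣ R) (X : 𝒟) : IsUniv R (adj.unit.app X) := fun Z => by
  refine (congrArg Function.Bijective ?_).mpr (adj.homEquiv X Z).bijective
  exact funext fun g => (adj.homEquiv_unit X Z g).symm

theorem exists_of_isRightAdjoint (R : 𝒞 ⥤ 𝒟) [R.IsRightAdjoint] (X : 𝒟) :
    ∃ (L : 𝒞) (η : X ⟶ R.obj L), IsUniv R η :=
  ⟨_, _, of_adj (Adjunction.ofIsRightAdjoint R) X⟩

theorem comp_iso {η : X ⟶ R.obj L} (h : IsUniv R η) {L' : 𝒞} (g : L ⟶ L') [IsIso g] :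
    IsUniv R (η ≫ R.map g) := fun Z => by
  convert (h Z).comp ((asIso g).homFromEquiv (Z := Z)).symm.bijective using 1
  funext k
  simp

theorem iso_comp {η : X ⟶ R.obj L} (h : IsUniv R η) {X' : 𝒟} (g : X' ⟶ X) [IsIso g] :
    IsUniv R (g ≫ η) := fun Z => by
  convert ((asIso g).homFromEquiv (Z := R.obj Z)).symm.bijective.comp (h Z) using 1
  funext k
  simp

theorem comp_iso_iff (η : X ⟶ R.obj L) {L' : 𝒞} (g : L ⟶ L') [IsIso g] :
    IsUniv R (η ≫ R.map g) ↔ IsUniv R η :=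
  ⟨fun h => by simpa [← R.map_comp] using h.comp_iso (inv g), fun h => h.comp_iso g⟩

theorem iso_comp_iff (η : X ⟶ R.obj L) {X' : 𝒟} (g : X' ⟶ X) [IsIso g] :
    IsUniv R (g ≫ η) ↔ IsUniv R η :=
  ⟨fun h => by simpa using h.iso_comp (inv g), fun h => h.iso_comp g⟩

theorem isIso_of_comp {η : X ⟶ R.obj L} (h : IsUniv R η) {L' : 𝒞} (g : L ⟶ L')
    (h' : IsUniv R (η ≫ R.map g)) : IsIso g := by
  obtain ⟨k, hk⟩ := (h' L).2 η
  refine ⟨k, (h L).1 ?_, (h' L').1 ?_⟩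
  · simpa using hk
  · have := congrArg (· ≫ R.map g) hk
    simpa using this

theorem exists_fac {η : X ⟶ R.obj L} (h : IsUniv R η) {Z : 𝒞} (k : X ⟶ R.obj Z) :
    ∃ g : L ⟶ Z, η ≫ R.map g = k :=
  (h Z).2 k

/-- The composite of universal arrows; the first one can be cancelled. -/
theorem comp_iff {S : 𝒟 ⥤ ℰ} {Y : ℰ} {η : Y ⟶ S.obj X} (h : IsUniv S η) (θ : X ⟶ R.obj L) :
    IsUniv (R ⋙ S) (η ≫ S.map θ) ↔ IsUniv R θ := by
  refine forall_congr' fun Z => ?_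
  rw [← Function.Bijective.of_comp_iff' (h (R.obj Z))]
  refine iff_of_eq (congrArg _ (funext fun g => ?_))
  simp

/-- Both objects are free on their images under `R`. If `R.map g` is invertible, it is a universal
arrow from `R L` to `L'` as well, and `g` is the comparison of two universal arrows. -/
theorem isIso_of_isIso_map {L L' : 𝒞} (h : IsUniv R (𝟙 (R.obj L))) (h' : IsUniv R (𝟙 (R.obj L')))
    (g : L ⟶ L') [IsIso (R.map g)] : IsIso g := by
  refine h.isIso_of_comp g ?_
  have := h'.iso_comp (R.map g)
  simpa using this

theorem of_natIso {R' : 𝒞 ⥤ 𝒟} (i : R ≅ R') {η : X ⟶ R.obj L} (h : IsUniv R η) :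
    IsUniv R' (η ≫ i.hom.app L) := fun Z => by
  convert ((i.app Z).homToEquiv (Z := X)).bijective.comp (h Z) using 1
  funext k
  simp

end IsUniv

/-- Bijectivity of a left adjoint on morphisms into objects with invertible unit. -/
theorem bijective_map_of_isIso_unit {F : 𝒞 ⥤ 𝒟} {G : 𝒟 ⥤ 𝒞} (adj : F ⊣ G) (Y E : 𝒞)
    [IsIso (adj.unit.app E)] : Function.Bijective fun g : Y ⟶ E => F.map g := by
  rw [← Function.Bijective.of_comp_iff' (adj.homEquiv Y (F.obj E)).bijective]
  refine (congrArg Function.Bijective (funext fun g => ?_)).mpr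
    ((asIso (adj.unit.app E)).homToEquiv (Z := Y)).bijective
  simp [adj.homEquiv_unit]

theorem bijective_map_of_isIso_counit {F : 𝒞 ⥤ 𝒟} {G : 𝒟 ⥤ 𝒞} (adj : F ⊣ G) (Y E : 𝒟)
    [IsIso (adj.counit.app E)] : Function.Bijective fun g : E ⟶ Y => G.map g := by
  rw [← Function.Bijective.of_comp_iff' (adj.homEquiv (G.obj E) Y).symm.bijective]
  refine (congrArg Function.Bijective (funext fun g => ?_)).mpr
    ((asIso (adj.counit.app E)).homFromEquiv (Z := Y)).symm.bijective
  simp [adj.homEquiv_counit]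

end Universal

/-! ### Pasting calculus for squares of categories and restriction functors. -/

theorem paste_aux {𝒞 : Type w} [Category.{v} 𝒞] {O₁ O₂ O₃ O₄ P₁ P₂ P₃ P₄ R₁ R₂ R₃ R₄ : 𝒞}
    (a : O₁ ≅ O₂) (b : O₂ ≅ O₃) (c : O₁ ≅ O₄) (d : O₄ ≅ O₃) (h : a.hom ≫ b.hom = c.hom ≫ d.hom)
    (a' : P₁ ≅ P₂) (b' : P₂ ≅ P₃) (c' : P₁ ≅ P₄) (d' : P₄ ≅ P₃)
    (h' : a'.hom ≫ b'.hom = c'.hom ≫ d'.hom)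
    (x : R₁ ≅ R₂) (y : R₂ ≅ R₃) (z : R₁ ≅ R₄) (t : R₄ ≅ R₃)
    (k : x.hom ≫ y.hom = z.hom ≫ t.hom) (r : O₄ ⟶ P₄) (s : P₂ ⟶ R₂) :
    a.inv ≫ ((c.hom ≫ r ≫ c'.inv) ≫ a'.hom ≫ s ≫ x.inv) ≫ z.hom ≫ t.hom =
      b.hom ≫ (d.inv ≫ r ≫ d'.hom) ≫ b'.inv ≫ s ≫ y.hom := by
  have h₁ : a.inv ≫ c.hom = b.hom ≫ d.inv := by
    rw [Iso.inv_comp_eq, ← Category.assoc, Iso.eq_comp_inv, h]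
  have h₂ : c'.inv ≫ a'.hom = d'.hom ≫ b'.inv := by
    rw [Iso.inv_comp_eq, ← Category.assoc, Iso.eq_comp_inv, h']
  have h₃ : x.inv ≫ z.hom ≫ t.hom = y.hom := by
    rw [← k, Iso.inv_hom_id_assoc]
  have := congr((($h₁ ≫ r) ≫ $h₂) ≫ s ≫ $h₃)
  simpa only [Category.assoc] using this

namespace Prederivator

variable (D : Prederivator.{u, v, w})

section Calculus

variable {A B C E J : Type u} [Category.{u} A] [Category.{u} B] [Category.{u} C] [Category.{u} E]
  [Category.{u} J]

theorem restrTrans_id (f : A ⥤ B) : D.restrTrans (𝟙 f) = 𝟙 _ :=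
  congrArg Cat.Hom₂.toNatTrans (D.map₂_id f.toCatHom.op)

theorem restrTrans_comp {f g h : A ⥤ B} (α : f ⟶ g) (β : g ⟶ h) :
    D.restrTrans (α ≫ β) = D.restrTrans α ≫ D.restrTrans β :=
  congrArg Cat.Hom₂.toNatTrans (D.map₂_comp (op2 α.toCatHom₂) (op2 β.toCatHom₂))

theorem restrComp_hom_app (f : A ⥤ B) (g : B ⥤ C) (X : D.Diag C) :
    (D.restrComp f g).hom.app X = eqToHom (by
      exact congrArg (fun t => t.toFunctor.obj X) (D.map_comp g.toCatHom.op f.toCatHom.op)) := by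
  refine (congrArg (fun t => t.hom.toNatTrans.app X)
    (D.mapComp_eq_eqToIso g.toCatHom.op f.toCatHom.op)).trans ?_
  exact eqToIso_app _ _

theorem restrComp_inv_app (f : A ⥤ B) (g : B ⥤ C) (X : D.Diag C) :
    (D.restrComp f g).inv.app X = eqToHom (by
      exact congrArg (fun t => t.toFunctor.obj X) (D.map_comp g.toCatHom.op f.toCatHom.op).symm) := by
  have h := (D.restrComp f g).inv_hom_id_app X
  rw [restrComp_hom_app] at h
  exact ((comp_eqToHom_iff _ _ _).mp h).trans (Category.id_comp _)

/-- A prederivator reverses 1-cells, so left and right whiskering are exchanged. -/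
theorem restrTrans_whiskerRight {f f' : A ⥤ B} (α : f ⟶ f') (g : B ⥤ C) :
    D.restrTrans (Functor.whiskerRight α g) =
      (D.restrComp f g).hom ≫ Functor.whiskerLeft (D.restr g) (D.restrTrans α) ≫
        (D.restrComp f' g).inv :=
  congrArg Cat.Hom₂.toNatTrans (D.map₂_whisker_left g.toCatHom.op (op2 α.toCatHom₂))

theorem restrTrans_whiskerLeft (f : A ⥤ B) {g g' : B ⥤ C} (α : g ⟶ g') :
    D.restrTrans (Functor.whiskerLeft f α) =
      (D.restrComp f g).hom ≫ Functor.whiskerRight (D.restrTrans α) (D.restr f) ≫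
        (D.restrComp f g').inv :=
  congrArg Cat.Hom₂.toNatTrans (D.map₂_whisker_right (op2 α.toCatHom₂) f.toCatHom.op)

/-- `id^*` is the identity. -/
abbrev restrId (A : Type u) [Category.{u} A] : D.restr (𝟭 A) ≅ 𝟭 _ :=
  Cat.Hom.toNatIso (D.mapId (op (Cat.of A)))

/-- Strictness turns all these coherence isomorphisms into `eqToHom`, so any two composites with the
same ends agree. -/
theorem restrComp_assoc (f : A ⥤ B) (g : B ⥤ C) (h : C ⥤ E) (X : D.Diag E) :
    (D.restrComp (f ⋙ g) h).hom.app X ≫ (D.restrComp f g).hom.app ((D.restr h).obj X) =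
      (D.restrComp f (g ⋙ h)).hom.app X ≫ (D.restr f).map ((D.restrComp g h).hom.app X) := by
  have h₁ : (D.restr f).map ((D.restrComp g h).hom.app X) = eqToHom (by
      exact congrArg (fun t => (D.restr f).obj (t.toFunctor.obj X))
        (D.map_comp h.toCatHom.op g.toCatHom.op)) := by
    rw [restrComp_hom_app]
    exact eqToHom_map _ _
  rw [h₁]
  simp only [restrComp_hom_app]
  exact (eqToHom_trans _ _).trans (eqToHom_trans _ _).symm

/-- The adjunction `r ⊣ l` in the opposite of the 2-category of categories. -/
def opAdj {l : A ⥤ B} {r : B ⥤ A} (adj : l ⊣ r) :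
    Bicategory.Adjunction r.toCatHom.op l.toCatHom.op where
  unit := op2 (.ofNatTrans adj.unit)
  counit := op2 (.ofNatTrans adj.counit)
  left_triangle := by
    refine congrArg op2 (Cat.Hom₂.ext (NatTrans.ext (funext fun X => ?_)))
    refine Eq.trans ?_ ((adj.right_triangle_components X).trans (Category.id_comp (𝟙 _)).symm)
    exact congrArg (_ ≫ ·) (Eq.trans (by simp; rfl) (Category.id_comp _))
  right_triangle := by
    refine congrArg op2 (Cat.Hom₂.ext (NatTrans.ext (funext fun X => ?_)))
    refine Eq.trans ?_ ((adj.left_triangle_components X).trans (Category.id_comp (𝟙 _)).symm)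
    exact congrArg (_ ≫ ·) (Eq.trans (by simp; rfl) (Category.id_comp _))

/-- An adjunction `l ⊣ r` induces `r^* ⊣ l^*`. -/
noncomputable def restrAdj {l : A ⥤ B} {r : B ⥤ A} (adj : l ⊣ r) : D.restr r ⊣ D.restr l :=
  Adjunction.ofCat (D.toPseudofunctor.mapAdjunction (opAdj adj))

theorem restrAdj_unit {l : A ⥤ B} {r : B ⥤ A} (adj : l ⊣ r) : (D.restrAdj adj).unit =
    (D.restrId A).inv ≫ D.restrTrans adj.unit ≫ (D.restrComp l r).hom := by
  rfl

theorem restrAdj_counit {l : A ⥤ B} {r : B ⥤ A} (adj : l ⊣ r) : (D.restrAdj adj).counit =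
    (D.restrComp r l).inv ≫ D.restrTrans adj.counit ≫ (D.restrId B).hom := by
  rfl

/-- The arrow `p^* X ⟶ q^* g^* L` induced by `η : X ⟶ f^* L` and a square `α : f p ⟶ g q`. -/
def ind {p : E ⥤ A} {q : E ⥤ B} {f : A ⥤ C} {g : B ⥤ C} (α : p ⋙ f ⟶ q ⋙ g) {X : D.Diag A}
    {L : D.Diag C} (η : X ⟶ (D.restr f).obj L) :
    (D.restr p).obj X ⟶ (D.restr q).obj ((D.restr g).obj L) :=
  (D.restr p).map η ≫ (D.squareTrans α).app L

theorem squareTrans_app {p : E ⥤ A} {q : E ⥤ B} {f : A ⥤ C} {g : B ⥤ C} (α : p ⋙ f ⟶ q ⋙ g)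
    (L : D.Diag C) : (D.squareTrans α).app L =
      (D.restrComp p f).inv.app L ≫ (D.restrTrans α).app L ≫ (D.restrComp q g).hom.app L :=
  rfl

theorem ind_comp {p : E ⥤ A} {q : E ⥤ B} {f : A ⥤ C} {g : B ⥤ C} (α : p ⋙ f ⟶ q ⋙ g)
    {X : D.Diag A} {L L' : D.Diag C} (η : X ⟶ (D.restr f).obj L) (k : L ⟶ L') :
    D.ind α (η ≫ (D.restr f).map k) = D.ind α η ≫ (D.restr q).map ((D.restr g).map k) := by
  have := (D.squareTrans α).naturality k
  simp only [ind, Functor.map_comp, Category.assoc]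
  exact congrArg _ this

/-- The pasting of two squares. -/
abbrev pasteSq {E' B' : Type u} [Category.{u} E'] [Category.{u} B'] {p : E ⥤ A} {q : E ⥤ B}
    {f : A ⥤ C} {g : B ⥤ C} (α : p ⋙ f ⟶ q ⋙ g) {p' : E' ⥤ E} {q' : E' ⥤ B'} {g' : B' ⥤ B}
    (β : p' ⋙ q ⟶ q' ⋙ g') : (p' ⋙ p) ⋙ f ⟶ q' ⋙ g' ⋙ g :=
  Functor.whiskerLeft p' α ≫ Functor.whiskerRight β g

/-- Compatibility of induced arrows with pasting: a universality condition for a pasted square can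
be tested one square at a time. -/
theorem ind_ind {E' B' : Type u} [Category.{u} E'] [Category.{u} B'] {p : E ⥤ A} {q : E ⥤ B}
    {f : A ⥤ C} {g : B ⥤ C} (α : p ⋙ f ⟶ q ⋙ g) {p' : E' ⥤ E} {q' : E' ⥤ B'} {g' : B' ⥤ B}
    (β : p' ⋙ q ⟶ q' ⋙ g') {X : D.Diag A} {L : D.Diag C} (η : X ⟶ (D.restr f).obj L) :
    D.ind (pasteSq α β) η ≫ (D.restr q').map ((D.restrComp g' g).hom.app L) =
      (D.restrComp p' p).hom.app X ≫ D.ind β (D.ind α η) := by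
  have h₁ := (D.restrComp p' p).hom.naturality η
  have w₁ := congrArg (fun t => t.app L) (D.restrTrans_whiskerLeft p' α)
  have w₂ := congrArg (fun t => t.app L) (D.restrTrans_whiskerRight β g)
  have w := congrArg (fun t => t.app L)
    (D.restrTrans_comp (Functor.whiskerLeft p' α) (Functor.whiskerRight β g))
  -- The three commutative squares fed in are the associativity coherences of `restrComp`; they
  -- cancel the coherence isomorphisms between the 2-cells `α` and `β`.
  have key := paste_aux ((D.restrComp (p' ⋙ p) f).app L)
    ((D.restrComp p' p).app ((D.restr f).obj L)) ((D.restrComp p' (p ⋙ f)).app L)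
    ((D.restr p').mapIso ((D.restrComp p f).app L)) (D.restrComp_assoc p' p f L)
    ((D.restrComp (p' ⋙ q) g).app L)
    ((D.restrComp p' q).app ((D.restr g).obj L)) ((D.restrComp p' (q ⋙ g)).app L)
    ((D.restr p').mapIso ((D.restrComp q g).app L)) (D.restrComp_assoc p' q g L)
    ((D.restrComp (q' ⋙ g') g).app L)
    ((D.restrComp q' g').app ((D.restr g).obj L)) ((D.restrComp q' (g' ⋙ g)).app L)
    ((D.restr q').mapIso ((D.restrComp g' g).app L)) (D.restrComp_assoc q' g' g L)
    ((D.restr p').map ((D.restrTrans α).app L)) ((D.restrTrans β).app ((D.restr g).obj L))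
  have hm : (D.restr p').map ((D.squareTrans α).app L) =
      (D.restr p').map ((D.restrComp p f).inv.app L) ≫ (D.restr p').map ((D.restrTrans α).app L) ≫
        (D.restr p').map ((D.restrComp q g).hom.app L) := by
    rw [squareTrans_app, Functor.map_comp, Functor.map_comp]
  dsimp only [ind]
  rw [Functor.map_comp, hm]
  have hT := w.trans (congr($w₁ ≫ $w₂))
  calc
    _ = (D.restr (p' ⋙ p)).map η ≫ (D.restrComp (p' ⋙ p) f).inv.app L ≫
        (D.restrTrans (pasteSq α β)).app L ≫ (D.restrComp q' (g' ⋙ g)).hom.app L ≫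
          (D.restr q').map ((D.restrComp g' g).hom.app L) := by
      rw [squareTrans_app]
      simp only [Category.assoc]
    _ = _ := (congrArg (fun t => (D.restr (p' ⋙ p)).map η ≫
        (D.restrComp (p' ⋙ p) f).inv.app L ≫ t ≫ _) hT).trans (congrArg (_ ≫ ·) key)
    _ = ((D.restr (p' ⋙ p)).map η ≫ (D.restrComp p' p).hom.app ((D.restr f).obj L)) ≫
        ((D.restr p').map ((D.restrComp p f).inv.app L) ≫
          (D.restr p').map ((D.restrTrans α).app L) ≫
            (D.restr p').map ((D.restrComp q g).hom.app L)) ≫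
              (D.squareTrans β).app ((D.restr g).obj L) := by
      refine Eq.trans ?_ (Category.assoc _ _ _).symm
      rfl
    _ = _ := by
      rw [h₁]
      simp only [Category.assoc]
      rfl

/-- The arrow `p^* f^* L ⟶ q^* X` induced by `c : g^* L ⟶ X` and a square `α : f p ⟶ g q`. -/
def coind {p : E ⥤ A} {q : E ⥤ B} {f : A ⥤ C} {g : B ⥤ C} (α : p ⋙ f ⟶ q ⋙ g) {X : D.Diag B}
    {L : D.Diag C} (c : (D.restr g).obj L ⟶ X) :
    (D.restr p).obj ((D.restr f).obj L) ⟶ (D.restr q).obj X :=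
  (D.squareTrans α).app L ≫ (D.restr q).map c

theorem coind_comp {p : E ⥤ A} {q : E ⥤ B} {f : A ⥤ C} {g : B ⥤ C} (α : p ⋙ f ⟶ q ⋙ g)
    {X : D.Diag B} {L L' : D.Diag C} (c : (D.restr g).obj L ⟶ X) (k : L' ⟶ L) :
    D.coind α ((D.restr g).map k ≫ c) = (D.restr p).map ((D.restr f).map k) ≫ D.coind α c := by
  have := (D.squareTrans α).naturality k
  simp only [coind, Functor.map_comp, ← Category.assoc]
  exact (congrArg (· ≫ _) this).symm

/-- The pasting of two squares. -/
abbrev copasteSq {E' A' : Type u} [Category.{u} E'] [Category.{u} A'] {p : E ⥤ A} {q : E ⥤ B}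
    {f : A ⥤ C} {g : B ⥤ C} (α : p ⋙ f ⟶ q ⋙ g) {p' : E' ⥤ A'} {q' : E' ⥤ E} {g' : A' ⥤ A}
    (β : p' ⋙ g' ⟶ q' ⋙ p) : p' ⋙ g' ⋙ f ⟶ (q' ⋙ q) ⋙ g :=
  Functor.whiskerRight β f ≫ Functor.whiskerLeft q' α

theorem coind_coind {E' A' : Type u} [Category.{u} E'] [Category.{u} A'] {p : E ⥤ A} {q : E ⥤ B}
    {f : A ⥤ C} {g : B ⥤ C} (α : p ⋙ f ⟶ q ⋙ g) {p' : E' ⥤ A'} {q' : E' ⥤ E} {g' : A' ⥤ A}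
    (β : p' ⋙ g' ⟶ q' ⋙ p) {X : D.Diag B} {L : D.Diag C} (c : (D.restr g).obj L ⟶ X) :
    (D.restr p').map ((D.restrComp g' f).hom.app L) ≫ D.coind β (D.coind α c) =
      D.coind (copasteSq α β) c ≫ (D.restrComp q' q).hom.app X := by
  have h₁ := (D.restrComp q' q).hom.naturality c
  have w₁ := congrArg (fun t => t.app L) (D.restrTrans_whiskerLeft q' α)
  have w₂ := congrArg (fun t => t.app L) (D.restrTrans_whiskerRight β f)
  have w := congrArg (fun t => t.app L)
    (D.restrTrans_comp (Functor.whiskerRight β f) (Functor.whiskerLeft q' α))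
  have key := paste_aux ((D.restrComp p' (g' ⋙ f)).app L)
    ((D.restr p').mapIso ((D.restrComp g' f).app L)) ((D.restrComp (p' ⋙ g') f).app L)
    ((D.restrComp p' g').app ((D.restr f).obj L)) (D.restrComp_assoc p' g' f L).symm
    ((D.restrComp q' (p ⋙ f)).app L) ((D.restr q').mapIso ((D.restrComp p f).app L))
    ((D.restrComp (q' ⋙ p) f).app L) ((D.restrComp q' p).app ((D.restr f).obj L))
    (D.restrComp_assoc q' p f L).symm
    ((D.restrComp q' (q ⋙ g)).app L) ((D.restr q').mapIso ((D.restrComp q g).app L))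
    ((D.restrComp (q' ⋙ q) g).app L) ((D.restrComp q' q).app ((D.restr g).obj L))
    (D.restrComp_assoc q' q g L).symm
    ((D.restrTrans β).app ((D.restr f).obj L)) ((D.restr q').map ((D.restrTrans α).app L))
  have hm : (D.restr q').map ((D.squareTrans α).app L) =
      (D.restr q').map ((D.restrComp p f).inv.app L) ≫ (D.restr q').map ((D.restrTrans α).app L) ≫
        (D.restr q').map ((D.restrComp q g).hom.app L) := by
    rw [squareTrans_app, Functor.map_comp, Functor.map_comp]
  dsimp only [coind]
  rw [Functor.map_comp, hm]
  have hT := w.trans (congr($w₂ ≫ $w₁))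
  symm
  calc
    _ = ((D.restrComp p' (g' ⋙ f)).inv.app L ≫
        (D.restrTrans (copasteSq α β)).app L ≫ (D.restrComp (q' ⋙ q) g).hom.app L ≫
          (D.restrComp q' q).hom.app ((D.restr g).obj L)) ≫
            (D.restr q').map ((D.restr q).map c) := by
      rw [squareTrans_app, Category.assoc, h₁]
      simp only [Category.assoc]
      rfl
    _ = _ := congrArg (· ≫ _) ((congrArg (fun t => (D.restrComp p' (g' ⋙ f)).inv.app L ≫ t ≫
        (D.restrComp (q' ⋙ q) g).hom.app L ≫ (D.restrComp q' q).hom.app ((D.restr g).obj L))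
          hT).trans key)
    _ = ((D.restr p').map ((D.restrComp g' f).hom.app L) ≫
        (D.squareTrans β).app ((D.restr f).obj L) ≫
          (D.restr q').map ((D.restrComp p f).inv.app L) ≫
            (D.restr q').map ((D.restrTrans α).app L) ≫
              (D.restr q').map ((D.restrComp q g).hom.app L)) ≫
                (D.restr q').map ((D.restr q).map c) := rfl
    _ = _ := by
      simp only [Category.assoc]

theorem isIso_restrTrans {f g : A ⥤ B} (α : f ⟶ g) [IsIso α] : IsIso (D.restrTrans α) :=
  ⟨D.restrTrans (inv α), by rw [← restrTrans_comp, IsIso.hom_inv_id, restrTrans_id],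
    by rw [← restrTrans_comp, IsIso.inv_hom_id, restrTrans_id]⟩

/-- Precomposition with a right adjoint `k` does not change colimits. -/
theorem isUniv_star_iff {l : A ⥤ J} {k : J ⥤ A} (adj : l ⊣ k) {Y : D.Diag A} {W : D.Diag Pt.{u}}
    (θ : Y ⟶ (D.restr (Functor.star.{u} A)).obj W) :
    IsUniv (D.restr (Functor.star.{u} J))
      ((D.restr k).map θ ≫ (D.restrComp k (Functor.star.{u} A)).inv.app W) ↔
      IsUniv (D.restr (Functor.star.{u} A)) θ := by
  -- The unit of `k^* ⊣ l^*` is invertible at constant diagrams, since the unit of `l ⊣ k` becomes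
  -- invertible after projection to the point. So maps from `Y` to a constant diagram are the same
  -- before and after `k^*`.
  have hu : ∀ Z, IsIso ((D.restrAdj adj).unit.app ((D.restr (Functor.star.{u} A)).obj Z)) :=
    fun Z => by
      have h₁ : IsIso (D.restrTrans (Functor.whiskerRight adj.unit (Functor.star.{u} A))) := by
        have : IsIso (Functor.whiskerRight adj.unit (Functor.star.{u} A)) :=
          NatIso.isIso_of_isIso_app _
        exact D.isIso_restrTrans _
      rw [restrTrans_whiskerRight, isIso_comp_left_iff, isIso_comp_right_iff] at h₁
      have h₂ : IsIso ((D.restrTrans adj.unit).app ((D.restr (Functor.star.{u} A)).obj Z)) :=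
        inferInstanceAs (IsIso ((Functor.whiskerLeft (D.restr (Functor.star.{u} A))
          (D.restrTrans adj.unit)).app Z))
      rw [restrAdj_unit]
      exact inferInstanceAs (IsIso ((D.restrId A).inv.app _ ≫ (D.restrTrans adj.unit).app _ ≫
        (D.restrComp l k).hom.app _))
  refine forall_congr' fun Z => ?_
  have hk := bijective_map_of_isIso_unit (D.restrAdj adj) Y ((D.restr (Functor.star.{u} A)).obj Z)
  have hc := (((D.restrComp k (Functor.star.{u} A)).symm.app Z).homToEquiv
    (Z := (D.restr k).obj Y)).bijective
  rw [← Function.Bijective.of_comp_iff' (hc.comp hk)]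
  refine iff_of_eq (congrArg _ (funext fun g => ?_))
  have := (D.restrComp k (Functor.star.{u} A)).inv.naturality g
  exact (Category.assoc _ _ _).trans ((congrArg (_ ≫ ·) this.symm).trans
    ((Category.assoc _ _ _).symm.trans (congrArg (· ≫ _) (Functor.map_comp _ _ _).symm)))

end Calculus

/-! ### Pointwise left Kan extensions in a derivator. -/

section Der

variable {D} (hD : D.IsDerivator)

variable {A B C E J : Type u} [Category.{u} A] [Category.{u} B] [Category.{u} C] [Category.{u} E]
  [Category.{u} J]

include hD

theorem IsDerivator.exists_lan (f : A ⥤ B) (X : D.Diag A) :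
    ∃ (L : D.Diag B) (η : X ⟶ (D.restr f).obj L), IsUniv (D.restr f) η :=
  have := hD.der3_left f
  IsUniv.exists_of_isRightAdjoint _ _

/-- The pointwise axiom for single objects. The arrow induced by a unit of `f_! ⊣ f^*` is a unit of
the colimit adjunction followed by the canonical mate (`unit_mateEquiv_symm`), and the mate is
invertible. -/
theorem IsDerivator.slice (f : A ⥤ B) (b : B) {X : D.Diag A} {L : D.Diag B}
    {η : X ⟶ (D.restr f).obj L} (h : IsUniv (D.restr f) η) :
    IsUniv (D.restr (Functor.star.{u} _)) (D.ind (sliceTrans f b) η) := by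
  have := hD.der3_left f
  have := hD.der3_left (Functor.star.{u} (CostructuredArrow f b))
  let adj := Adjunction.ofIsRightAdjoint (D.restr f)
  let adj' := Adjunction.ofIsRightAdjoint (D.restr (Functor.star.{u} (CostructuredArrow f b)))
  obtain ⟨k, rfl⟩ := (IsUniv.of_adj adj X).exists_fac η
  have := (IsUniv.of_adj adj X).isIso_of_comp k h
  rw [ind_comp]
  refine IsUniv.comp_iso ?_ _
  have hm := hD.der4_left f b _ adj _ adj'
  have key := unit_mateEquiv_symm adj adj' (.mk _ _ _ _ (D.squareTrans (sliceTrans f b))) X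
  have key' : D.ind (sliceTrans f b) (adj.unit.app X) = _ := key
  rw [key']
  have := ((asIso (((mateEquiv adj adj').symm
      (.mk _ _ _ _ (D.squareTrans (sliceTrans f b)))).natTrans)).app X).isIso_hom
  exact @IsUniv.comp_iso _ _ _ _ _ _ _ _ (IsUniv.of_adj adj' _) _ _ this

theorem IsDerivator.isIso_of_eval {X Y : D.Diag A} (g : X ⟶ Y)
    (h : ∀ a, IsIso ((D.eval a).map g)) : IsIso g :=
  (hD.der2 g).mpr h

/-- Left Kan extensions are detected pointwise. -/
theorem IsDerivator.isUniv_of_slice (f : A ⥤ B) {X : D.Diag A} {L : D.Diag B}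
    (η : X ⟶ (D.restr f).obj L)
    (h : ∀ b, IsUniv (D.restr (Functor.star.{u} _)) (D.ind (sliceTrans f b) η)) :
    IsUniv (D.restr f) η := by
  obtain ⟨L', η', h'⟩ := hD.exists_lan f X
  obtain ⟨k, rfl⟩ := h'.exists_fac η
  -- Compare with an actual Kan extension: at each `b` both induced arrows are universal, so the
  -- comparison is invertible there.
  have : IsIso k := hD.isIso_of_eval k fun b => by
    have := h b
    rw [ind_comp] at this
    exact (hD.slice f b h').isIso_of_comp _ this
  exact h'.comp_iso k

end Der

end Prederivator

theorem IsUniv.isIso_of_isEquivalence {𝒞 𝒟 : Type*} [Category 𝒞] [Category 𝒟] {R : 𝒞 ⥤ 𝒟}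
    [R.IsEquivalence] {X : 𝒟} {L : 𝒞} {η : X ⟶ R.obj L} (h : IsUniv R η) : IsIso η := by
  let i := R.objObjPreimageIso X
  have h₁ : IsUniv R (i.inv ≫ 𝟙 (R.obj (R.objPreimage X))) := IsUniv.iso_comp (fun Z => by
    simpa using (Functor.FullyFaithful.ofFullyFaithful R).map_bijective _ _) _
  obtain ⟨k, rfl⟩ := h₁.exists_fac η
  have := h₁.isIso_of_comp k h
  rw [Category.comp_id]
  infer_instance

theorem whisker_aux {𝒞 : Type w} [Category.{v} 𝒞] {O₁ O₂ O₃ O₄ P₁ P₂ P₃ P₄ : 𝒞}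
    (a : O₁ ≅ O₂) (b : O₂ ≅ O₃) (c : O₁ ≅ O₄) (d : O₄ ≅ O₃) (h : a.hom ≫ b.hom = c.hom ≫ d.hom)
    (a' : P₁ ≅ P₂) (b' : P₂ ≅ P₃) (c' : P₁ ≅ P₄) (d' : P₄ ≅ P₃)
    (h' : a'.hom ≫ b'.hom = c'.hom ≫ d'.hom) (r : O₄ ⟶ P₄) :
    a.inv ≫ (c.hom ≫ r ≫ c'.inv) ≫ a'.hom ≫ b'.hom = b.hom ≫ d.inv ≫ r ≫ d'.hom := by
  have h₁ : a.inv ≫ c.hom = b.hom ≫ d.inv := by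
    rw [Iso.inv_comp_eq, ← Category.assoc, Iso.eq_comp_inv, h]
  have := congr(($h₁ ≫ r) ≫ d'.hom)
  simpa [h'] using this

namespace Prederivator

variable (D : Prederivator.{u, v, w})

section

variable {A B C E J J' : Type u} [Category.{u} A] [Category.{u} B] [Category.{u} C] [Category.{u} E]
  [Category.{u} J] [Category.{u} J']

theorem ind_whiskerLeft (k : J ⥤ E) {p : E ⥤ A} {q : E ⥤ B} {f : A ⥤ C} {g : B ⥤ C}
    (α : p ⋙ f ⟶ q ⋙ g) {X : D.Diag A} {L : D.Diag C} (η : X ⟶ (D.restr f).obj L) :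
    D.ind (p := k ⋙ p) (q := k ⋙ q) (f := f) (g := g) (Functor.whiskerLeft k α) η ≫
        (D.restrComp k q).hom.app _ =
      (D.restrComp k p).hom.app X ≫ (D.restr k).map (D.ind α η) := by
  have h₁ := (D.restrComp k p).hom.naturality η
  have w₁ := congrArg (fun t => t.app L) (D.restrTrans_whiskerLeft k α)
  have key := whisker_aux ((D.restrComp (k ⋙ p) f).app L)
    ((D.restrComp k p).app ((D.restr f).obj L)) ((D.restrComp k (p ⋙ f)).app L)
    ((D.restr k).mapIso ((D.restrComp p f).app L)) (D.restrComp_assoc k p f L)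
    ((D.restrComp (k ⋙ q) g).app L)
    ((D.restrComp k q).app ((D.restr g).obj L)) ((D.restrComp k (q ⋙ g)).app L)
    ((D.restr k).mapIso ((D.restrComp q g).app L)) (D.restrComp_assoc k q g L)
    ((D.restr k).map ((D.restrTrans α).app L))
  have hm : (D.restr k).map ((D.squareTrans α).app L) =
      (D.restr k).map ((D.restrComp p f).inv.app L) ≫ (D.restr k).map ((D.restrTrans α).app L) ≫
        (D.restr k).map ((D.restrComp q g).hom.app L) := by
    rw [squareTrans_app, Functor.map_comp, Functor.map_comp]
  dsimp only [ind]
  rw [Functor.map_comp, hm]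
  calc
    _ = (D.restr (k ⋙ p)).map η ≫ (D.restrComp (k ⋙ p) f).inv.app L ≫
        (D.restrTrans (Functor.whiskerLeft k α)).app L ≫ (D.restrComp (k ⋙ q) g).hom.app L ≫
          (D.restrComp k q).hom.app _ := by
      rw [squareTrans_app]
      simp only [Category.assoc]
    _ = _ := (congrArg (fun t => (D.restr (k ⋙ p)).map η ≫
        (D.restrComp (k ⋙ p) f).inv.app L ≫ t ≫ _) w₁).trans (congrArg (_ ≫ ·) key)
    _ = ((D.restr (k ⋙ p)).map η ≫ (D.restrComp k p).hom.app ((D.restr f).obj L)) ≫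
        ((D.restr k).map ((D.restrComp p f).inv.app L) ≫
          (D.restr k).map ((D.restrTrans α).app L) ≫
            (D.restr k).map ((D.restrComp q g).hom.app L)) :=
      (Category.assoc _ _ _).symm
    _ = _ := by
      rw [h₁]
      simp only [Category.assoc]
      rfl

/-- Precomposition with a right adjoint does not change colimits. -/
theorem isUniv_ind_whiskerLeft_iff {l : J' ⥤ J} {k : J ⥤ J'} (adj : l ⊣ k) {r : J' ⥤ A}
    {f : A ⥤ C} {t : Pt.{u} ⥤ C} (α : r ⋙ f ⟶ Functor.star.{u} J' ⋙ t) {X : D.Diag A}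
    {L : D.Diag C} (η : X ⟶ (D.restr f).obj L) :
    IsUniv (D.restr (Functor.star.{u} J)) (D.ind (p := k ⋙ r) (q := Functor.star.{u} J) (f := f)
      (g := t) (Functor.whiskerLeft k α) η) ↔
      IsUniv (D.restr (Functor.star.{u} J')) (D.ind α η) := by
  rw [← D.isUniv_star_iff adj]
  have h := D.ind_whiskerLeft k α η
  have h' := (IsIso.eq_comp_inv _).mpr h
  refine Iff.trans (iff_of_eq (congrArg (IsUniv (D.restr (Functor.star.{u} J)))
    (h'.trans (Category.assoc _ _ _)))) ((IsUniv.iso_comp_iff _ _).trans ?_)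
  refine iff_of_eq (congrArg (IsUniv (D.restr (Functor.star.{u} J))) ?_)
  refine congrArg (_ ≫ ·) ?_
  exact (IsIso.inv_eq_of_hom_inv_id ((D.restrComp k (Functor.star.{u} J')).hom_inv_id_app _))

theorem isIso_ind_iff {p : E ⥤ A} {q : E ⥤ B} {f : A ⥤ C} {g : B ⥤ C}
    (α : p ⋙ f ⟶ q ⋙ g) [IsIso α] {X : D.Diag A} {L : D.Diag C} (η : X ⟶ (D.restr f).obj L) :
    IsIso (D.ind α η) ↔ IsIso ((D.restr p).map η) := by
  have := D.isIso_restrTrans α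
  have : IsIso ((D.squareTrans α).app L) := by
    rw [squareTrans_app]
    infer_instance
  exact isIso_comp_right_iff _ _

instance : (D.restr (Functor.star.{u} Pt.{u})).IsEquivalence := by
  have h : D.restr (Functor.star.{u} Pt.{u}) = D.restr (𝟭 Pt.{u}) := rfl
  rw [h]
  exact Functor.isEquivalence_of_iso (D.restrId _).symm

/-- The terminal object of the slice category of a fully faithful functor. -/
noncomputable def sliceTerminalAdj (f : A ⥤ B) [f.Full] [f.Faithful] (a : A) :
    Functor.star.{u} (CostructuredArrow f (f.obj a)) ⊣
      Functor.fromPUnit (CostructuredArrow.mk (𝟙 (f.obj a))) :=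
  Adjunction.mkOfHomEquiv
    { homEquiv _ _ :=
        { toFun _ := CostructuredArrow.homMk (f.preimage (CostructuredArrow.hom _)) (by simp)
          invFun _ := eqToHom (by subsingleton)
          left_inv _ := Subsingleton.elim _ _
          right_inv g := by
            ext
            apply f.map_injective
            simpa using (CostructuredArrow.w g).symm }
      homEquiv_naturality_left_symm _ _ := Subsingleton.elim _ _
      homEquiv_naturality_right _ g := by
        ext
        apply f.map_injective
        simp }

end

instance : upperIncl.{u}.Full where
  map_surjective f := ⟨f, Subsingleton.elim _ _⟩

instance : upperIncl.{u}.Faithful where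
  map_injective _ := Subsingleton.elim _ _

instance : lowerIncl.{u}.Full where
  map_surjective f := ⟨f, Subsingleton.elim _ _⟩

instance : lowerIncl.{u}.Faithful where
  map_injective _ := Subsingleton.elim _ _

section Der

variable {D} (hD : D.IsDerivator)

variable {A B C E J : Type u} [Category.{u} A] [Category.{u} B] [Category.{u} C] [Category.{u} E]
  [Category.{u} J]

/-- Converse of `IsDerivator.slice`: the mate compares two universal arrows. This form is used to
verify the pointwise axiom for shifted and for equivalent prederivators. -/
theorem der4_left_of_isUniv (f : A ⥤ B) (b : B)
    (h : ∀ {X : D.Diag A} {L : D.Diag B} (η : X ⟶ (D.restr f).obj L), IsUniv (D.restr f) η →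
      IsUniv (D.restr (Functor.star.{u} _)) (D.ind (sliceTrans f b) η))
    (lan : D.Diag A ⥤ D.Diag B) (adj : lan ⊣ D.restr f)
    (colim : D.Diag (CostructuredArrow f b) ⥤ D.Diag Pt.{u})
    (adj' : colim ⊣ D.restr (Functor.star.{u} (CostructuredArrow f b))) :
    IsIso ((mateEquiv adj adj').symm (.mk _ _ _ _ (D.squareTrans (sliceTrans f b)))).natTrans := by
  have : ∀ X, IsIso (((mateEquiv adj adj').symm
      (.mk _ _ _ _ (D.squareTrans (sliceTrans f b)))).natTrans.app X) := fun X => by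
    have key := unit_mateEquiv_symm adj adj' (.mk _ _ _ _ (D.squareTrans (sliceTrans f b))) X
    have key' : D.ind (sliceTrans f b) (adj.unit.app X) = _ := key
    have h' := h _ (IsUniv.of_adj adj X)
    rw [key'] at h'
    exact (IsUniv.of_adj adj' _).isIso_of_comp _ h'
  exact NatIso.isIso_of_isIso_app _

include hD

/-- Left Kan extension along a fully faithful functor is fully faithful. -/
theorem IsDerivator.isIso_of_isUniv (f : A ⥤ B) [f.Full] [f.Faithful] {X : D.Diag A} {L : D.Diag B}
    {η : X ⟶ (D.restr f).obj L} (h : IsUniv (D.restr f) η) : IsIso η :=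
  hD.isIso_of_eval _ fun a => by
    -- The slice over `f.obj a` has the identity as terminal object, so the colimit over it is
    -- evaluation at that object, that is, at `a`.
    have h₁ := (D.isUniv_ind_whiskerLeft_iff (sliceTerminalAdj f a) (sliceTrans f (f.obj a)) η).mpr
      (hD.slice f (f.obj a) h)
    have h₂ := h₁.isIso_of_isEquivalence
    have : IsIso (Functor.whiskerLeft (Functor.fromPUnit (CostructuredArrow.mk (𝟙 (f.obj a))))
        (sliceTrans f (f.obj a))) := by
      have : ∀ x, IsIso ((Functor.whiskerLeft (Functor.fromPUnit (CostructuredArrow.mk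
        (𝟙 (f.obj a)))) (sliceTrans f (f.obj a))).app x) := fun x => by
        exact inferInstanceAs (IsIso (𝟙 (f.obj a)))
      exact NatIso.isIso_of_isIso_app _
    exact (isIso_ind_iff D (p := Functor.fromPUnit (CostructuredArrow.mk
        (𝟙 (f.obj a))) ⋙ CostructuredArrow.proj f (f.obj a)) (q := Functor.star.{u} Pt) (f := f)
        (g := Functor.fromPUnit (f.obj a)) _ η).mp h₂

/-- `upperIncl` is fully faithful, so the units of its Kan extension are invertible and membership
in the essential image is universality of the identity. No chosen adjoint appears any more. -/
theorem IsDerivator.isCocartesian_iff (X : D.Diag Square.{u}) :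
    IsCocartesian X ↔ IsUniv (D.restr upperIncl.{u}) (𝟙 ((D.restr upperIncl.{u}).obj X)) := by
  constructor
  · rintro ⟨lan, adj, Y, ⟨e⟩⟩
    have h := IsUniv.of_adj adj Y
    have := hD.isIso_of_isUniv _ h
    simpa using (h.comp_iso e.hom).iso_comp (inv (adj.unit.app Y ≫ (D.restr upperIncl).map e.hom))
  · intro h
    have := hD.der3_left upperIncl.{u}
    refine ⟨_, Adjunction.ofIsRightAdjoint (D.restr upperIncl.{u}), (D.restr upperIncl.{u}).obj X, ?_⟩
    have h' := IsUniv.of_adj (Adjunction.ofIsRightAdjoint (D.restr upperIncl.{u}))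
      ((D.restr upperIncl.{u}).obj X)
    obtain ⟨k, hk⟩ := h'.exists_fac (𝟙 _)
    have := h'.isIso_of_comp k (by rwa [hk])
    exact ⟨asIso k⟩

end Der

end Prederivator

/-! ### The dual theory: couniversal arrows and pointwise right Kan extensions. -/

namespace IsCouniv

universe v₁ v₂ v₃ u₁ u₂ u₃

variable {𝒞 : Type u₁} [Category.{v₁} 𝒞] {𝒟 : Type u₂} [Category.{v₂} 𝒟]
  {ℰ : Type u₃} [Category.{v₃} ℰ] {R : 𝒞 ⥤ 𝒟} {X : 𝒟} {L : 𝒞}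

theorem of_adj {F : 𝒟 ⥤ 𝒞} (adj : R ⊣ F) (X : 𝒟) : IsCouniv R (adj.counit.app X) := fun Z => by
  refine (congrArg Function.Bijective ?_).mpr (adj.homEquiv Z X).symm.bijective
  exact funext fun g => (adj.homEquiv_counit Z X g).symm

theorem exists_of_isLeftAdjoint (R : 𝒞 ⥤ 𝒟) [R.IsLeftAdjoint] (X : 𝒟) :
    ∃ (L : 𝒞) (c : R.obj L ⟶ X), IsCouniv R c :=
  ⟨_, _, of_adj (Adjunction.ofIsLeftAdjoint R) X⟩

theorem iso_comp {c : R.obj L ⟶ X} (h : IsCouniv R c) {L' : 𝒞} (g : L' ⟶ L) [IsIso g] :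
    IsCouniv R (R.map g ≫ c) := fun Z => by
  convert (h Z).comp ((asIso g).homToEquiv (Z := Z)).bijective using 1
  funext k
  simp

theorem comp_iso {c : R.obj L ⟶ X} (h : IsCouniv R c) {X' : 𝒟} (g : X ⟶ X') [IsIso g] :
    IsCouniv R (c ≫ g) := fun Z => by
  convert ((asIso g).homToEquiv (Z := R.obj Z)).bijective.comp (h Z) using 1
  funext k
  simp

theorem comp_iso_iff (c : R.obj L ⟶ X) {X' : 𝒟} (g : X ⟶ X') [IsIso g] :
    IsCouniv R (c ≫ g) ↔ IsCouniv R c :=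
  ⟨fun h => by simpa using h.comp_iso (inv g), fun h => h.comp_iso g⟩

theorem iso_comp_iff (c : R.obj L ⟶ X) {L' : 𝒞} (g : L' ⟶ L) [IsIso g] :
    IsCouniv R (R.map g ≫ c) ↔ IsCouniv R c :=
  ⟨fun h => by simpa using h.iso_comp (inv g), fun h => h.iso_comp g⟩

theorem isIso_of_comp {c : R.obj L ⟶ X} (h : IsCouniv R c) {L' : 𝒞} (g : L' ⟶ L)
    (h' : IsCouniv R (R.map g ≫ c)) : IsIso g := by
  obtain ⟨k, hk⟩ := (h' L).2 c
  refine ⟨k, (h' L').1 ?_, (h L).1 ?_⟩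
  · have := congrArg (R.map g ≫ ·) hk
    simpa using this
  · simpa using hk

theorem exists_fac {c : R.obj L ⟶ X} (h : IsCouniv R c) {Z : 𝒞} (k : R.obj Z ⟶ X) :
    ∃ g : Z ⟶ L, R.map g ≫ c = k :=
  (h Z).2 k

theorem comp_iff {S : 𝒟 ⥤ ℰ} {Y : ℰ} {c : S.obj X ⟶ Y} (h : IsCouniv S c) (θ : R.obj L ⟶ X) :
    IsCouniv (R ⋙ S) (S.map θ ≫ c) ↔ IsCouniv R θ := by
  refine forall_congr' fun Z => ?_
  rw [← Function.Bijective.of_comp_iff' (h (R.obj Z))]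
  refine iff_of_eq (congrArg _ (funext fun g => ?_))
  simp

theorem isIso_of_isIso_map {L L' : 𝒞} (h : IsCouniv R (𝟙 (R.obj L)))
    (h' : IsCouniv R (𝟙 (R.obj L'))) (g : L ⟶ L') [IsIso (R.map g)] : IsIso g := by
  refine h'.isIso_of_comp g ?_
  have := h.comp_iso (R.map g)
  simpa using this

theorem of_natIso {R' : 𝒞 ⥤ 𝒟} (i : R ≅ R') {c : R.obj L ⟶ X} (h : IsCouniv R c) :
    IsCouniv R' (i.inv.app L ≫ c) := fun Z => by
  convert ((i.app Z).homFromEquiv (Z := X)).bijective.comp (h Z) using 1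
  funext k
  simp

theorem isIso_of_isEquivalence [R.IsEquivalence] {c : R.obj L ⟶ X} (h : IsCouniv R c) :
    IsIso c := by
  let i := R.objObjPreimageIso X
  have h₁ : IsCouniv R (𝟙 (R.obj (R.objPreimage X)) ≫ i.hom) := comp_iso (fun Z => by
    simpa using (Functor.FullyFaithful.ofFullyFaithful R).map_bijective _ _) _
  obtain ⟨k, rfl⟩ := h₁.exists_fac c
  have := h₁.isIso_of_comp k h
  rw [Category.id_comp]
  infer_instance

end IsCouniv

namespace Prederivator

variable (D : Prederivator.{u, v, w})

section

variable {A B C E J J' : Type u} [Category.{u} A] [Category.{u} B] [Category.{u} C] [Category.{u} E]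
  [Category.{u} J] [Category.{u} J']

/-- Precomposition with a left adjoint `k` does not change limits. -/
theorem isCouniv_star_iff {r : A ⥤ J} {k : J ⥤ A} (adj : k ⊣ r) {Y : D.Diag A}
    {W : D.Diag Pt.{u}} (θ : (D.restr (Functor.star.{u} A)).obj W ⟶ Y) :
    IsCouniv (D.restr (Functor.star.{u} J))
      ((D.restrComp k (Functor.star.{u} A)).hom.app W ≫ (D.restr k).map θ) ↔
      IsCouniv (D.restr (Functor.star.{u} A)) θ := by
  have hu : ∀ Z, IsIso ((D.restrAdj adj).counit.app ((D.restr (Functor.star.{u} A)).obj Z)) :=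
    fun Z => by
      have h₁ : IsIso (D.restrTrans (Functor.whiskerRight adj.counit (Functor.star.{u} A))) := by
        have : IsIso (Functor.whiskerRight adj.counit (Functor.star.{u} A)) :=
          NatIso.isIso_of_isIso_app _
        exact D.isIso_restrTrans _
      rw [restrTrans_whiskerRight, isIso_comp_left_iff, isIso_comp_right_iff] at h₁
      have h₂ : IsIso ((D.restrTrans adj.counit).app ((D.restr (Functor.star.{u} A)).obj Z)) :=
        inferInstanceAs (IsIso ((Functor.whiskerLeft (D.restr (Functor.star.{u} A))
          (D.restrTrans adj.counit)).app Z))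
      rw [restrAdj_counit]
      exact inferInstanceAs (IsIso ((D.restrComp r k).inv.app _ ≫
        (D.restrTrans adj.counit).app _ ≫ (D.restrId A).hom.app _))
  refine forall_congr' fun Z => ?_
  have hk := bijective_map_of_isIso_counit (D.restrAdj adj) Y
    ((D.restr (Functor.star.{u} A)).obj Z)
  have hc := (((D.restrComp k (Functor.star.{u} A)).symm.app Z).homFromEquiv
    (Z := (D.restr k).obj Y)).bijective
  rw [← Function.Bijective.of_comp_iff' (hc.comp hk)]
  refine iff_of_eq (congrArg _ (funext fun g => ?_))
  have := (D.restrComp k (Functor.star.{u} A)).hom.naturality g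
  exact (Category.assoc _ _ _).symm.trans ((congrArg (· ≫ _) this).trans
    ((Category.assoc _ _ _).trans (congrArg (_ ≫ ·) ((D.restr k).map_comp _ _).symm)))

theorem coind_whiskerLeft (k : J ⥤ E) {p : E ⥤ A} {q : E ⥤ B} {f : A ⥤ C} {g : B ⥤ C}
    (α : p ⋙ f ⟶ q ⋙ g) {X : D.Diag B} {L : D.Diag C} (c : (D.restr g).obj L ⟶ X) :
    (D.restrComp k p).hom.app _ ≫ (D.restr k).map (D.coind α c) =
      D.coind (p := k ⋙ p) (q := k ⋙ q) (f := f) (g := g) (Functor.whiskerLeft k α) c ≫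
        (D.restrComp k q).hom.app X := by
  have h₁ := (D.restrComp k q).hom.naturality c
  -- For `η = 𝟙` the induced arrow is the component of `squareTrans`, so the computation for `ind`
  -- also serves `coind`.
  have h₂ := D.ind_whiskerLeft k α (𝟙 ((D.restr f).obj L))
  have h₃ : D.ind (p := k ⋙ p) (q := k ⋙ q) (f := f) (g := g) (Functor.whiskerLeft k α)
      (𝟙 ((D.restr f).obj L)) =
        (D.squareTrans (p := k ⋙ p) (q := k ⋙ q) (f := f) (g := g)
          (Functor.whiskerLeft k α)).app L := by
    simp [ind]
  have h₄ : D.ind α (𝟙 ((D.restr f).obj L)) = (D.squareTrans α).app L := by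
    simp [ind]
  rw [h₃, h₄] at h₂
  dsimp only [coind]
  rw [Category.assoc, h₁, Functor.map_comp, ← Category.assoc, ← h₂, Category.assoc]
  rfl

/-- Precomposition with a left adjoint does not change limits. -/
theorem isCouniv_coind_whiskerLeft_iff {r : J' ⥤ J} {k : J ⥤ J'} (adj : k ⊣ r) {p : J' ⥤ A}
    {f : A ⥤ C} {t : Pt.{u} ⥤ C} (α : Functor.star.{u} J' ⋙ t ⟶ p ⋙ f) {X : D.Diag A}
    {L : D.Diag C} (c : (D.restr f).obj L ⟶ X) :
    IsCouniv (D.restr (Functor.star.{u} J)) (D.coind (p := Functor.star.{u} J) (q := k ⋙ p)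
      (f := t) (g := f) (Functor.whiskerLeft k α) c) ↔
      IsCouniv (D.restr (Functor.star.{u} J')) (D.coind α c) := by
  rw [← D.isCouniv_star_iff adj]
  have h := D.coind_whiskerLeft k α c
  exact Iff.trans (IsCouniv.comp_iso_iff _ ((D.restrComp k p).hom.app X)).symm
    (iff_of_eq (congrArg (IsCouniv (D.restr (Functor.star.{u} J))) h.symm))

theorem isIso_coind_iff {p : E ⥤ A} {q : E ⥤ B} {f : A ⥤ C} {g : B ⥤ C}
    (α : p ⋙ f ⟶ q ⋙ g) [IsIso α] {X : D.Diag B} {L : D.Diag C} (c : (D.restr g).obj L ⟶ X) :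
    IsIso (D.coind α c) ↔ IsIso ((D.restr q).map c) := by
  have := D.isIso_restrTrans α
  have : IsIso ((D.squareTrans α).app L) := by
    rw [squareTrans_app]
    infer_instance
  exact isIso_comp_left_iff _ _

/-- The initial object of the coslice category of a fully faithful functor. -/
noncomputable def cosliceInitialAdj (f : A ⥤ B) [f.Full] [f.Faithful] (a : A) :
    Functor.fromPUnit (StructuredArrow.mk (𝟙 (f.obj a))) ⊣
      Functor.star.{u} (StructuredArrow (f.obj a) f) :=
  Adjunction.mkOfHomEquiv
    { homEquiv _ _ :=
        { invFun _ := StructuredArrow.homMk (f.preimage (StructuredArrow.hom _)) (by simp)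
          toFun _ := eqToHom (by subsingleton)
          right_inv _ := Subsingleton.elim _ _
          left_inv g := by
            ext
            apply f.map_injective
            simpa using (StructuredArrow.w g).symm }
      homEquiv_naturality_left_symm _ g := by
        ext
        apply f.map_injective
        simp
      homEquiv_naturality_right _ _ := Subsingleton.elim _ _ }

end

section Der

variable {D} (hD : D.IsDerivator)

variable {A B C E J : Type u} [Category.{u} A] [Category.{u} B] [Category.{u} C] [Category.{u} E]
  [Category.{u} J]

theorem der4_right_of_isCouniv (f : A ⥤ B) (b : B)
    (h : ∀ {X : D.Diag A} {L : D.Diag B} (c : (D.restr f).obj L ⟶ X), IsCouniv (D.restr f) c →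
      IsCouniv (D.restr (Functor.star.{u} _)) (D.coind (cosliceTrans f b) c))
    (ran : D.Diag A ⥤ D.Diag B) (adj : D.restr f ⊣ ran)
    (lim : D.Diag (StructuredArrow b f) ⥤ D.Diag Pt.{u})
    (adj' : D.restr (Functor.star.{u} (StructuredArrow b f)) ⊣ lim) :
    IsIso (mateEquiv adj adj' (.mk _ _ _ _ (D.squareTrans (cosliceTrans f b)))).natTrans := by
  have : ∀ X, IsIso ((mateEquiv adj adj'
      (.mk _ _ _ _ (D.squareTrans (cosliceTrans f b)))).natTrans.app X) := fun X => by
    have key := mateEquiv_counit adj adj' (.mk _ _ _ _ (D.squareTrans (cosliceTrans f b))) X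
    have key' : D.coind (cosliceTrans f b) (adj.counit.app X) = _ := key.symm
    have h' := h _ (IsCouniv.of_adj adj X)
    rw [key'] at h'
    exact (IsCouniv.of_adj adj' _).isIso_of_comp _ h'
  exact NatIso.isIso_of_isIso_app _

include hD

theorem IsDerivator.exists_ran (f : A ⥤ B) (X : D.Diag A) :
    ∃ (L : D.Diag B) (c : (D.restr f).obj L ⟶ X), IsCouniv (D.restr f) c :=
  have := hD.der3_right f
  IsCouniv.exists_of_isLeftAdjoint _ _

theorem IsDerivator.coslice (f : A ⥤ B) (b : B) {X : D.Diag A} {L : D.Diag B}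
    {c : (D.restr f).obj L ⟶ X} (h : IsCouniv (D.restr f) c) :
    IsCouniv (D.restr (Functor.star.{u} _)) (D.coind (cosliceTrans f b) c) := by
  have := hD.der3_right f
  have := hD.der3_right (Functor.star.{u} (StructuredArrow b f))
  let adj := Adjunction.ofIsLeftAdjoint (D.restr f)
  let adj' := Adjunction.ofIsLeftAdjoint (D.restr (Functor.star.{u} (StructuredArrow b f)))
  obtain ⟨k, rfl⟩ := (IsCouniv.of_adj adj X).exists_fac c
  have := (IsCouniv.of_adj adj X).isIso_of_comp k h
  rw [coind_comp]
  refine IsCouniv.iso_comp ?_ _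
  have hm := hD.der4_right f b _ adj _ adj'
  have key := mateEquiv_counit adj adj' (.mk _ _ _ _ (D.squareTrans (cosliceTrans f b))) X
  have key' : D.coind (cosliceTrans f b) (adj.counit.app X) = _ := key.symm
  rw [key']
  have := ((asIso ((mateEquiv adj adj'
      (.mk _ _ _ _ (D.squareTrans (cosliceTrans f b)))).natTrans)).app X).isIso_hom
  exact @IsCouniv.iso_comp _ _ _ _ _ _ _ _ (IsCouniv.of_adj adj' _) _ _ this

/-- Right Kan extensions are detected pointwise. -/
theorem IsDerivator.isCouniv_of_coslice (f : A ⥤ B) {X : D.Diag A} {L : D.Diag B}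
    (c : (D.restr f).obj L ⟶ X)
    (h : ∀ b, IsCouniv (D.restr (Functor.star.{u} _)) (D.coind (cosliceTrans f b) c)) :
    IsCouniv (D.restr f) c := by
  obtain ⟨L', c', h'⟩ := hD.exists_ran f X
  obtain ⟨k, rfl⟩ := h'.exists_fac c
  have : IsIso k := hD.isIso_of_eval k fun b => by
    have := h b
    rw [coind_comp] at this
    exact (hD.coslice f b h').isIso_of_comp _ this
  exact h'.iso_comp k

/-- Right Kan extension along a fully faithful functor is fully faithful. -/
theorem IsDerivator.isIso_of_isCouniv (f : A ⥤ B) [f.Full] [f.Faithful] {X : D.Diag A}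
    {L : D.Diag B} {c : (D.restr f).obj L ⟶ X} (h : IsCouniv (D.restr f) c) : IsIso c :=
  hD.isIso_of_eval _ fun a => by
    have h₁ := (D.isCouniv_coind_whiskerLeft_iff (cosliceInitialAdj f a)
      (cosliceTrans f (f.obj a)) c).mpr (hD.coslice f (f.obj a) h)
    have h₂ := h₁.isIso_of_isEquivalence
    have : IsIso (Functor.whiskerLeft (Functor.fromPUnit (StructuredArrow.mk (𝟙 (f.obj a))))
        (cosliceTrans f (f.obj a))) := by
      have : ∀ x, IsIso ((Functor.whiskerLeft (Functor.fromPUnit (StructuredArrow.mk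
        (𝟙 (f.obj a)))) (cosliceTrans f (f.obj a))).app x) := fun x => by
        exact inferInstanceAs (IsIso (𝟙 (f.obj a)))
      exact NatIso.isIso_of_isIso_app _
    exact (isIso_coind_iff D (q := Functor.fromPUnit (StructuredArrow.mk
        (𝟙 (f.obj a))) ⋙ StructuredArrow.proj (f.obj a) f) (p := Functor.star.{u} Pt)
        (f := Functor.fromPUnit (f.obj a)) (g := f) _ c).mp h₂

theorem IsDerivator.isCartesian_iff (X : D.Diag Square.{u}) :
    IsCartesian X ↔ IsCouniv (D.restr lowerIncl.{u}) (𝟙 ((D.restr lowerIncl.{u}).obj X)) := by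
  constructor
  · rintro ⟨ran, adj, Y, ⟨e⟩⟩
    have h := IsCouniv.of_adj adj Y
    have := hD.isIso_of_isCouniv _ h
    simpa using (h.iso_comp e.inv).comp_iso
      (inv ((D.restr lowerIncl).map e.inv ≫ adj.counit.app Y))
  · intro h
    have := hD.der3_right lowerIncl.{u}
    refine ⟨_, Adjunction.ofIsLeftAdjoint (D.restr lowerIncl.{u}),
      (D.restr lowerIncl.{u}).obj X, ?_⟩
    have h' := IsCouniv.of_adj (Adjunction.ofIsLeftAdjoint (D.restr lowerIncl.{u}))
      ((D.restr lowerIncl.{u}).obj X)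
    obtain ⟨k, hk⟩ := h'.exists_fac (𝟙 _)
    have := h'.isIso_of_comp k (by rwa [hk])
    exact ⟨(asIso k).symm⟩

end Der

end Prederivator
-- Kan extensions along `id × f` are fibrewise.
namespace Prederivator

variable (D : Prederivator.{u, v, w})

section

variable {A B C E J J' : Type u} [Category.{u} A] [Category.{u} B] [Category.{u} C] [Category.{u} E]
  [Category.{u} J] [Category.{u} J']

theorem isUniv_pasteSq_iff {E' B' : Type u} [Category.{u} E'] [Category.{u} B'] {p : E ⥤ A}
    {q : E ⥤ B} {f : A ⥤ C} {g : B ⥤ C} (α : p ⋙ f ⟶ q ⋙ g) {p' : E' ⥤ E} {q' : E' ⥤ B'}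
    {g' : B' ⥤ B} (β : p' ⋙ q ⟶ q' ⋙ g') {X : D.Diag A} {L : D.Diag C}
    (η : X ⟶ (D.restr f).obj L) :
    IsUniv (D.restr q') (D.ind (pasteSq α β) η) ↔ IsUniv (D.restr q') (D.ind β (D.ind α η)) := by
  rw [← IsUniv.comp_iso_iff _ ((D.restrComp g' g).hom.app L), ind_ind]
  exact IsUniv.iso_comp_iff _ _

theorem isCouniv_copasteSq_iff {E' A' : Type u} [Category.{u} E'] [Category.{u} A'] {p : E ⥤ A}
    {q : E ⥤ B} {f : A ⥤ C} {g : B ⥤ C} (α : p ⋙ f ⟶ q ⋙ g) {p' : E' ⥤ A'} {q' : E' ⥤ E}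
    {g' : A' ⥤ A} (β : p' ⋙ g' ⟶ q' ⋙ p) {X : D.Diag B} {L : D.Diag C}
    (c : (D.restr g).obj L ⟶ X) :
    IsCouniv (D.restr p') (D.coind (copasteSq α β) c) ↔
      IsCouniv (D.restr p') (D.coind β (D.coind α c)) := by
  rw [← IsCouniv.iso_comp_iff (D.coind β (D.coind α c)) ((D.restrComp g' f).hom.app L),
    coind_coind]
  exact (IsCouniv.comp_iso_iff _ _).symm

/-- Restriction to `{b} × A` commutes with `id × f`. -/
def sectTrans (b : B) (f : A ⥤ C) :
    Prod.sectR b A ⋙ (𝟭 B).prod f ⟶ f ⋙ Prod.sectR b C where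
  app a := 𝟙 (b, f.obj a)
  naturality _ _ _ := (Category.comp_id _).trans (Category.id_comp _).symm

def sectTransInv (b : B) (f : A ⥤ C) :
    f ⋙ Prod.sectR b C ⟶ Prod.sectR b A ⋙ (𝟭 B).prod f where
  app a := 𝟙 (b, f.obj a)
  naturality _ _ _ := (Category.comp_id _).trans (Category.id_comp _).symm

instance (b : B) (f : A ⥤ C) : IsIso (sectTrans b f) :=
  ⟨sectTransInv b f, by ext <;> exact Category.comp_id _, by ext <;> exact Category.comp_id _⟩

instance (b : B) (f : A ⥤ C) : IsIso (sectTransInv b f) :=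
  ⟨sectTrans b f, by ext <;> exact Category.comp_id _, by ext <;> exact Category.comp_id _⟩

/-- The inclusion of `f / c` in `(id × f) / (b, c)`. -/
def sliceSect (b : B) (f : A ⥤ C) (c : C) :
    CostructuredArrow f c ⥤ CostructuredArrow ((𝟭 B).prod f) (b, c) where
  obj x := CostructuredArrow.mk (Y := (b, x.left)) (show (b, f.obj x.left) ⟶ (b, c) from (𝟙 b, x.hom))
  map g := CostructuredArrow.homMk (𝟙 b, g.left)
    (Prod.ext (Category.comp_id _) (CostructuredArrow.w g))
  map_id x := rfl
  map_comp g h := by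
    ext
    · exact (Category.comp_id _).symm
    · rfl

/-- The projection from `(id × f) / (b, c)` to `f / c`. -/
def sliceProj (b : B) (f : A ⥤ C) (c : C) :
    CostructuredArrow ((𝟭 B).prod f) (b, c) ⥤ CostructuredArrow f c where
  obj y := CostructuredArrow.mk (Y := y.left.2) (show f.obj y.left.2 ⟶ c from y.hom.2)
  map g := CostructuredArrow.homMk g.left.2 (congrArg _root_.Prod.snd (CostructuredArrow.w g))

/-- An object over `(b, c)` with first component `b' ⟶ b` has a universal map to one with first
component `𝟙 b`. Thus `f / c` sits in the big slice by a right adjoint, and colimits may be computed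
on it. -/
def sliceSectAdj (b : B) (f : A ⥤ C) (c : C) : sliceProj b f c ⊣ sliceSect b f c :=
  Adjunction.mkOfHomEquiv
    { homEquiv y x :=
        { toFun g := CostructuredArrow.homMk
            (show (y.left.1, y.left.2) ⟶ (b, x.left) from (y.hom.1, g.left))
            (Prod.ext (Category.comp_id _) (CostructuredArrow.w g))
          invFun g := CostructuredArrow.homMk g.left.2
            (congrArg _root_.Prod.snd (CostructuredArrow.w g))
          left_inv _ := rfl
          right_inv g := by
            ext
            · exact ((congrArg _root_.Prod.fst (CostructuredArrow.w g)).symm).trans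
                (Category.comp_id _)
            · rfl }
      homEquiv_naturality_left_symm _ _ := rfl
      homEquiv_naturality_right _ g := by
        ext
        · exact (Category.comp_id _).symm
        · rfl }

/-- The inclusion of `c / f` in `(b, c) / (id × f)`. -/
def cosliceSect (b : B) (f : A ⥤ C) (c : C) :
    StructuredArrow c f ⥤ StructuredArrow (b, c) ((𝟭 B).prod f) where
  obj x := StructuredArrow.mk (Y := (b, x.right))
    (show (b, c) ⟶ (b, f.obj x.right) from (𝟙 b, x.hom))
  map g := StructuredArrow.homMk (𝟙 b, g.right)
    (Prod.ext (Category.comp_id _) (StructuredArrow.w g))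
  map_id x := rfl
  map_comp g h := by
    ext
    · exact (Category.comp_id _).symm
    · rfl

/-- The projection from `(b, c) / (id × f)` to `c / f`. -/
def cosliceProj (b : B) (f : A ⥤ C) (c : C) :
    StructuredArrow (b, c) ((𝟭 B).prod f) ⥤ StructuredArrow c f where
  obj y := StructuredArrow.mk (Y := y.right.2) (show c ⟶ f.obj y.right.2 from y.hom.2)
  map g := StructuredArrow.homMk g.right.2 (congrArg _root_.Prod.snd (StructuredArrow.w g))

def cosliceSectAdj (b : B) (f : A ⥤ C) (c : C) : cosliceSect b f c ⊣ cosliceProj b f c :=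
  Adjunction.mkOfHomEquiv
    { homEquiv x y :=
        { invFun g := StructuredArrow.homMk
            (show (b, x.right) ⟶ (y.right.1, y.right.2) from (y.hom.1, g.right))
            (Prod.ext (Category.id_comp _) (StructuredArrow.w g))
          toFun g := StructuredArrow.homMk g.right.2
            (congrArg _root_.Prod.snd (StructuredArrow.w g))
          right_inv _ := rfl
          left_inv g := by
            ext
            · exact ((congrArg _root_.Prod.fst (StructuredArrow.w g)).symm).trans
                (Category.id_comp _)
            · rfl }
      homEquiv_naturality_right _ _ := rfl
      homEquiv_naturality_left_symm _ g := by
        ext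
        · exact (Category.id_comp _).symm
        · rfl }

end

section Der

variable {D} (hD : D.IsDerivator)

variable {A B C E J : Type u} [Category.{u} A] [Category.{u} B] [Category.{u} C] [Category.{u} E]
  [Category.{u} J]

include hD

/-- Left Kan extensions along `id × f` are computed in the fibres over `B`. -/
theorem IsDerivator.isUniv_prod_iff (f : A ⥤ C) {X : D.Diag (B × A)} {L : D.Diag (B × C)}
    (η : X ⟶ (D.restr ((𝟭 B).prod f)).obj L) :
    IsUniv (D.restr ((𝟭 B).prod f)) η ↔ ∀ b, IsUniv (D.restr f) (D.ind (sectTrans b f) η) := by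
  -- Both conditions express the value at `(b, c)`, first as a colimit over the slice of `id × f`,
  -- then over the slice of `f` in the fibre at `b`.
  have key : ∀ b c, IsUniv (D.restr (Functor.star.{u} _))
      (D.ind (sliceTrans ((𝟭 B).prod f) (b, c)) η) ↔
        IsUniv (D.restr (Functor.star.{u} _))
          (D.ind (sliceTrans f c) (D.ind (sectTrans b f) η)) := fun b c => by
    rw [← D.isUniv_pasteSq_iff,
      ← D.isUniv_ind_whiskerLeft_iff (sliceSectAdj b f c)]
    refine iff_of_eq (congrArg (fun t => IsUniv (D.restr (Functor.star.{u} _)) (D.ind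
      (p := CostructuredArrow.proj f c ⋙ Prod.sectR b A) (q := Functor.star.{u} _)
      (f := (𝟭 B).prod f) (g := Functor.fromPUnit (b, c)) t η)) ?_)
    ext x
    · exact (Category.id_comp _).symm
    · exact (Category.id_comp _).symm
  constructor
  · exact fun h b => hD.isUniv_of_slice _ _ fun c => (key b c).mp (hD.slice _ _ h)
  · exact fun h => hD.isUniv_of_slice _ _ fun bc => (key bc.1 bc.2).mpr (hD.slice _ _ (h bc.1))

theorem IsDerivator.isCouniv_prod_iff (f : A ⥤ C) {X : D.Diag (B × A)} {L : D.Diag (B × C)}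
    (c : (D.restr ((𝟭 B).prod f)).obj L ⟶ X) :
    IsCouniv (D.restr ((𝟭 B).prod f)) c ↔
      ∀ b, IsCouniv (D.restr f) (D.coind (sectTransInv b f) c) := by
  have key : ∀ b d, IsCouniv (D.restr (Functor.star.{u} _))
      (D.coind (cosliceTrans ((𝟭 B).prod f) (b, d)) c) ↔
        IsCouniv (D.restr (Functor.star.{u} _))
          (D.coind (cosliceTrans f d) (D.coind (sectTransInv b f) c)) := fun b d => by
    rw [← D.isCouniv_copasteSq_iff,
      ← D.isCouniv_coind_whiskerLeft_iff (cosliceSectAdj b f d)]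
    refine iff_of_eq (congrArg (fun t => IsCouniv (D.restr (Functor.star.{u} _)) (D.coind
      (q := StructuredArrow.proj d f ⋙ Prod.sectR b A) (p := Functor.star.{u} _)
      (g := (𝟭 B).prod f) (f := Functor.fromPUnit (b, d)) t c)) ?_)
    ext x
    · exact (Category.comp_id _).symm
    · exact (Category.comp_id _).symm
  constructor
  · exact fun h b => hD.isCouniv_of_coslice _ _ fun d => (key b d).mp (hD.coslice _ _ h)
  · exact fun h => hD.isCouniv_of_coslice _ _ fun bd => (key bd.1 bd.2).mpr (hD.coslice _ _ (h bd.1))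

end Der

end Prederivator
-- Shifts of stable derivators are stable derivators.
namespace Prederivator

variable (D : Prederivator.{u, v, w})

section

variable {A B C E J J' : Type u} [Category.{u} A] [Category.{u} B] [Category.{u} C] [Category.{u} E]
  [Category.{u} J] [Category.{u} J']

/-- The product of a square with `B`. -/
def prodTrans (B : Type u) [Category.{u} B] {A' : Type u} [Category.{u} A'] {p : E ⥤ A}
    {q : E ⥤ A'} {f : A ⥤ C} {g : A' ⥤ C} (α : p ⋙ f ⟶ q ⋙ g) :
    (𝟭 B).prod p ⋙ (𝟭 B).prod f ⟶ (𝟭 B).prod q ⋙ (𝟭 B).prod g :=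
  NatTrans.prod (𝟙 (𝟭 B)) α

theorem shift_squareTrans_app (B : Type u) [Category.{u} B] {A' : Type u} [Category.{u} A']
    {p : E ⥤ A} {q : E ⥤ A'} {f : A ⥤ C} {g : A' ⥤ C} (α : p ⋙ f ⟶ q ⋙ g)
    (L : D.Diag (B × C)) :
    ((D.shift B).squareTrans α).app L = (D.squareTrans (prodTrans B α)).app L := by
  refine ((D.shift B).squareTrans_app α L).trans (Eq.trans ?_
    (D.squareTrans_app (prodTrans B α) L).symm)
  have h₁ := (D.shift B).restrComp_inv_app p f L
  have h₂ := (D.shift B).restrComp_hom_app q g L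
  have h₃ := D.restrComp_inv_app ((𝟭 B).prod p) ((𝟭 B).prod f) L
  have h₄ := D.restrComp_hom_app ((𝟭 B).prod q) ((𝟭 B).prod g) L
  exact congr($(h₁.trans h₃.symm) ≫ (D.restrTrans (prodTrans B α)).app L ≫ $(h₂.trans h₄.symm))

theorem shift_ind (B : Type u) [Category.{u} B] {A' : Type u} [Category.{u} A']
    {p : E ⥤ A} {q : E ⥤ A'} {f : A ⥤ C} {g : A' ⥤ C} (α : p ⋙ f ⟶ q ⋙ g) {X : D.Diag (B × A)}
    {L : D.Diag (B × C)} (η : X ⟶ (D.restr ((𝟭 B).prod f)).obj L) :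
    (D.shift B).ind α (X := X) (L := L) η = D.ind (prodTrans B α) η :=
  congrArg (_ ≫ ·) (D.shift_squareTrans_app B α L)

theorem shift_coind (B : Type u) [Category.{u} B] {A' : Type u} [Category.{u} A']
    {p : E ⥤ A} {q : E ⥤ A'} {f : A ⥤ C} {g : A' ⥤ C} (α : p ⋙ f ⟶ q ⋙ g) {X : D.Diag (B × A')}
    {L : D.Diag (B × C)} (c : (D.restr ((𝟭 B).prod g)).obj L ⟶ X) :
    (D.shift B).coind α (X := X) (L := L) c = D.coind (prodTrans B α) c :=
  congrArg (· ≫ _) (D.shift_squareTrans_app B α L)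

end

theorem isEquivalence_restr {A C : Type u} [Category.{u} A] [Category.{u} C] (k : A ⥤ C)
    [k.IsEquivalence] : (D.restr k).IsEquivalence :=
  let e := k.asEquivalence
  have := D.isIso_restrTrans e.counit
  have := D.isIso_restrTrans e.unit
  (CategoryTheory.Equivalence.mk (D.restr k) (D.restr e.inverse)
    ((D.restrId C).symm ≪≫ (asIso (D.restrTrans e.counit)).symm ≪≫ D.restrComp e.inverse k)
    ((D.restrComp k e.inverse).symm ≪≫ (asIso (D.restrTrans e.unit)).symm ≪≫
      D.restrId A)).isEquivalence_functor

section Der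

variable {D} (hD : D.IsDerivator)

variable {A C E J : Type u} [Category.{u} A] (B : Type u) [Category.{u} B] [Category.{u} C]
  [Category.{u} E] [Category.{u} J]

include hD

/-- Both universality statements are fibrewise over `B` by `isUniv_prod_iff`, and in the fibre over
`b` the claim is the pointwise formula for `f`. -/
theorem IsDerivator.shift_slice (f : A ⥤ C) (c : C) {X : D.Diag (B × A)} {L : D.Diag (B × C)}
    (η : X ⟶ (D.restr ((𝟭 B).prod f)).obj L) (h : IsUniv (D.restr ((𝟭 B).prod f)) η) :
    IsUniv (D.restr ((𝟭 B).prod (Functor.star.{u} _))) (D.ind (prodTrans B (sliceTrans f c)) η) := by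
  rw [hD.isUniv_prod_iff] at h ⊢
  intro b
  have h' := hD.slice f c (h b)
  rw [← D.isUniv_pasteSq_iff] at h' ⊢
  refine (iff_of_eq (congrArg (fun t => IsUniv (D.restr (Functor.star.{u} _)) (D.ind
      (p := CostructuredArrow.proj f c ⋙ Prod.sectR b A) (q := Functor.star.{u} _)
      (f := (𝟭 B).prod f) (g := Functor.fromPUnit (b, c)) t η)) ?_)).mp h'
  ext x
  · rfl
  · exact (Category.id_comp _).trans (Category.comp_id _).symm

theorem IsDerivator.shift_coslice (f : A ⥤ C) (c : C) {X : D.Diag (B × A)} {L : D.Diag (B × C)}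
    (η : (D.restr ((𝟭 B).prod f)).obj L ⟶ X) (h : IsCouniv (D.restr ((𝟭 B).prod f)) η) :
    IsCouniv (D.restr ((𝟭 B).prod (Functor.star.{u} _)))
      (D.coind (prodTrans B (cosliceTrans f c)) η) := by
  rw [hD.isCouniv_prod_iff] at h ⊢
  intro b
  have h' := hD.coslice f c (h b)
  rw [← D.isCouniv_copasteSq_iff] at h' ⊢
  refine (iff_of_eq (congrArg (fun t => IsCouniv (D.restr (Functor.star.{u} _)) (D.coind
      (q := StructuredArrow.proj c f ⋙ Prod.sectR b A) (p := Functor.star.{u} _)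
      (g := (𝟭 B).prod f) (f := Functor.fromPUnit (b, c)) t η)) ?_)).mp h'
  ext x
  · rfl
  · exact (Category.comp_id _).trans (Category.id_comp _).symm

theorem IsDerivator.shift_isIso_iff {X Y : D.Diag (B × A)} (f : X ⟶ Y) :
    IsIso f ↔ ∀ a : A, IsIso ((D.restr ((𝟭 B).prod (Functor.fromPUnit a))).map f) := by
  refine ⟨fun _ _ => inferInstance, fun h => hD.isIso_of_eval f fun ⟨b, a⟩ => ?_⟩
  have := (NatIso.isIso_map_iff (D.restrComp (Functor.fromPUnit (b, ⟨⟨⟩⟩))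
    ((𝟭 B).prod (Functor.fromPUnit a))) f).mpr
      (Functor.map_isIso (D.restr _) ((D.restr ((𝟭 B).prod (Functor.fromPUnit a))).map f))
  exact this

omit hD in
-- Products with `B` distribute over coproducts of categories; this reduces the coproduct axiom for
-- the shift to the one for `D`.
theorem isEquivalence_sigmaDesc_prod {I : Type u} (A : I → Type u) [∀ i, Category.{u} (A i)] :
    (Sigma.desc (fun i => (𝟭 B).prod (Sigma.incl (C := A) i)) :
      (Σ i, B × A i) ⥤ B × (Σ i, A i)).IsEquivalence where
  faithful := ⟨by
    rintro ⟨i, x⟩ ⟨_, y⟩ ⟨f⟩ g h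
    change Sigma.SigmaHom _ _ at g
    obtain ⟨g⟩ := g
    have h₁ := congrArg _root_.Prod.fst h
    have h₂ := congrArg _root_.Prod.snd h
    have h₃ : f.2 = g.2 := (Sigma.incl (C := A) i).map_injective h₂
    exact congrArg _ (_root_.Prod.ext h₁ h₃)⟩
  full := ⟨by
    rintro ⟨i, x⟩ ⟨j, y⟩ ⟨f, g⟩
    change Sigma.SigmaHom (C := A) ⟨i, x.2⟩ ⟨j, y.2⟩ at g
    obtain ⟨g⟩ := g
    exact ⟨Sigma.SigmaHom.mk (f, g), rfl⟩⟩
  essSurj := ⟨fun ⟨b, ⟨i, a⟩⟩ => ⟨⟨i, (b, a)⟩, ⟨Iso.refl _⟩⟩⟩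

theorem IsDerivator.shift_der1 {I : Type u} (A : I → Type u) [∀ i, Category.{u} (A i)] :
    (Functor.pi' fun i => (D.shift B).restr (Sigma.incl (C := A) i)).IsEquivalence := by
  have := isEquivalence_sigmaDesc_prod B A
  let k : (Σ i, B × A i) ⥤ B × (Σ i, A i) :=
    Sigma.desc fun i => (𝟭 B).prod (Sigma.incl (C := A) i)
  have : (D.restr k).IsEquivalence := D.isEquivalence_restr k
  have := hD.der1 fun i => B × A i
  refine Functor.isEquivalence_of_iso (F := D.restr k ⋙
    Functor.pi' fun i => D.restr (Sigma.incl (C := fun i => B × A i) i)) ?_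
  exact NatIso.ofComponents (fun X => Pi.isoMk fun i => (D.restrComp (Sigma.incl i) k).symm.app X)
    fun f => funext fun i => (D.restrComp (Sigma.incl i) k).inv.naturality f

theorem IsDerivator.shift : (D.shift B).IsDerivator where
  der1 A := hD.shift_der1 B A
  der2 f := hD.shift_isIso_iff B f
  der3_left f := hD.der3_left ((𝟭 B).prod f)
  der3_right f := hD.der3_right ((𝟭 B).prod f)
  der4_left f b := der4_left_of_isUniv f b fun η h =>
    (congrArg (IsUniv (D.restr ((𝟭 B).prod (Functor.star.{u} _))))
      (D.shift_ind B (sliceTrans f b) η)).mpr (hD.shift_slice B f b η h)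
  der4_right f b := der4_right_of_isCouniv f b fun η h =>
    (congrArg (IsCouniv (D.restr ((𝟭 B).prod (Functor.star.{u} _))))
      (D.shift_coind B (cosliceTrans f b) η)).mpr (hD.shift_coslice B f b η h)

/-- Restriction has adjoints on both sides, so it preserves initial and terminal objects. -/
theorem IsDerivator.isZero_restr (f : A ⥤ C) {X : D.Diag C} (hX : Limits.IsZero X) :
    Limits.IsZero ((D.restr f).obj X) := by
  have := hD.der3_left f
  have := hD.der3_right f
  exact ⟨fun Y => ⟨⟨⟨((Adjunction.ofIsLeftAdjoint (D.restr f)).homEquiv X Y).symm (hX.to_ _)⟩,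
      fun g => ((Adjunction.ofIsLeftAdjoint (D.restr f)).homEquiv X Y).injective
        (hX.eq_of_src _ _)⟩⟩,
    fun Y => ⟨⟨⟨((Adjunction.ofIsRightAdjoint (D.restr f)).homEquiv Y X) (hX.from_ _)⟩,
      fun g => ((Adjunction.ofIsRightAdjoint (D.restr f)).homEquiv Y X).symm.injective
        (hX.eq_of_tgt _ _)⟩⟩⟩

/-- Combines `isUniv_prod_iff` for `upperIncl` with the description of cocartesian squares by
universality of an identity. Stability of the shift follows from this and its dual. -/
theorem IsDerivator.shift_isCocartesian_iff (X : D.Diag (B × Square.{u})) :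
    IsCocartesian (D := D.shift B) X ↔
      ∀ b, IsCocartesian ((D.restr (Prod.sectR b Square.{u})).obj X) := by
  refine ((hD.shift B).isCocartesian_iff X).trans ((hD.isUniv_prod_iff (B := B) upperIncl.{u}
    (𝟙 ((D.restr ((𝟭 B).prod upperIncl.{u})).obj X))).trans (forall_congr' fun b => ?_))
  rw [hD.isCocartesian_iff]
  have : IsIso (D.ind (sectTrans b upperIncl.{u})
      (𝟙 ((D.restr ((𝟭 B).prod upperIncl.{u})).obj X))) :=
    (D.isIso_ind_iff _ _).mpr inferInstance
  rw [← IsUniv.iso_comp_iff (𝟙 _) (D.ind (sectTrans b upperIncl.{u})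
      (𝟙 ((D.restr ((𝟭 B).prod upperIncl.{u})).obj X))), Category.comp_id]

theorem IsDerivator.shift_isCartesian_iff (X : D.Diag (B × Square.{u})) :
    IsCartesian (D := D.shift B) X ↔
      ∀ b, IsCartesian ((D.restr (Prod.sectR b Square.{u})).obj X) := by
  refine ((hD.shift B).isCartesian_iff X).trans ((hD.isCouniv_prod_iff (B := B) lowerIncl.{u}
    (𝟙 ((D.restr ((𝟭 B).prod lowerIncl.{u})).obj X))).trans (forall_congr' fun b => ?_))
  rw [hD.isCartesian_iff]
  have : IsIso (D.coind (sectTransInv b lowerIncl.{u})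
      (𝟙 ((D.restr ((𝟭 B).prod lowerIncl.{u})).obj X))) :=
    (D.isIso_coind_iff _ _).mpr inferInstance
  rw [← IsCouniv.comp_iso_iff (𝟙 _) (D.coind (sectTransInv b lowerIncl.{u})
      (𝟙 ((D.restr ((𝟭 B).prod lowerIncl.{u})).obj X))), Category.id_comp]

omit hD

theorem IsStableDerivator.shift (hD : D.IsStableDerivator) : (D.shift B).IsStableDerivator where
  toIsDerivator := hD.toIsDerivator.shift B
  pointed := by
    obtain ⟨Z, hZ⟩ := hD.pointed
    exact ⟨_, hD.toIsDerivator.isZero_restr (Functor.star.{u} (B × Pt.{u})) hZ⟩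
  cartesian_iff X := (hD.toIsDerivator.shift_isCartesian_iff B X).trans
    ((forall_congr' fun _ => hD.cartesian_iff _).trans
      (hD.toIsDerivator.shift_isCocartesian_iff B X).symm)

end Der

end Prederivator

/-! ### Invariance of stable derivators under equivalence. -/

section

universe v₁ v₂ v₃ v₄ u₁ u₂ u₃ u₄

variable {𝒞 : Type u₁} [Category.{v₁} 𝒞] {𝒟 : Type u₂} [Category.{v₂} 𝒟]
  {𝒞' : Type u₃} [Category.{v₃} 𝒞'] {𝒟' : Type u₄} [Category.{v₄} 𝒟']

theorem IsUniv.of_natIso_iff {R R' : 𝒞 ⥤ 𝒟} (i : R ≅ R') {X : 𝒟} {L : 𝒞} (η : X ⟶ R.obj L) :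
    IsUniv R' (η ≫ i.hom.app L) ↔ IsUniv R η :=
  ⟨fun h => by simpa using h.of_natIso i.symm, fun h => h.of_natIso i⟩

theorem IsCouniv.of_natIso_iff {R R' : 𝒞 ⥤ 𝒟} (i : R ≅ R') {X : 𝒟} {L : 𝒞} (c : R.obj L ⟶ X) :
    IsCouniv R' (i.inv.app L ≫ c) ↔ IsCouniv R c :=
  ⟨fun h => by simpa using h.of_natIso i.symm, fun h => h.of_natIso i⟩

theorem IsUniv.iso_iff {R : 𝒞 ⥤ 𝒟} {X : 𝒟} {L : 𝒞} (g : X ⟶ R.obj L) [IsIso g] :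
    IsUniv R g ↔ IsUniv R (𝟙 (R.obj L)) := by
  rw [← iso_comp_iff (𝟙 _) g, Category.comp_id]

theorem IsCouniv.iso_iff {R : 𝒞 ⥤ 𝒟} {X : 𝒟} {L : 𝒞} (g : R.obj L ⟶ X) [IsIso g] :
    IsCouniv R g ↔ IsCouniv R (𝟙 (R.obj L)) := by
  rw [← comp_iso_iff (𝟙 _) g, Category.id_comp]

theorem isUniv_precomp_iff (H : 𝒞 ⥤ 𝒞') [H.IsEquivalence] {R : 𝒞' ⥤ 𝒟} {X : 𝒟} {L : 𝒞}
    (η : X ⟶ R.obj (H.obj L)) : IsUniv (H ⋙ R) η ↔ IsUniv R η := by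
  have key : ∀ Z, (Function.Bijective fun g : L ⟶ Z => η ≫ (H ⋙ R).map g) ↔
      Function.Bijective fun g : H.obj L ⟶ H.obj Z => η ≫ R.map g := fun Z => by
    rw [← Function.Bijective.of_comp_iff _
      ((Functor.FullyFaithful.ofFullyFaithful H).map_bijective L Z)]
    rfl
  refine ⟨fun h Z => ?_, fun h Z => (key Z).mpr (h _)⟩
  have h₁ := (key _).mp (h (H.objPreimage Z))
  let e := H.objObjPreimageIso Z
  convert ((R.mapIso e).homToEquiv (Z := X)).bijective.comp
    (h₁.comp (e.homToEquiv (Z := H.obj L)).symm.bijective) using 1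
  funext g
  change η ≫ R.map g = (η ≫ R.map (g ≫ e.inv)) ≫ R.map e.hom
  rw [Category.assoc, ← R.map_comp, Category.assoc, e.inv_hom_id, Category.comp_id]

theorem isCouniv_precomp_iff (H : 𝒞 ⥤ 𝒞') [H.IsEquivalence] {R : 𝒞' ⥤ 𝒟} {X : 𝒟} {L : 𝒞}
    (c : R.obj (H.obj L) ⟶ X) : IsCouniv (H ⋙ R) c ↔ IsCouniv R c := by
  have key : ∀ Z, (Function.Bijective fun g : Z ⟶ L => (H ⋙ R).map g ≫ c) ↔
      Function.Bijective fun g : H.obj Z ⟶ H.obj L => R.map g ≫ c := fun Z => by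
    rw [← Function.Bijective.of_comp_iff _
      ((Functor.FullyFaithful.ofFullyFaithful H).map_bijective Z L)]
    rfl
  refine ⟨fun h Z => ?_, fun h Z => (key Z).mpr (h _)⟩
  have h₁ := (key _).mp (h (H.objPreimage Z))
  let e := H.objObjPreimageIso Z
  convert ((R.mapIso e).homFromEquiv (Z := X)).bijective.comp
    (h₁.comp (e.homFromEquiv (Z := H.obj L)).symm.bijective) using 1
  funext g
  change R.map g ≫ c = R.map e.inv ≫ R.map (e.hom ≫ g) ≫ c
  rw [← Category.assoc, ← R.map_comp, e.inv_hom_id_assoc]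

/-- Universal arrows correspond under equivalences of categories. -/
theorem isUniv_map_iff {R : 𝒞 ⥤ 𝒟} {R' : 𝒞' ⥤ 𝒟'} {H : 𝒞 ⥤ 𝒞'} {G : 𝒟 ⥤ 𝒟'} [H.IsEquivalence]
    [G.IsEquivalence] (i : R ⋙ G ≅ H ⋙ R') {X : 𝒟} {L : 𝒞} (η : X ⟶ R.obj L) :
    IsUniv R' (X := G.obj X) (L := H.obj L) (G.map η ≫ i.hom.app L) ↔ IsUniv R η := by
  have key : IsUniv (R ⋙ G) (G.map η) ↔ IsUniv R η := forall_congr' fun Z => by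
    rw [← Function.Bijective.of_comp_iff' ((Functor.FullyFaithful.ofFullyFaithful G).map_bijective
      X (R.obj Z))]
    exact iff_of_eq (congrArg Function.Bijective (funext fun g => (G.map_comp η (R.map g)).symm))
  rw [← key, ← IsUniv.of_natIso_iff i]
  exact (isUniv_precomp_iff H (R := R') (L := L) (X := G.obj X) _).symm

theorem isCouniv_map_iff {R : 𝒞 ⥤ 𝒟} {R' : 𝒞' ⥤ 𝒟'} {H : 𝒞 ⥤ 𝒞'} {G : 𝒟 ⥤ 𝒟'} [H.IsEquivalence]
    [G.IsEquivalence] (i : R ⋙ G ≅ H ⋙ R') {X : 𝒟} {L : 𝒞} (c : R.obj L ⟶ X) :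
    IsCouniv R' (X := G.obj X) (L := H.obj L) (i.inv.app L ≫ G.map c) ↔ IsCouniv R c := by
  have key : IsCouniv (R ⋙ G) (G.map c) ↔ IsCouniv R c := forall_congr' fun Z => by
    rw [← Function.Bijective.of_comp_iff' ((Functor.FullyFaithful.ofFullyFaithful G).map_bijective
      (R.obj Z) X)]
    exact iff_of_eq (congrArg Function.Bijective (funext fun g => (G.map_comp (R.map g) c).symm))
  rw [← key, ← IsCouniv.of_natIso_iff i]
  exact (isCouniv_precomp_iff H (R := R') (L := L) (X := G.obj X) _).symm

end

namespace Prederivator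

variable {D E : Prederivator.{u, v, w}} (G : D.toPseudofunctor ⟶ E.toPseudofunctor)

section

variable {A B C J : Type u} [Category.{u} A] [Category.{u} B] [Category.{u} C] [Category.{u} J]

/-- Morphisms of prederivators commute with restriction functors up to natural isomorphism. -/
abbrev compRestrNatIso (f : A ⥤ B) :
    D.restr f ⋙ component G A ≅ component G B ⋙ E.restr f :=
  Cat.Hom.toNatIso (G.naturality f.toCatHom.op)

theorem compRestrNatIso_comp (f : A ⥤ B) (g : B ⥤ C) (L : D.Diag C) :
    (component G A).map ((D.restrComp f g).hom.app L) ≫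
        (compRestrNatIso G f).hom.app ((D.restr g).obj L) ≫
          (E.restr f).map ((compRestrNatIso G g).hom.app L) =
      (compRestrNatIso G (f ⋙ g)).hom.app L ≫
        (E.restrComp f g).hom.app ((component G C).obj L) := by
  have h := naturality_comp_app G g.toCatHom.op f.toCatHom.op L
  rw [restrComp_hom_app, restrComp_hom_app]
  exact (congrArg (· ≫ _) (eqToHom_map (component G A) _)).trans h.symm

theorem compRestrNatIso_trans {f g : A ⥤ B} (α : f ⟶ g) (L : D.Diag B) :
    (component G A).map ((D.restrTrans α).app L) ≫ (compRestrNatIso G g).hom.app L =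
      (compRestrNatIso G f).hom.app L ≫ (E.restrTrans α).app ((component G B).obj L) :=
  congrArg (fun t => t.toNatTrans.app L) (G.naturality_naturality (op2 α.toCatHom₂))

theorem map_squareTrans {p : J ⥤ A} {q : J ⥤ B} {f : A ⥤ C} {g : B ⥤ C} (α : p ⋙ f ⟶ q ⋙ g)
    (L : D.Diag C) :
    (component G J).map ((D.squareTrans α).app L) ≫
        (compRestrNatIso G q).hom.app ((D.restr g).obj L) ≫
          (E.restr q).map ((compRestrNatIso G g).hom.app L) =
      ((compRestrNatIso G p).hom.app ((D.restr f).obj L) ≫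
        (E.restr p).map ((compRestrNatIso G f).hom.app L)) ≫
          (E.squareTrans α).app ((component G C).obj L) := by
  have h₁ := compRestrNatIso_comp G p f L
  have h₂ := compRestrNatIso_comp G q g L
  have h₃ := compRestrNatIso_trans G α L
  rw [squareTrans_app, squareTrans_app, Functor.map_comp, Functor.map_comp, Category.assoc,
    Category.assoc, h₂, reassoc_of% h₃]
  have h₄ : (component G J).map ((D.restrComp p f).inv.app L) ≫
      (compRestrNatIso G (p ⋙ f)).hom.app L = ((compRestrNatIso G p).hom.app ((D.restr f).obj L) ≫
        (E.restr p).map ((compRestrNatIso G f).hom.app L)) ≫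
          (E.restrComp p f).inv.app ((component G C).obj L) := by
    rw [← cancel_epi ((component G J).map ((D.restrComp p f).hom.app L)),
      ← Functor.map_comp_assoc, Iso.hom_inv_id_app, Category.assoc, reassoc_of% h₁]
    simp
  rw [reassoc_of% h₄]
  simp only [Category.assoc]

/-- A morphism of prederivators carries induced arrows to induced arrows, up to its structure
isomorphisms. With `isUniv_component_iff` this transports the pointwise axiom. -/
theorem map_ind {p : J ⥤ A} {q : J ⥤ B} {f : A ⥤ C} {g : B ⥤ C} (α : p ⋙ f ⟶ q ⋙ g)
    {X : D.Diag A} {L : D.Diag C} (η : X ⟶ (D.restr f).obj L) :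
    ((component G J).map (D.ind α η) ≫ (compRestrNatIso G q).hom.app ((D.restr g).obj L)) ≫
        (E.restr q).map ((compRestrNatIso G g).hom.app L) =
      (compRestrNatIso G p).hom.app X ≫
        E.ind α ((component G A).map η ≫ (compRestrNatIso G f).hom.app L) := by
  have h₁ := map_squareTrans G α L
  have h₂ := (compRestrNatIso G p).hom.naturality η
  dsimp only [Functor.comp_map] at h₂
  rw [ind, ind, Functor.map_comp, Category.assoc, Category.assoc, h₁, Category.assoc,
    reassoc_of% h₂, Functor.map_comp, Category.assoc]

theorem map_coind {p : J ⥤ A} {q : J ⥤ B} {f : A ⥤ C} {g : B ⥤ C} (α : p ⋙ f ⟶ q ⋙ g)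
    {X : D.Diag B} {L : D.Diag C} (c : (D.restr g).obj L ⟶ X) :
    (E.restr p).map ((compRestrNatIso G f).inv.app L) ≫
      (compRestrNatIso G p).inv.app ((D.restr f).obj L) ≫ (component G J).map (D.coind α c) =
      E.coind α ((compRestrNatIso G g).inv.app L ≫ (component G B).map c) ≫
        (compRestrNatIso G q).inv.app X := by
  have h₁ := map_squareTrans G α L
  have h₂ := (compRestrNatIso G q).inv.naturality c
  dsimp only [Functor.comp_map] at h₂
  have h₃ : (E.restr p).map ((compRestrNatIso G f).hom.app L) ≫
      (E.restr p).map ((compRestrNatIso G f).inv.app L) = 𝟙 _ := by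
    rw [← Functor.map_comp, Iso.hom_inv_id_app]
    exact CategoryTheory.Functor.map_id _ _
  have h₄ : (E.restr q).map ((compRestrNatIso G g).hom.app L) ≫
      (E.restr q).map ((compRestrNatIso G g).inv.app L) = 𝟙 _ := by
    rw [← Functor.map_comp, Iso.hom_inv_id_app]
    exact CategoryTheory.Functor.map_id _ _
  simp only [Category.assoc] at h₁
  have h₅ := reassoc_of% h₁.symm
  rw [coind, coind, Functor.map_comp, Functor.map_comp, Category.assoc, Category.assoc, h₂,
    ← cancel_epi ((compRestrNatIso G p).hom.app ((D.restr f).obj L) ≫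
        (E.restr p).map ((compRestrNatIso G f).hom.app L)), Category.assoc, Category.assoc, h₅,
    reassoc_of% h₃, reassoc_of% h₄, Iso.hom_inv_id_app_assoc, Iso.hom_inv_id_app_assoc]

end

section Transfer

variable (hG : ∀ (A : Type u) [Category.{u} A], (component G A).IsEquivalence)
include hG

theorem isUniv_component_iff {A B : Type u} [Category.{u} A] [Category.{u} B] (f : A ⥤ B)
    {X : D.Diag A} {L : D.Diag B} (η : X ⟶ (D.restr f).obj L) :
    IsUniv (E.restr f) (X := (component G A).obj X) (L := (component G B).obj L)
      ((component G A).map η ≫ (compRestrNatIso G f).hom.app L) ↔ IsUniv (D.restr f) η :=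
  have := hG A
  have := hG B
  isUniv_map_iff (compRestrNatIso G f) η

theorem isCouniv_component_iff {A B : Type u} [Category.{u} A] [Category.{u} B] (f : A ⥤ B)
    {X : D.Diag A} {L : D.Diag B} (c : (D.restr f).obj L ⟶ X) :
    IsCouniv (E.restr f) (X := (component G A).obj X) (L := (component G B).obj L)
      ((compRestrNatIso G f).inv.app L ≫ (component G A).map c) ↔ IsCouniv (D.restr f) c :=
  have := hG A
  have := hG B
  isCouniv_map_iff (compRestrNatIso G f) c

/-- The axioms speak only of restriction functors, isomorphisms and universal arrows. Levelwise
equivalences which commute with restriction preserve and reflect all of them. -/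
theorem IsDerivator.of_equivalence (hE : E.IsDerivator) : D.IsDerivator where
  der1 {I} A _ := by
    have := hE.der1 A
    have := fun i => hG (A i)
    have := hG (Σ i, A i)
    let e : (∀ i, D.Diag (A i)) ≌ ∀ i, E.Diag (A i) :=
      CategoryTheory.Equivalence.pi fun i => (component G (A i)).asEquivalence
    have : ((Functor.pi' fun i => D.restr (Sigma.incl (C := A) i)) ⋙ e.functor).IsEquivalence := by
      refine Functor.isEquivalence_of_iso (F := component G (Σ i, A i) ⋙
        Functor.pi' fun i => E.restr (Sigma.incl (C := A) i)) ?_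
      exact NatIso.ofComponents
        (fun X => Pi.isoMk fun i => (compRestrNatIso G (Sigma.incl i)).symm.app X)
        fun f => funext fun i => (compRestrNatIso G (Sigma.incl i)).inv.naturality f
    exact Functor.isEquivalence_of_comp_right _ e.functor
  der2 {A} _ {X Y} f := by
    have := hG A
    have := hG Pt.{u}
    rw [← isIso_iff_of_reflects_iso f (component G A), hE.der2]
    refine forall_congr' fun a => ?_
    rw [← isIso_iff_of_reflects_iso ((D.eval a).map f) (component G Pt)]
    exact (NatIso.isIso_map_iff (compRestrNatIso G (Functor.fromPUnit a)) f).symm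
  der3_left {A B} _ _ f := by
    have := hG A
    have := hG B
    have := hE.der3_left f
    refine Functor.isRightAdjoint_of_iso (F := (component G B ⋙ E.restr f) ⋙ (component G A).inv)
      (Functor.isoWhiskerRight (compRestrNatIso G f).symm _ ≪≫ Functor.associator _ _ _ ≪≫
        Functor.isoWhiskerLeft _ (component G A).asEquivalence.unitIso.symm ≪≫
          Functor.rightUnitor _)
  der3_right {A B} _ _ f := by
    have := hG A
    have := hG B
    have := hE.der3_right f
    refine Functor.isLeftAdjoint_of_iso (F := (component G B ⋙ E.restr f) ⋙ (component G A).inv)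
      (Functor.isoWhiskerRight (compRestrNatIso G f).symm _ ≪≫ Functor.associator _ _ _ ≪≫
        Functor.isoWhiskerLeft _ (component G A).asEquivalence.unitIso.symm ≪≫
          Functor.rightUnitor _)
  der4_left f b := der4_left_of_isUniv f b fun η h => by
    rw [← isUniv_component_iff G hG] at h ⊢
    rw [← IsUniv.comp_iso_iff _ ((compRestrNatIso G (Functor.fromPUnit b)).hom.app _), map_ind,
      IsUniv.iso_comp_iff]
    exact hE.slice f b h
  der4_right f b := der4_right_of_isCouniv f b fun c h => by
    rw [← isCouniv_component_iff G hG] at h ⊢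
    rw [← IsCouniv.iso_comp_iff _ ((compRestrNatIso G (Functor.fromPUnit b)).inv.app _), map_coind,
      IsCouniv.comp_iso_iff]
    exact hE.coslice f b h

/-- Stable derivators are invariant under equivalences of prederivators. -/
theorem IsStableDerivator.of_equivalence (hE : E.IsStableDerivator) : D.IsStableDerivator where
  toIsDerivator := IsDerivator.of_equivalence G hG hE.toIsDerivator
  pointed := by
    have := hG Pt.{u}
    obtain ⟨Z, hZ⟩ := hE.pointed
    exact ⟨_, Limits.IsZero.of_full_of_faithful_of_isZero (component G Pt) _
      (hZ.of_iso ((component G Pt).objObjPreimageIso Z))⟩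
  cartesian_iff X := by
    have hD := IsDerivator.of_equivalence G hG hE.toIsDerivator
    have h₁ : IsCartesian X ↔ IsCartesian ((component G Square).obj X) :=
      (hD.isCartesian_iff X).trans ((isCouniv_component_iff G hG lowerIncl _).symm.trans
        ((IsCouniv.iso_iff (R := E.restr lowerIncl) (L := (component G Square).obj X) _).trans
          (hE.toIsDerivator.isCartesian_iff _).symm))
    have h₂ : IsCocartesian X ↔ IsCocartesian ((component G Square).obj X) :=
      (hD.isCocartesian_iff X).trans ((isUniv_component_iff G hG upperIncl _).symm.trans
        ((IsUniv.iso_iff (R := E.restr upperIncl) (L := (component G Square).obj X) _).trans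
          (hE.toIsDerivator.isCocartesian_iff _).symm))
    rw [h₁, h₂, hE.cartesian_iff]

end Transfer

end Prederivator

/-! ### Values of Kan extensions at single objects. -/

namespace Prederivator

section

variable (D : Prederivator.{u, v, w}) {A B C : Type u} [Category.{u} A] [Category.{u} B]
  [Category.{u} C]

def fromPUnitCompIso (i : A ⥤ B) (a : A) :
    (Functor.fromPUnit a ⋙ i : Pt.{u} ⥤ B) ≅ Functor.fromPUnit (i.obj a) :=
  NatIso.ofComponents (fun _ => Iso.refl _) fun _ => congrArg (· ≫ 𝟙 (i.obj a)) (i.map_id a)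

/-- Evaluation of a restricted diagram. -/
noncomputable def evalRestrIso (i : A ⥤ B) (a : A) : D.restr i ⋙ D.eval a ≅ D.eval (i.obj a) :=
  have := D.isIso_restrTrans (fromPUnitCompIso i a).hom
  (D.restrComp (Functor.fromPUnit a) i).symm ≪≫ asIso (D.restrTrans (fromPUnitCompIso i a).hom)

theorem isIso_eval_restr_iff (i : A ⥤ B) (a : A) {X Y : D.Diag B} (f : X ⟶ Y) :
    IsIso ((D.eval a).map ((D.restr i).map f)) ↔ IsIso ((D.eval (i.obj a)).map f) :=
  NatIso.isIso_map_iff (D.evalRestrIso i a) f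

theorem isZero_eval_restr_iff (i : A ⥤ B) (a : A) (X : D.Diag B) :
    Limits.IsZero ((D.eval a).obj ((D.restr i).obj X)) ↔
      Limits.IsZero ((D.eval (i.obj a)).obj X) :=
  Iso.isZero_iff ((D.evalRestrIso i a).app X)

end

section Der

variable {D : Prederivator.{u, v, w}} (hD : D.IsDerivator)
include hD

/-- The coproduct axiom for the empty family: diagrams on an empty category form a category
equivalent to the terminal one. -/
theorem IsDerivator.nonempty_unique_hom {J : Type u} [Category.{u} J] [IsEmpty J]
    (X Y : D.Diag J) : Nonempty (Unique (X ⟶ Y)) := by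
  let k : J ⥤ (Σ _ : PEmpty.{u + 1}, Pt.{u}) :=
    { obj := isEmptyElim, map := fun {x} => isEmptyElim x, map_id := isEmptyElim
      map_comp := fun {x} => isEmptyElim x }
  have : k.IsEquivalence :=
    { faithful := ⟨fun {x} _ _ _ _ => (IsEmpty.false x).elim⟩
      full := ⟨fun {x} => (IsEmpty.false x).elim⟩
      essSurj := ⟨fun x => x.1.elim⟩ }
  have := D.isEquivalence_restr k
  have := hD.der1 fun _ : PEmpty.{u + 1} => Pt.{u}
  let F := (D.restr k).inv ⋙ Functor.pi' fun i => D.restr (Sigma.incl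
    (C := fun _ : PEmpty.{u + 1} => Pt.{u}) i)
  have : Unique (F.obj X ⟶ F.obj Y) := ⟨⟨fun i => i.elim⟩, fun _ => funext fun i => i.elim⟩
  exact ⟨(Functor.FullyFaithful.ofFullyFaithful F).homEquiv.unique⟩

/-- The value is a colimit over an empty slice. In a stable derivator this produces zeros on the
boundary. -/
theorem IsDerivator.isInitial_eval {A B : Type u} [Category.{u} A] [Category.{u} B] (f : A ⥤ B)
    (b : B) [IsEmpty (CostructuredArrow f b)] {X : D.Diag A} {L : D.Diag B}
    {η : X ⟶ (D.restr f).obj L} (h : IsUniv (D.restr f) η) :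
    Nonempty (Limits.IsInitial ((D.eval b).obj L)) := by
  have key : ∀ Z, Nonempty (Unique ((D.eval b).obj L ⟶ Z)) := fun Z => by
    obtain ⟨_⟩ := hD.nonempty_unique_hom ((D.restr (CostructuredArrow.proj f b)).obj X)
      ((D.restr (Functor.star.{u} (CostructuredArrow f b))).obj Z)
    exact ⟨(Equiv.ofBijective _ (hD.slice f b h Z)).unique⟩
  have := fun Z => (key Z).some
  exact ⟨Limits.IsInitial.ofUnique _⟩

theorem IsDerivator.isTerminal_eval {A B : Type u} [Category.{u} A] [Category.{u} B] (f : A ⥤ B)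
    (b : B) [IsEmpty (StructuredArrow b f)] {X : D.Diag A} {L : D.Diag B}
    {c : (D.restr f).obj L ⟶ X} (h : IsCouniv (D.restr f) c) :
    Nonempty (Limits.IsTerminal ((D.eval b).obj L)) := by
  have key : ∀ Z, Nonempty (Unique (Z ⟶ (D.eval b).obj L)) := fun Z => by
    obtain ⟨_⟩ := hD.nonempty_unique_hom
      ((D.restr (Functor.star.{u} (StructuredArrow b f))).obj Z)
      ((D.restr (StructuredArrow.proj b f)).obj X)
    exact ⟨(Equiv.ofBijective _ (hD.coslice f b h Z)).unique⟩
  have := fun Z => (key Z).some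
  exact ⟨Limits.IsTerminal.ofUnique _⟩

/-- A diagram extended from `A` is also extended from the intermediate `B`. Extending in two steps
gives a universal arrow along `f ⋙ g`, hence an object isomorphic to `X`; the second step is along
the fully faithful `g`, so its unit is invertible. -/
theorem IsDerivator.isUniv_of_comp {A B C : Type u} [Category.{u} A] [Category.{u} B]
    [Category.{u} C] (f : A ⥤ B) (g : B ⥤ C) [g.Full] [g.Faithful] {X : D.Diag C}
    (h : IsUniv (D.restr (f ⋙ g)) (𝟙 ((D.restr (f ⋙ g)).obj X))) :
    IsUniv (D.restr g) (𝟙 ((D.restr g).obj X)) := by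
  obtain ⟨M, η, hη⟩ := hD.exists_lan f ((D.restr f).obj ((D.restr g).obj X))
  obtain ⟨N, θ, hθ⟩ := hD.exists_lan g M
  have hθ' := hD.isIso_of_isUniv g hθ
  have h₁ := (hη.comp_iff θ).mpr hθ
  have h₂ := (IsUniv.iso_iff ((D.restrComp f g).inv.app X) (R := D.restr (f ⋙ g))).mpr h
  have h₃ : IsUniv (D.restr g ⋙ D.restr f) (𝟙 ((D.restr f).obj ((D.restr g).obj X))) := by
    have := h₂.of_natIso (D.restrComp f g)
    rwa [Iso.inv_hom_id_app] at this
  obtain ⟨k, hk⟩ := h₃.exists_fac (η ≫ (D.restr f).map θ)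
  have : IsIso k := h₃.isIso_of_comp k (by rw [hk]; exact h₁)
  have h₄ := hθ.comp_iso (inv k)
  have : IsIso (θ ≫ (D.restr g).map (inv k)) := inferInstance
  exact (IsUniv.iso_iff _).mp h₄

theorem IsDerivator.isCouniv_of_comp {A B C : Type u} [Category.{u} A] [Category.{u} B]
    [Category.{u} C] (f : A ⥤ B) (g : B ⥤ C) [g.Full] [g.Faithful] {X : D.Diag C}
    (h : IsCouniv (D.restr (f ⋙ g)) (𝟙 ((D.restr (f ⋙ g)).obj X))) :
    IsCouniv (D.restr g) (𝟙 ((D.restr g).obj X)) := by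
  obtain ⟨M, η, hη⟩ := hD.exists_ran f ((D.restr f).obj ((D.restr g).obj X))
  obtain ⟨N, θ, hθ⟩ := hD.exists_ran g M
  have hθ' := hD.isIso_of_isCouniv g hθ
  have h₁ := (hη.comp_iff θ).mpr hθ
  have h₂ := (IsCouniv.iso_iff ((D.restrComp f g).hom.app X) (R := D.restr (f ⋙ g))).mpr h
  have h₃ : IsCouniv (D.restr g ⋙ D.restr f) (𝟙 ((D.restr f).obj ((D.restr g).obj X))) := by
    have := h₂.of_natIso (D.restrComp f g)
    rwa [Iso.inv_hom_id_app] at this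
  obtain ⟨k, hk⟩ := h₃.exists_fac ((D.restr f).map θ ≫ η)
  have : IsIso k := h₃.isIso_of_comp k (by rw [hk]; exact h₁)
  have h₄ := hθ.iso_comp (inv k)
  have : IsIso ((D.restr g).map (inv k) ≫ θ) := inferInstance
  exact (IsCouniv.iso_iff _).mp h₄

omit hD in
theorem isUniv_of_isIso_of_isEquivalence {𝒞 𝒟 : Type*} [Category 𝒞] [Category 𝒟] {R : 𝒞 ⥤ 𝒟}
    [R.IsEquivalence] {X : 𝒟} {L : 𝒞} (η : X ⟶ R.obj L) [IsIso η] : IsUniv R η :=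
  (IsUniv.iso_iff η).mpr fun Z => by
    simpa using (Functor.FullyFaithful.ofFullyFaithful R).map_bijective L Z

omit hD in
theorem isCouniv_of_isIso_of_isEquivalence {𝒞 𝒟 : Type*} [Category 𝒞] [Category 𝒟] {R : 𝒞 ⥤ 𝒟}
    [R.IsEquivalence] {X : 𝒟} {L : 𝒞} (c : R.obj L ⟶ X) [IsIso c] : IsCouniv R c :=
  (IsCouniv.iso_iff c).mpr fun Z => by
    simpa using (Functor.FullyFaithful.ofFullyFaithful R).map_bijective Z L

omit hD in
/-- The universality of `η` has to be checked only at objects outside of the image of a fully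
faithful functor if `η` is invertible. -/
theorem isUniv_slice_of_isIso {A B : Type u} [Category.{u} A] [Category.{u} B] (f : A ⥤ B) [f.Full]
    [f.Faithful] (a : A) {X : D.Diag A} {L : D.Diag B} (η : X ⟶ (D.restr f).obj L) [IsIso η] :
    IsUniv (D.restr (Functor.star.{u} _)) (D.ind (sliceTrans f (f.obj a)) η) := by
  rw [← D.isUniv_ind_whiskerLeft_iff (sliceTerminalAdj f a)]
  have : IsIso (Functor.whiskerLeft (Functor.fromPUnit (CostructuredArrow.mk (𝟙 (f.obj a))))
      (sliceTrans f (f.obj a))) := by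
    rw [NatTrans.isIso_iff_isIso_app]
    intro x
    exact inferInstanceAs (IsIso (𝟙 (f.obj a)))
  have := (D.isIso_ind_iff (p := Functor.fromPUnit (CostructuredArrow.mk (𝟙 (f.obj a))) ⋙
    CostructuredArrow.proj f (f.obj a)) (q := Functor.star.{u} Pt.{u}) (f := f)
    (g := Functor.fromPUnit (f.obj a))
    (Functor.whiskerLeft (Functor.fromPUnit (CostructuredArrow.mk (𝟙 (f.obj a))))
      (sliceTrans f (f.obj a))) η).mpr inferInstance
  exact isUniv_of_isIso_of_isEquivalence (R := D.restr (Functor.star.{u} Pt.{u})) _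

omit hD in
theorem isCouniv_coslice_of_isIso {A B : Type u} [Category.{u} A] [Category.{u} B] (f : A ⥤ B)
    [f.Full] [f.Faithful] (a : A) {X : D.Diag A} {L : D.Diag B} (c : (D.restr f).obj L ⟶ X)
    [IsIso c] :
    IsCouniv (D.restr (Functor.star.{u} _)) (D.coind (cosliceTrans f (f.obj a)) c) := by
  rw [← D.isCouniv_coind_whiskerLeft_iff (cosliceInitialAdj f a)]
  have : IsIso (Functor.whiskerLeft (Functor.fromPUnit (StructuredArrow.mk (𝟙 (f.obj a))))
      (cosliceTrans f (f.obj a))) := by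
    rw [NatTrans.isIso_iff_isIso_app]
    intro x
    exact inferInstanceAs (IsIso (𝟙 (f.obj a)))
  have := (D.isIso_coind_iff (q := Functor.fromPUnit (StructuredArrow.mk (𝟙 (f.obj a))) ⋙
    StructuredArrow.proj (f.obj a) f) (p := Functor.star.{u} Pt.{u}) (g := f)
    (f := Functor.fromPUnit (f.obj a))
    (Functor.whiskerLeft (Functor.fromPUnit (StructuredArrow.mk (𝟙 (f.obj a))))
      (cosliceTrans f (f.obj a))) c).mpr inferInstance
  exact isCouniv_of_isIso_of_isEquivalence (R := D.restr (Functor.star.{u} Pt.{u})) _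

end Der

end Prederivator

/-! ### Detection of cocartesian and cartesian squares. -/

namespace Prederivator

/-- The terminal vertex of the square. -/
abbrev Square.last : Square.{u} := ⟨(1, 1)⟩

/-- The initial vertex of the square. -/
abbrev Square.first : Square.{u} := ⟨(0, 0)⟩

def upperSlice : UpperCorner.{u} ⥤ CostructuredArrow upperIncl.{u} Square.last.{u} where
  obj x := CostructuredArrow.mk (Y := x)
    (homOfLE (show x.1.down ≤ ((1, 1) : Fin 2 × Fin 2) from ⟨Fin.le_last _, Fin.le_last _⟩))
  map g := CostructuredArrow.homMk g (Subsingleton.elim _ _)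

instance : upperSlice.{u}.IsEquivalence where
  faithful := ⟨fun _ => Subsingleton.elim _ _⟩
  full := ⟨fun g => ⟨g.left, CostructuredArrow.hom_ext _ _ (Subsingleton.elim _ _)⟩⟩
  essSurj := ⟨fun y => ⟨y.left, ⟨CostructuredArrow.isoMk (Iso.refl _) (Subsingleton.elim _ _)⟩⟩⟩

def lowerCoslice : LowerCorner.{u} ⥤ StructuredArrow Square.first.{u} lowerIncl.{u} where
  obj x := StructuredArrow.mk (Y := x)
    (homOfLE (show ((0, 0) : Fin 2 × Fin 2) ≤ x.1.down from ⟨Fin.zero_le _, Fin.zero_le _⟩))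
  map g := StructuredArrow.homMk g (Subsingleton.elim _ _)

instance : lowerCoslice.{u}.IsEquivalence where
  faithful := ⟨fun _ => Subsingleton.elim _ _⟩
  full := ⟨fun g => ⟨g.right, StructuredArrow.hom_ext _ _ (Subsingleton.elim _ _)⟩⟩
  essSurj := ⟨fun y => ⟨y.right, ⟨StructuredArrow.isoMk (Iso.refl _) (Subsingleton.elim _ _)⟩⟩⟩

variable {D : Prederivator.{u, v, w}} (hD : D.IsDerivator) {K L : Type u} [Category.{u} K]
  [Preorder L]
include hD

/-- Detection of cocartesian squares in left Kan extensions. -/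
theorem IsDerivator.isCocartesian_of_isUniv (f : K ⥤ L) (i : Square.{u} ⥤ L)
    (r : UpperCorner.{u} ⥤ CostructuredArrow f (i.obj Square.last)) [r.IsRightAdjoint]
    (hr : ∀ x, f.obj (r.obj x).left = i.obj x.1) {X : D.Diag L}
    (h : IsUniv (D.restr f) (𝟙 ((D.restr f).obj X))) : IsCocartesian ((D.restr i).obj X) := by
  let α : (r ⋙ CostructuredArrow.proj f (i.obj Square.last)) ⋙ f ⟶ upperIncl.{u} ⋙ i :=
    { app x := eqToHom (hr x), naturality _ _ _ := Subsingleton.elim _ _ }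
  have : IsIso α := by
    rw [NatTrans.isIso_iff_isIso_app]
    intro x
    exact inferInstanceAs (IsIso (eqToHom (hr x)))
  have hα := (D.isIso_ind_iff α (𝟙 ((D.restr f).obj X))).mpr inferInstance
  refine (hD.isCocartesian_iff _).mpr ((IsUniv.iso_iff
    (D.ind α (𝟙 ((D.restr f).obj X)))).mp (hD.isUniv_of_slice upperIncl.{u} _ fun s => ?_))
  by_cases hs : s.down = (1, 1)
  · obtain rfl : s = Square.last := ULift.ext _ _ hs
    rw [← D.isUniv_ind_whiskerLeft_iff upperSlice.{u}.asEquivalence.symm.toAdjunction,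
      ← D.isUniv_pasteSq_iff]
    -- The value at the terminal vertex is a colimit over the slice of `f`; restricting along the
    -- right adjoint `r` turns it into a colimit over the corner.
    have h₁ := (D.isUniv_ind_whiskerLeft_iff (Adjunction.ofIsRightAdjoint r)
      (sliceTrans f (i.obj Square.last)) _).mpr (hD.slice f (i.obj Square.last) h)
    refine (iff_of_eq (congrArg (fun t => IsUniv (D.restr (Functor.star.{u} UpperCorner.{u}))
      (D.ind (p := r ⋙ CostructuredArrow.proj f (i.obj Square.last)) (q := Functor.star.{u} _)
      (f := f) (g := Functor.fromPUnit (i.obj Square.last)) t (𝟙 ((D.restr f).obj X)))) ?_)).mp h₁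
    ext x
    exact Subsingleton.elim _ _
  -- At the vertices of the corner universality is automatic, the induced arrow being invertible and
  -- `upperIncl` fully faithful.
  · exact isUniv_slice_of_isIso upperIncl.{u} (⟨s, hs⟩ : UpperCorner.{u}) _

theorem IsDerivator.isCartesian_of_isCouniv (f : K ⥤ L) (i : Square.{u} ⥤ L)
    (r : LowerCorner.{u} ⥤ StructuredArrow (i.obj Square.first) f) [r.IsLeftAdjoint]
    (hr : ∀ x, i.obj x.1 = f.obj (r.obj x).right) {X : D.Diag L}
    (h : IsCouniv (D.restr f) (𝟙 ((D.restr f).obj X))) : IsCartesian ((D.restr i).obj X) := by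
  let α : lowerIncl.{u} ⋙ i ⟶ (r ⋙ StructuredArrow.proj (i.obj Square.first) f) ⋙ f :=
    { app x := eqToHom (hr x), naturality _ _ _ := Subsingleton.elim _ _ }
  have : IsIso α := by
    rw [NatTrans.isIso_iff_isIso_app]
    intro x
    exact inferInstanceAs (IsIso (eqToHom (hr x)))
  have hα := (D.isIso_coind_iff α (𝟙 ((D.restr f).obj X))).mpr inferInstance
  refine (hD.isCartesian_iff _).mpr ((IsCouniv.iso_iff
    (D.coind α (𝟙 ((D.restr f).obj X)))).mp (hD.isCouniv_of_coslice lowerIncl.{u} _ fun s => ?_))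
  by_cases hs : s.down = (0, 0)
  · obtain rfl : s = Square.first := ULift.ext _ _ hs
    rw [← D.isCouniv_coind_whiskerLeft_iff lowerCoslice.{u}.asEquivalence.toAdjunction,
      ← D.isCouniv_copasteSq_iff]
    have h₁ := (D.isCouniv_coind_whiskerLeft_iff (Adjunction.ofIsLeftAdjoint r)
      (cosliceTrans f (i.obj Square.first)) _).mpr (hD.coslice f (i.obj Square.first) h)
    refine (iff_of_eq (congrArg (fun t => IsCouniv (D.restr (Functor.star.{u} LowerCorner.{u}))
      (D.coind (q := r ⋙ StructuredArrow.proj (i.obj Square.first) f) (p := Functor.star.{u} _)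
      (g := f) (f := Functor.fromPUnit (i.obj Square.first)) t (𝟙 ((D.restr f).obj X)))) ?_)).mp h₁
    ext x
    exact Subsingleton.elim _ _
  · exact isCouniv_coslice_of_isIso lowerIncl.{u} (⟨s, hs⟩ : LowerCorner.{u}) _

/-- A morphism of cocartesian squares is invertible at the terminal vertex if it is invertible at
the other vertices. -/
theorem IsDerivator.isIso_last (i : Square.{u} ⥤ L) {X Y : D.Diag L} (f : X ⟶ Y)
    (hX : IsCocartesian ((D.restr i).obj X)) (hY : IsCocartesian ((D.restr i).obj Y))
    (h : ∀ x : UpperCorner.{u}, IsIso ((D.eval (i.obj x.1)).map f)) :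
    IsIso ((D.eval (i.obj Square.last)).map f) := by
  rw [hD.isCocartesian_iff] at hX hY
  have : IsIso ((D.restr upperIncl.{u}).map ((D.restr i).map f)) :=
    hD.isIso_of_eval _ fun x => by
      rw [isIso_eval_restr_iff, isIso_eval_restr_iff]
      exact h x
  have := hX.isIso_of_isIso_map hY ((D.restr i).map f)
  rw [← isIso_eval_restr_iff]
  infer_instance

theorem IsDerivator.isIso_first (i : Square.{u} ⥤ L) {X Y : D.Diag L} (f : X ⟶ Y)
    (hX : IsCartesian ((D.restr i).obj X)) (hY : IsCartesian ((D.restr i).obj Y))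
    (h : ∀ x : LowerCorner.{u}, IsIso ((D.eval (i.obj x.1)).map f)) :
    IsIso ((D.eval (i.obj Square.first)).map f) := by
  rw [hD.isCartesian_iff] at hX hY
  have : IsIso ((D.restr lowerIncl.{u}).map ((D.restr i).map f)) :=
    hD.isIso_of_eval _ fun x => by
      rw [isIso_eval_restr_iff, isIso_eval_restr_iff]
      exact h x
  have := hX.isIso_of_isIso_map hY ((D.restr i).map f)
  rw [← isIso_eval_restr_iff]
  infer_instance

end Prederivator


/-! ### Functors restricting to equivalences of full subcategories. -/

section

universe v₁ v₂ v₃ u₁ u₂ u₃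

variable {𝒞 : Type u₁} [Category.{v₁} 𝒞] {𝒟 : Type u₂} [Category.{v₂} 𝒟] {ℰ : Type u₃}
  [Category.{v₃} ℰ]

/-- `R` restricts to an equivalence between the full subcategories `P` and `Q`. -/
structure RestrictsToEquiv (R : 𝒞 ⥤ 𝒟) (P : 𝒞 → Prop) (Q : 𝒟 → Prop) : Prop where
  map : ∀ X, P X → Q (R.obj X)
  bijective : ∀ X Y, P X → P Y → Function.Bijective fun g : X ⟶ Y => R.map g
  surj : ∀ Y, Q Y → ∃ X, P X ∧ Nonempty (R.obj X ≅ Y)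

theorem RestrictsToEquiv.comp {R : 𝒞 ⥤ 𝒟} {S : 𝒟 ⥤ ℰ} {P : 𝒞 → Prop} {Q : 𝒟 → Prop}
    {Q' : ℰ → Prop} (h : RestrictsToEquiv R P Q) (h' : RestrictsToEquiv S Q Q') :
    RestrictsToEquiv (R ⋙ S) P Q' where
  map X hX := h'.map _ (h.map X hX)
  bijective X Y hX hY := (h'.bijective _ _ (h.map X hX) (h.map Y hY)).comp (h.bijective X Y hX hY)
  surj Z hZ := by
    obtain ⟨Y, hY, ⟨e⟩⟩ := h'.surj Z hZ
    obtain ⟨X, hX, ⟨e'⟩⟩ := h.surj Y hY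
    exact ⟨X, hX, ⟨S.mapIso e' ≪≫ e⟩⟩

theorem RestrictsToEquiv.of_natIso {R R' : 𝒞 ⥤ 𝒟} {P : 𝒞 → Prop} {Q : 𝒟 → Prop}
    (h : RestrictsToEquiv R P Q) (i : R ≅ R') (hQ : ∀ Y Y', (Y ≅ Y') → Q Y → Q Y') :
    RestrictsToEquiv R' P Q where
  map X hX := hQ _ _ (i.app X) (h.map X hX)
  bijective X Y hX hY := by
    convert ((i.app X).homCongr (i.app Y)).bijective.comp (h.bijective X Y hX hY) using 1
    funext g
    simp [Iso.homCongr]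
  surj Z hZ := by
    obtain ⟨X, hX, ⟨e⟩⟩ := h.surj Z hZ
    exact ⟨X, hX, ⟨(i.app X).symm ≪≫ e⟩⟩

theorem RestrictsToEquiv.of_isEquivalence (R : 𝒞 ⥤ 𝒟) [R.IsEquivalence] {P : 𝒞 → Prop}
    {Q : 𝒟 → Prop} (h : ∀ X, P X ↔ Q (R.obj X)) (hQ : ∀ Y Y', (Y ≅ Y') → Q Y → Q Y') :
    RestrictsToEquiv R P Q where
  map X hX := (h X).mp hX
  bijective X Y _ _ := (Functor.FullyFaithful.ofFullyFaithful R).map_bijective X Y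
  surj Y hY := ⟨R.objPreimage Y, (h _).mpr (hQ _ _ (R.objObjPreimageIso Y).symm hY),
    ⟨R.objObjPreimageIso Y⟩⟩

/-- A functor between thin categories is a right adjoint if for every `y` there is a smallest `j`
with `y ⟶ r j`. -/
theorem isRightAdjoint_of_isThin {𝒟' : Type u₂} [Category.{v₁} 𝒟'] [Quiver.IsThin 𝒞]
    [Quiver.IsThin 𝒟'] (r : 𝒞 ⥤ 𝒟') (h : ∀ y, ∃ j, Nonempty (y ⟶ r.obj j) ∧
      ∀ j', Nonempty (y ⟶ r.obj j') → Nonempty (j ⟶ j')) : r.IsRightAdjoint := by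
  have : ∀ y, Limits.HasInitial (StructuredArrow y r) := fun y => by
    obtain ⟨j, ⟨g⟩, hj⟩ := h y
    refine Limits.IsInitial.hasInitial (X := StructuredArrow.mk g)
      (Limits.IsInitial.ofUniqueHom (fun z => StructuredArrow.homMk (hj z.right ⟨z.hom⟩).some
        (Subsingleton.elim _ _)) fun z m => StructuredArrow.hom_ext _ _ (Subsingleton.elim _ _))
  exact isRightAdjointOfStructuredArrowInitials r

theorem isLeftAdjoint_of_isThin {𝒟' : Type u₂} [Category.{v₁} 𝒟'] [Quiver.IsThin 𝒞]
    [Quiver.IsThin 𝒟'] (r : 𝒞 ⥤ 𝒟') (h : ∀ y, ∃ j, Nonempty (r.obj j ⟶ y) ∧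
      ∀ j', Nonempty (r.obj j' ⟶ y) → Nonempty (j' ⟶ j)) : r.IsLeftAdjoint := by
  have : ∀ y, Limits.HasTerminal (CostructuredArrow r y) := fun y => by
    obtain ⟨j, ⟨g⟩, hj⟩ := h y
    refine Limits.IsTerminal.hasTerminal (X := CostructuredArrow.mk g)
      (Limits.IsTerminal.ofUniqueHom (fun z => CostructuredArrow.homMk (hj z.left ⟨z.hom⟩).some
        (Subsingleton.elim _ _)) fun z m => CostructuredArrow.hom_ext _ _ (Subsingleton.elim _ _))
  exact isLeftAdjoint_of_costructuredArrowTerminals r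

end

namespace Prederivator

variable {D : Prederivator.{u, v, w}} (hD : D.IsDerivator)
include hD

/-- By `h₂` the left Kan extensions of objects of `Q` lie in `P`. For `X` in `P` the comparison from
the extension of its restriction to `X` restricts to an isomorphism, so `h₃` makes it invertible.
Hence `P` consists of the Kan extensions of objects of `Q`, and maps out of them are computed after
restriction. -/
theorem IsDerivator.restrictsToEquiv_of_isUniv {K L : Type u} [Category.{u} K] [Category.{u} L]
    (f : K ⥤ L) [f.Full] [f.Faithful] {P : D.Diag L → Prop} {Q : D.Diag K → Prop}
    (hQ : ∀ Y Y', (Y ≅ Y') → Q Y → Q Y') (h₁ : ∀ X, P X → Q ((D.restr f).obj X))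
    (h₂ : ∀ X, IsUniv (D.restr f) (𝟙 ((D.restr f).obj X)) → Q ((D.restr f).obj X) → P X)
    (h₃ : ∀ X Y (g : X ⟶ Y), P X → P Y → IsIso ((D.restr f).map g) → IsIso g) :
    RestrictsToEquiv (D.restr f) P Q where
  map := h₁
  bijective X Y hX _ := by
    obtain ⟨L, η, hη⟩ := hD.exists_lan f ((D.restr f).obj X)
    have := hD.isIso_of_isUniv f hη
    have hL := h₂ L ((IsUniv.iso_iff η).mp hη) (hQ _ _ (asIso η) (h₁ X hX))
    obtain ⟨g, hg⟩ := hη.exists_fac (𝟙 ((D.restr f).obj X))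
    have : IsIso ((D.restr f).map g) := by
      have h : IsIso (η ≫ (D.restr f).map g) := by rw [hg]; infer_instance
      exact IsIso.of_isIso_comp_left η _
    have := h₃ L X g hL hX this
    have h := hη.comp_iso g Y
    rw [hg] at h
    simpa using h
  surj Y hY := by
    obtain ⟨L, η, hη⟩ := hD.exists_lan f Y
    have := hD.isIso_of_isUniv f hη
    exact ⟨L, h₂ L ((IsUniv.iso_iff η).mp hη) (hQ _ _ (asIso η) hY), ⟨(asIso η).symm⟩⟩

theorem IsDerivator.restrictsToEquiv_of_isCouniv {K L : Type u} [Category.{u} K] [Category.{u} L]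
    (f : K ⥤ L) [f.Full] [f.Faithful] {P : D.Diag L → Prop} {Q : D.Diag K → Prop}
    (hQ : ∀ Y Y', (Y ≅ Y') → Q Y → Q Y') (h₁ : ∀ X, P X → Q ((D.restr f).obj X))
    (h₂ : ∀ X, IsCouniv (D.restr f) (𝟙 ((D.restr f).obj X)) → Q ((D.restr f).obj X) → P X)
    (h₃ : ∀ X Y (g : X ⟶ Y), P X → P Y → IsIso ((D.restr f).map g) → IsIso g) :
    RestrictsToEquiv (D.restr f) P Q where
  map := h₁
  bijective X Y _ hY := by
    obtain ⟨L, c, hc⟩ := hD.exists_ran f ((D.restr f).obj Y)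
    have := hD.isIso_of_isCouniv f hc
    have hL := h₂ L ((IsCouniv.iso_iff c).mp hc) (hQ _ _ (asIso c).symm (h₁ Y hY))
    obtain ⟨g, hg⟩ := hc.exists_fac (𝟙 ((D.restr f).obj Y))
    have : IsIso ((D.restr f).map g) := by
      have h : IsIso ((D.restr f).map g ≫ c) := by rw [hg]; infer_instance
      exact IsIso.of_isIso_comp_right _ c
    have := h₃ Y L g hY hL this
    have h := hc.iso_comp g X
    rw [hg] at h
    simpa using h
  surj Y hY := by
    obtain ⟨L, c, hc⟩ := hD.exists_ran f Y
    have := hD.isIso_of_isCouniv f hc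
    exact ⟨L, h₂ L ((IsCouniv.iso_iff c).mp hc) (hQ _ _ (asIso c).symm hY), ⟨asIso c⟩⟩

end Prederivator


/-! ### Exact diagrams on subposets of the plane and their extension. -/

/-- The poset of the points of the plane satisfying `P`. -/
abbrev Shape (P : ℤ → ℤ → Prop) : Type u := ULift.{u} {p : ℤ × ℤ // P p.1 p.2}

namespace Shape

variable {P P' P'' : ℤ → ℤ → Prop}

abbrev pt (x y : ℤ) (h : P x y) : Shape.{u} P := ⟨⟨(x, y), h⟩⟩

noncomputable def incl (h : ∀ x y, P x y → P' x y) : Shape.{u} P ⥤ Shape.{u} P' :=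
  Monotone.functor (f := fun p => ⟨⟨p.down.1, h _ _ p.down.2⟩⟩) fun _ _ hpq => hpq

instance (h : ∀ x y, P x y → P' x y) : (incl.{u} h).Full where
  map_surjective g := ⟨homOfLE (leOfHom g), Subsingleton.elim _ _⟩

instance (h : ∀ x y, P x y → P' x y) : (incl.{u} h).Faithful where
  map_injective _ := Subsingleton.elim _ _

theorem corner_mem {x y : ℤ} (h₀₀ : P x y) (h₁₀ : P x (y + 1)) (h₀₁ : P (x + 1) y)
    (h₁₁ : P (x + 1) (y + 1)) (a b : Fin 2) : P (x + (b : ℕ)) (y + (a : ℕ)) := by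
  fin_cases a <;> fin_cases b <;> simpa

/-- The vertices of the unit square with lower left vertex `(x, y)` satisfy `P`. -/
def HasSquare (P : ℤ → ℤ → Prop) (x y : ℤ) : Prop :=
  P x y ∧ P x (y + 1) ∧ P (x + 1) y ∧ P (x + 1) (y + 1)

theorem HasSquare.mem {x y : ℤ} (h : HasSquare P x y) (a b : Fin 2) :
    P (x + (b : ℕ)) (y + (a : ℕ)) :=
  corner_mem h.1 h.2.1 h.2.2.1 h.2.2.2 a b

/-- A unit square. -/
noncomputable def square {x y : ℤ} (h : HasSquare P x y) : Square.{u} ⥤ Shape.{u} P :=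
  -- The first coordinate of the square moves `y` and the second moves `x`, in agreement with
  -- `Mesh.square`.
  Monotone.functor (f := fun s => pt (x + (s.down.2 : ℕ)) (y + (s.down.1 : ℕ)) (h.mem _ _))
    fun _ _ hst => ⟨by have := hst.2; simpa using this, by have := hst.1; simpa using this⟩

end Shape

namespace Prederivator

open Shape

variable {D : Prederivator.{u, v, w}} {P P' : ℤ → ℤ → Prop}

/-- The points `(x, y)` of the strip `x ≤ y ≤ x + n + 1` which are not on the boundary. -/
def Interior (n : ℕ) (x y : ℤ) : Prop := x + 1 ≤ y ∧ y ≤ x + n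

/-- The boundary points of the strip `x ≤ y ≤ x + n + 1`. -/
def Boundary (n : ℕ) (x y : ℤ) : Prop := y = x ∨ y = x + n + 1

/-- The vanishing and exactness conditions for the diagrams on a subset of the strip
`x ≤ y ≤ x + n + 1`. -/
structure IsExactOn (n : ℕ) (X : D.Diag (Shape.{u} P)) : Prop where
  zero : ∀ x y (h : P x y), Boundary n x y → Limits.IsZero ((D.eval (pt x y h)).obj X)
  -- Here `(x, y)` is the initial vertex. Cartesianness is not demanded, as it follows in a stable
  -- derivator.
  cocartesian : ∀ x y (h : HasSquare P x y), Interior n x y →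
    IsCocartesian ((D.restr (Shape.square h)).obj X)

variable {n : ℕ}

theorem IsExactOn.of_iso {X Y : D.Diag (Shape.{u} P)} (h : IsExactOn n X) (i : X ≅ Y) :
    IsExactOn n Y where
  zero x y hp hb := (h.zero x y hp hb).of_iso ((D.eval _).mapIso i.symm)
  cocartesian x y hs hi := (h.cocartesian x y hs hi).of_iso ((D.restr _).mapIso i)

theorem isCocartesian_square_iff (h : ∀ x y, P x y → P' x y) {x y : ℤ} (hs : HasSquare P x y)
    (hs' : HasSquare P' x y) (X : D.Diag (Shape.{u} P')) :
    IsCocartesian ((D.restr (Shape.square hs)).obj ((D.restr (incl h)).obj X)) ↔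
      IsCocartesian ((D.restr (Shape.square hs')).obj X) :=
  ⟨fun H => H.of_iso ((D.restrComp (Shape.square hs) (incl h)).symm.app X),
    fun H => H.of_iso ((D.restrComp (Shape.square hs) (incl h)).app X)⟩

theorem IsExactOn.restr {X : D.Diag (Shape.{u} P')} (hX : IsExactOn n X)
    (h : ∀ x y, P x y → P' x y) : IsExactOn n ((D.restr (incl h)).obj X) where
  zero x y hp hb := (D.isZero_eval_restr_iff (incl h) (pt x y hp) X).mpr
    (hX.zero x y (h x y hp) hb)
  cocartesian x y hs hi := (isCocartesian_square_iff h hs ⟨h _ _ hs.1, h _ _ hs.2.1,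
    h _ _ hs.2.2.1, h _ _ hs.2.2.2⟩ X).mpr (hX.cocartesian x y _ hi)

theorem isIso_of_isZero {𝒞 : Type*} [Category 𝒞] {X Y : 𝒞} (hX : Limits.IsZero X)
    (hY : Limits.IsZero Y) (f : X ⟶ Y) : IsIso f :=
  ⟨hY.to_ X, hX.eq_of_src _ _, hY.eq_of_src _ _⟩

/-- The inclusion of the complement of the terminal vertex of a square. -/
def removeLast (P : ℤ → ℤ → Prop) (x y : ℤ) : ℤ → ℤ → Prop :=
  fun a b => P a b ∧ (a, b) ≠ (x + 1, y + 1)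

def removeFirst (P : ℤ → ℤ → Prop) (x y : ℤ) : ℤ → ℤ → Prop :=
  fun a b => P a b ∧ (a, b) ≠ (x, y)

theorem corner_ne_last {x y : ℤ} (s : UpperCorner.{u}) :
    (x + ((s.1.down.2 : ℕ) : ℤ), y + ((s.1.down.1 : ℕ) : ℤ)) ≠ (x + 1, y + 1) := by
  obtain ⟨⟨a, b⟩, hs⟩ := s
  intro h
  refine hs (_root_.Prod.ext (Fin.ext ?_) (Fin.ext ?_))
  · have := congrArg _root_.Prod.snd h
    simpa using this
  · have := congrArg _root_.Prod.fst h
    simpa using this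

theorem corner_ne_first {x y : ℤ} (s : LowerCorner.{u}) :
    (x + ((s.1.down.2 : ℕ) : ℤ), y + ((s.1.down.1 : ℕ) : ℤ)) ≠ (x, y) := by
  obtain ⟨⟨a, b⟩, hs⟩ := s
  intro h
  refine hs (_root_.Prod.ext (Fin.ext ?_) (Fin.ext ?_))
  · have := congrArg _root_.Prod.snd h
    simpa using this
  · have := congrArg _root_.Prod.fst h
    simpa using this

noncomputable def cornerToSlice {x y : ℤ} (h : HasSquare P x y) : UpperCorner.{u} ⥤
    CostructuredArrow (incl.{u} (P := removeLast P x y) (P' := P) fun _ _ h => h.1)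
      ((Shape.square.{u} h).obj Square.last) where
  obj s := CostructuredArrow.mk (Y := pt _ _ ⟨h.mem s.1.down.1 s.1.down.2, corner_ne_last s⟩)
    ((Shape.square.{u} h).map (homOfLE (show s.1.down ≤ ((1, 1) : Fin 2 × Fin 2) from
      ⟨Fin.le_last _, Fin.le_last _⟩)))
  map {s t} g := CostructuredArrow.homMk
    (homOfLE (leOfHom ((Shape.square.{u} h).map (upperIncl.{u}.map g)))) (Subsingleton.elim _ _)

noncomputable def cornerToCoslice {x y : ℤ} (h : HasSquare P x y) : LowerCorner.{u} ⥤
    StructuredArrow ((Shape.square.{u} h).obj Square.first)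
      (incl.{u} (P := removeFirst P x y) (P' := P) fun _ _ h => h.1) where
  obj s := StructuredArrow.mk (Y := pt _ _ ⟨h.mem s.1.down.1 s.1.down.2, corner_ne_first s⟩)
    ((Shape.square.{u} h).map (homOfLE (show ((0, 0) : Fin 2 × Fin 2) ≤ s.1.down from
      ⟨Fin.zero_le _, Fin.zero_le _⟩)))
  map {s t} g := StructuredArrow.homMk
    (homOfLE (leOfHom ((Shape.square.{u} h).map (lowerIncl.{u}.map g)))) (Subsingleton.elim _ _)

instance {A C : Type u} [Category.{u} A] [Category.{u} C] [Quiver.IsThin A] (f : A ⥤ C) (c : C) :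
    Quiver.IsThin (CostructuredArrow f c) :=
  fun _ _ => ⟨fun _ _ => CostructuredArrow.hom_ext _ _ (Subsingleton.elim _ _)⟩

instance {A C : Type u} [Category.{u} A] [Category.{u} C] [Quiver.IsThin A] (f : A ⥤ C) (c : C) :
    Quiver.IsThin (StructuredArrow c f) :=
  fun _ _ => ⟨fun _ _ => StructuredArrow.hom_ext _ _ (Subsingleton.elim _ _)⟩

/-- A point below the terminal vertex and different from it has a least corner vertex above it,
obtained by raising each coordinate to the least admissible value of the square. This is the
adjointness needed by `isCocartesian_of_isUniv`. -/
instance {x y : ℤ} (h : HasSquare P x y) : (cornerToSlice.{u} h).IsRightAdjoint :=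
  isRightAdjoint_of_isThin _ fun t => by
    obtain ⟨⟨⟨⟨a, b⟩, hp, hne⟩⟩, _, g⟩ := t
    have hle : a ≤ x + 1 ∧ b ≤ y + 1 := by
      have := leOfHom g
      have h₁ : a ≤ x + ((1 : Fin 2) : ℕ) := this.1
      have h₂ : b ≤ y + ((1 : Fin 2) : ℕ) := this.2
      simpa using And.intro h₁ h₂
    have key : ∀ s : UpperCorner.{u}, Nonempty (CostructuredArrow.mk g ⟶
        (cornerToSlice.{u} h).obj s) ↔
          a ≤ x + ((s.1.down.2 : ℕ) : ℤ) ∧ b ≤ y + ((s.1.down.1 : ℕ) : ℤ) := fun s =>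
      ⟨fun ⟨k⟩ => leOfHom k.left, fun hs => ⟨CostructuredArrow.homMk (homOfLE hs)
        (Subsingleton.elim _ _)⟩⟩
    have h₀ : (((0 : Fin 2) : ℕ) : ℤ) = 0 := rfl
    have h₁ : (((1 : Fin 2) : ℕ) : ℤ) = 1 := rfl
    have hne' : ¬ (a = x + 1 ∧ b = y + 1) := fun hab => hne (_root_.Prod.ext hab.1 hab.2)
    have le_one : ∀ (i : Fin 2), 1 ≤ ((i : ℕ) : ℤ) → (1 : Fin 2) ≤ i := fun i hi => by
      rw [Fin.le_def]
      exact_mod_cast hi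
    by_cases hb : b ≤ y
    · by_cases ha : a ≤ x
      · exact ⟨⟨⟨(0, 0)⟩, by decide⟩, (key _).mpr (by dsimp only; omega), fun s _ =>
          ⟨homOfLE (show ((0, 0) : Fin 2 × Fin 2) ≤ s.1.down from
            ⟨Fin.zero_le _, Fin.zero_le _⟩)⟩⟩
      · exact ⟨⟨⟨(0, 1)⟩, by decide⟩, (key _).mpr (by dsimp only; omega), fun s hs =>
          ⟨homOfLE (show ((0, 1) : Fin 2 × Fin 2) ≤ s.1.down from
            ⟨Fin.zero_le _, le_one _ (by have := (key s).mp hs; omega)⟩)⟩⟩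
    · exact ⟨⟨⟨(1, 0)⟩, by decide⟩, (key _).mpr (by dsimp only; omega), fun s hs =>
        ⟨homOfLE (show ((1, 0) : Fin 2 × Fin 2) ≤ s.1.down from
          ⟨le_one _ (by have := (key s).mp hs; omega), Fin.zero_le _⟩)⟩⟩

instance {x y : ℤ} (h : HasSquare P x y) : (cornerToCoslice.{u} h).IsLeftAdjoint :=
  isLeftAdjoint_of_isThin _ fun t => by
    obtain ⟨_, ⟨⟨⟨a, b⟩, hp, hne⟩⟩, g⟩ := t
    have hle : x ≤ a ∧ y ≤ b := by
      have := leOfHom g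
      have h₁ : x + ((0 : Fin 2) : ℕ) ≤ a := this.1
      have h₂ : y + ((0 : Fin 2) : ℕ) ≤ b := this.2
      simpa using And.intro h₁ h₂
    have key : ∀ s : LowerCorner.{u}, Nonempty ((cornerToCoslice.{u} h).obj s ⟶
        StructuredArrow.mk g) ↔
          x + ((s.1.down.2 : ℕ) : ℤ) ≤ a ∧ y + ((s.1.down.1 : ℕ) : ℤ) ≤ b := fun s =>
      ⟨fun ⟨k⟩ => leOfHom k.right, fun hs => ⟨StructuredArrow.homMk (homOfLE hs)
        (Subsingleton.elim _ _)⟩⟩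
    have h₀ : (((0 : Fin 2) : ℕ) : ℤ) = 0 := rfl
    have h₁ : (((1 : Fin 2) : ℕ) : ℤ) = 1 := rfl
    have hne' : ¬ (a = x ∧ b = y) := fun hab => hne (_root_.Prod.ext hab.1 hab.2)
    have le_zero : ∀ (i : Fin 2), ((i : ℕ) : ℤ) ≤ 0 → i ≤ 0 := fun i hi => by
      rw [Fin.le_def]
      exact_mod_cast hi
    by_cases hb : y + 1 ≤ b
    · by_cases ha : x + 1 ≤ a
      · exact ⟨⟨⟨(1, 1)⟩, by decide⟩, (key _).mpr (by dsimp only; omega), fun s _ =>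
          ⟨homOfLE (show s.1.down ≤ ((1, 1) : Fin 2 × Fin 2) from
            ⟨Fin.le_last _, Fin.le_last _⟩)⟩⟩
      · exact ⟨⟨⟨(1, 0)⟩, by decide⟩, (key _).mpr (by dsimp only; omega), fun s hs =>
          ⟨homOfLE (show s.1.down ≤ ((1, 0) : Fin 2 × Fin 2) from
            ⟨Fin.le_last _, le_zero _ (by have := (key s).mp hs; omega)⟩)⟩⟩
    · exact ⟨⟨⟨(0, 1)⟩, by decide⟩, (key _).mpr (by dsimp only; omega), fun s hs =>
        ⟨homOfLE (show s.1.down ≤ ((0, 1) : Fin 2 × Fin 2) from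
          ⟨le_zero _ (by have := (key s).mp hs; omega), Fin.le_last _⟩)⟩⟩

/-- As `(x + 1, y + 1)` is not in `P`, the diagram is also extended from the complement of this
single vertex in `P'` (`isUniv_of_comp`). There the detection criterion applies. -/
theorem IsDerivator.isCocartesian_square (hD : D.IsDerivator) (h : ∀ x y, P x y → P' x y) {x y : ℤ}
    (hs : HasSquare P' x y) (hP : ¬ P (x + 1) (y + 1)) {X : D.Diag (Shape.{u} P')}
    (hX : IsUniv (D.restr (incl.{u} h)) (𝟙 ((D.restr (incl.{u} h)).obj X))) :
    IsCocartesian ((D.restr (Shape.square hs)).obj X) := by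
  have h' : ∀ a b, P a b → removeLast P' x y a b := fun a b hab => ⟨h a b hab, fun e => by
    obtain ⟨rfl, rfl⟩ := _root_.Prod.ext_iff.mp e
    exact hP hab⟩
  exact hD.isCocartesian_of_isUniv (incl.{u} (P := removeLast P' x y) (P' := P') fun _ _ h => h.1)
    (Shape.square hs) (cornerToSlice hs) (fun _ => rfl) (hD.isUniv_of_comp (incl.{u} h') _ hX)

theorem IsDerivator.isCartesian_square (hD : D.IsDerivator) (h : ∀ x y, P x y → P' x y) {x y : ℤ}
    (hs : HasSquare P' x y) (hP : ¬ P x y) {X : D.Diag (Shape.{u} P')}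
    (hX : IsCouniv (D.restr (incl.{u} h)) (𝟙 ((D.restr (incl.{u} h)).obj X))) :
    IsCartesian ((D.restr (Shape.square hs)).obj X) := by
  have h' : ∀ a b, P a b → removeFirst P' x y a b := fun a b hab => ⟨h a b hab, fun e => by
    obtain ⟨rfl, rfl⟩ := _root_.Prod.ext_iff.mp e
    exact hP hab⟩
  refine hD.isCartesian_of_isCouniv (incl.{u} (P := removeFirst P' x y) (P' := P') fun _ _ h => h.1)
    (Shape.square hs) (cornerToCoslice hs) (fun s => ?_) (hD.isCouniv_of_comp (incl.{u} h') _ hX)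
  rfl

theorem IsStableDerivator.isZero_of_isInitial (hD : D.IsStableDerivator) {X : D.Diag Pt.{u}}
    (h : Nonempty (Limits.IsInitial X)) : Limits.IsZero X := by
  obtain ⟨Z, hZ⟩ := hD.pointed
  exact hZ.of_iso (h.some.uniqueUpToIso hZ.isInitial)

theorem IsStableDerivator.isZero_of_isTerminal (hD : D.IsStableDerivator) {X : D.Diag Pt.{u}}
    (h : Nonempty (Limits.IsTerminal X)) : Limits.IsZero X := by
  obtain ⟨Z, hZ⟩ := hD.pointed
  exact hZ.of_iso (h.some.uniqueUpToIso hZ.isTerminal)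

/-- Extension of exact diagrams by left Kan extension. -/
theorem IsStableDerivator.restrictsToEquiv_lan (hD : D.IsStableDerivator)
    (h : ∀ x y, P x y → P' x y)
    (hbd : ∀ x y, P' x y → ¬ P x y → Boundary n x y → ∀ a b, P a b → ¬ (a ≤ x ∧ b ≤ y))
    (hsq : ∀ x y, HasSquare P' x y → Interior n x y → P (x + 1) (y + 1) → HasSquare P x y)
    (c : ℤ) (hstep : ∀ x y, P' (x + 1) (y + 1) → ¬ P (x + 1) (y + 1) →
      ¬ Boundary n (x + 1) (y + 1) → HasSquare P' x y ∧ Interior n x y ∧ c ≤ x + y) :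
    RestrictsToEquiv (D.restr (incl.{u} h)) (IsExactOn n) (IsExactOn n) := by
  refine hD.toIsDerivator.restrictsToEquiv_of_isUniv (incl.{u} h) (fun _ _ i hY => hY.of_iso i)
    (fun X hX => hX.restr h) (fun X hX hPX => ⟨fun x y hp hb => ?_, fun x y hs hi => ?_⟩)
    fun X Y g hX hY hg => hD.toIsDerivator.isIso_of_eval g fun ⟨⟨⟨x, y⟩, hp⟩⟩ => ?_
  · by_cases hP : P x y
    · exact (D.isZero_eval_restr_iff (incl h) (pt x y hP) X).mp (hPX.zero x y hP hb)
    -- A new boundary point has no old point below it by `hbd`, so the Kan extension has there an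
    -- empty colimit, which is zero.
    · have : IsEmpty (CostructuredArrow (incl.{u} h) (pt x y hp)) :=
        ⟨fun t => hbd x y hp hP hb _ _ t.left.down.2 (leOfHom t.hom)⟩
      exact hD.isZero_of_isInitial (hD.toIsDerivator.isInitial_eval (incl.{u} h) (pt x y hp) hX)
  · by_cases hP : P (x + 1) (y + 1)
    · exact (isCocartesian_square_iff h (hsq x y hs hi hP) hs X).mp (hPX.cocartesian x y _ hi)
    · exact hD.toIsDerivator.isCocartesian_square h hs hP hX
  -- Conservativity by induction on `x + y - c`: an interior new point is the terminal vertex of a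
  -- cocartesian square whose other vertices have smaller coordinate sum. The bound `c` on the
  -- initial vertex keeps the truncated difference strictly decreasing.
  · have key : ∀ (N : ℕ) (x y : ℤ) (hp : P' x y), (x + y - c).toNat < N →
        IsIso ((D.eval (pt x y hp)).map g) := by
      intro N
      induction N with
      | zero => exact fun _ _ _ hN => absurd hN (Nat.not_lt_zero _)
      | succ N ih =>
        intro x y hp hN
        by_cases hP : P x y
        · exact (D.isIso_eval_restr_iff (incl h) (pt x y hP) g).mp inferInstance
        by_cases hb : Boundary n x y
        · exact isIso_of_isZero (hX.zero x y hp hb) (hY.zero x y hp hb) _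
        obtain ⟨x, rfl⟩ : ∃ x', x = x' + 1 := ⟨x - 1, by ring⟩
        obtain ⟨y, rfl⟩ : ∃ y', y = y' + 1 := ⟨y - 1, by ring⟩
        obtain ⟨hs, hi, hc⟩ := hstep x y hp hP hb
        refine hD.toIsDerivator.isIso_last (Shape.square hs) g (hX.cocartesian x y hs hi)
          (hY.cocartesian x y hs hi) fun s => ih _ _ (hs.mem s.1.down.1 s.1.down.2) ?_
        have h₁ := corner_ne_last (x := x) (y := y) s
        have h₂ := s.1.down.1.isLt
        have h₃ := s.1.down.2.isLt
        rw [Ne, _root_.Prod.ext_iff] at h₁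
        dsimp only at h₁
        omega
    exact key _ x y hp (Nat.lt_succ_self _)

/-- Extension of exact diagrams by right Kan extension. -/
theorem IsStableDerivator.restrictsToEquiv_ran (hD : D.IsStableDerivator)
    (h : ∀ x y, P x y → P' x y)
    (hbd : ∀ x y, P' x y → ¬ P x y → Boundary n x y → ∀ a b, P a b → ¬ (x ≤ a ∧ y ≤ b))
    (hsq : ∀ x y, HasSquare P' x y → Interior n x y → P x y → HasSquare P x y)
    (c : ℤ) (hstep : ∀ x y, P' x y → ¬ P x y → ¬ Boundary n x y →
      HasSquare P' x y ∧ Interior n x y ∧ x + y < c) :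
    RestrictsToEquiv (D.restr (incl.{u} h)) (IsExactOn n) (IsExactOn n) := by
  refine hD.toIsDerivator.restrictsToEquiv_of_isCouniv (incl.{u} h) (fun _ _ i hY => hY.of_iso i)
    (fun X hX => hX.restr h) (fun X hX hPX => ⟨fun x y hp hb => ?_, fun x y hs hi => ?_⟩)
    fun X Y g hX hY hg => hD.toIsDerivator.isIso_of_eval g fun ⟨⟨⟨x, y⟩, hp⟩⟩ => ?_
  · by_cases hP : P x y
    · exact (D.isZero_eval_restr_iff (incl h) (pt x y hP) X).mp (hPX.zero x y hP hb)
    · have : IsEmpty (StructuredArrow (pt x y hp) (incl.{u} h)) :=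
        ⟨fun t => hbd x y hp hP hb _ _ t.right.down.2 (leOfHom t.hom)⟩
      exact hD.isZero_of_isTerminal (hD.toIsDerivator.isTerminal_eval (incl.{u} h) (pt x y hp) hX)
  · by_cases hP : P x y
    · exact (isCocartesian_square_iff h (hsq x y hs hi hP) hs X).mp (hPX.cocartesian x y _ hi)
    · exact (hD.cartesian_iff _).mp (hD.toIsDerivator.isCartesian_square h hs hP hX)
  -- The same induction in the opposite direction: a new interior point is the initial vertex of a
  -- cartesian square, and `c` bounds its coordinate sum from above.
  · have key : ∀ (N : ℕ) (x y : ℤ) (hp : P' x y), (c - (x + y)).toNat < N →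
        IsIso ((D.eval (pt x y hp)).map g) := by
      intro N
      induction N with
      | zero => exact fun _ _ _ hN => absurd hN (Nat.not_lt_zero _)
      | succ N ih =>
        intro x y hp hN
        by_cases hP : P x y
        · exact (D.isIso_eval_restr_iff (incl h) (pt x y hP) g).mp inferInstance
        by_cases hb : Boundary n x y
        · exact isIso_of_isZero (hX.zero x y hp hb) (hY.zero x y hp hb) _
        obtain ⟨hs, hi, hc⟩ := hstep x y hp hP hb
        have := hD.toIsDerivator.isIso_first (Shape.square hs) g
          ((hD.cartesian_iff _).mpr (hX.cocartesian x y hs hi))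
          ((hD.cartesian_iff _).mpr (hY.cocartesian x y hs hi)) fun s =>
            ih _ _ (hs.mem s.1.down.1 s.1.down.2) (by
              have h₁ := corner_ne_first (x := x) (y := y) s
              rw [Ne, _root_.Prod.ext_iff] at h₁
              dsimp only at h₁
              omega)
        have e : (Shape.square.{u} hs).obj Square.first = pt x y hp :=
          ULift.ext _ _ (Subtype.ext (_root_.Prod.ext (add_zero x) (add_zero y)))
        rwa [e] at this
    exact key _ x y hp (Nat.lt_succ_self _)

/-! ### Reconstruction of exact diagrams on the strip from a section. -/

/-- Sections of the strip, given by the first coordinates of their points at the levels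
`y - x`. -/
def IsSection (σ : ℤ → ℤ) : Prop := ∀ l, σ (l + 1) ≤ σ l ∧ σ l ≤ σ (l + 1) + 1

theorem IsSection.le {σ : ℤ → ℤ} (hσ : IsSection σ) {l m : ℤ} (h : l ≤ m) :
    σ m ≤ σ l ∧ σ l ≤ σ m + (m - l) := by
  obtain ⟨k, rfl⟩ := Int.le.dest h
  induction k with
  | zero => simp
  | succ k ih =>
    have h₁ := ih (by omega)
    have h₂ := hσ (l + k)
    rw [add_assoc] at h₂
    push_cast
    omega

def SectionShape (n : ℕ) (σ : ℤ → ℤ) (x y : ℤ) : Prop := Interior n x y ∧ x = σ (y - x)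

/-- The strip `x ≤ y ≤ x + n + 1`. -/
def StripShape (n : ℕ) (x y : ℤ) : Prop := x ≤ y ∧ y ≤ x + n + 1

theorem SectionShape.strip {n : ℕ} {σ : ℤ → ℤ} {x y : ℤ} (h : SectionShape n σ x y) :
    StripShape n x y := by
  obtain ⟨⟨h₁, h₂⟩, -⟩ := h
  constructor <;> omega

/-- Exact diagrams on the strip are determined by their restriction to a section. -/
theorem IsStableDerivator.restrictsToEquiv_section (hD : D.IsStableDerivator) {σ : ℤ → ℤ}
    (hσ : IsSection σ) {n : ℕ} (hn : 1 ≤ n) :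
    RestrictsToEquiv (D.restr (incl.{u} fun x y (h : SectionShape n σ x y) => h.strip))
      (IsExactOn n) fun _ => True := by
  -- `T` adds to the section exactly the boundary points which lie below none of its points. They
  -- have empty coslices, so right Kan extension puts zeros there.
  let T : ℤ → ℤ → Prop := fun x y => SectionShape n σ x y ∨ (y = x ∧ σ 1 + 1 ≤ x) ∨
    (y = x + n + 1 ∧ σ n ≤ x)
  -- `K` consists of the interior points on or after the section, together with the whole boundary.
  let K : ℤ → ℤ → Prop := fun x y => (Interior n x y ∧ σ (y - x) ≤ x) ∨ Boundary n x y
  have hST : ∀ x y, SectionShape n σ x y → T x y := fun x y h => Or.inl h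
  have hTK : ∀ x y, T x y → K x y := by
    rintro x y (⟨h, h'⟩ | h | h)
    · exact Or.inl ⟨h, h'.ge⟩
    · exact Or.inr (Or.inl h.1)
    · exact Or.inr (Or.inr h.1)
  have hKL : ∀ x y, K x y → StripShape n x y := by
    rintro x y (⟨⟨h, h'⟩, -⟩ | h | h) <;> constructor <;> omega
  have hA : RestrictsToEquiv (D.restr (incl.{u} hST)) (IsExactOn n) (IsExactOn n) := by
    -- No interior point is added, so the bound `0` plays no role.
    refine hD.restrictsToEquiv_ran hST ?_ ?_ 0 ?_
    · rintro x y (h | h) hS hb a b ⟨⟨h₁, h₂⟩, h₃⟩ ⟨h₄, h₅⟩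
      · exact hS h
      · have h₆ := hσ.le (l := 1) (m := b - a) (by omega)
        have h₇ := hσ.le (l := b - a) (m := n) (by omega)
        omega
    · rintro x y ⟨h₀, -, -, h₁⟩ hi -
      obtain ⟨hi₁, hi₂⟩ := hi
      have e : y + 1 - (x + 1) = y - x := by ring
      rcases h₀ with ⟨-, h₀⟩ | h₀ | h₀
      · rcases h₁ with ⟨-, h₁⟩ | h₁ | h₁
        · rw [e] at h₁
          omega
        all_goals omega
      all_goals omega
    · rintro x y (h | h | h) hS hb
      · exact absurd h hS
      · exact absurd (Or.inl h.1) hb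
      · exact absurd (Or.inr h.1) hb
  have hB : RestrictsToEquiv (D.restr (incl.{u} hTK)) (IsExactOn n) (IsExactOn n) := by
    -- On or after the section `σ n ≤ σ (y - x) ≤ x` and `x ≤ y`, which gives the lower bound `2 * σ
    -- n` for `x + y`.
    refine hD.restrictsToEquiv_lan hTK ?_ ?_ (2 * σ n) ?_
    · intro x y _ hT hb a b h ⟨h₄, h₅⟩
      have h₀ := hσ.le (l := 1) (m := n) (by omega)
      have hT₁ : ¬ (y = x ∧ σ 1 + 1 ≤ x) := fun h => hT (Or.inr (Or.inl h))
      have hT₂ : ¬ (y = x + n + 1 ∧ σ n ≤ x) := fun h => hT (Or.inr (Or.inr h))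
      rcases h with ⟨⟨h₁, h₂⟩, h₃⟩ | h | h
      · have h₆ := hσ.le (l := 1) (m := b - a) (by omega)
        have h₇ := hσ.le (l := b - a) (m := n) (by omega)
        rcases hb with hb | hb <;> omega
      · rcases hb with hb | hb <;> omega
      · rcases hb with hb | hb <;> omega
    · rintro x y ⟨h₀, -⟩ ⟨hi₁, hi₂⟩ h₁
      have e : y + 1 - (x + 1) = y - x := by ring
      rcases h₀ with ⟨-, h₀⟩ | h₀ | h₀
      · rcases h₁ with ⟨-, h₁⟩ | h₁ | h₁
        · rw [e] at h₁
          omega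
        all_goals omega
      all_goals omega
    · rintro x y (⟨⟨h₁, h₂⟩, h₃⟩ | h) hT hb
      · have e : y + 1 - (x + 1) = y - x := by ring
        -- The vertex `(x + 1, y + 1)` lies strictly after the section. So `(x, y)`, on the same
        -- level, is still on or after it, and the whole square is contained in `K`.
        have h₄ : ¬ x + 1 = σ (y - x) := fun h => hT (Or.inl ⟨⟨h₁, h₂⟩, by rwa [e]⟩)
        rw [e] at h₃
        have h₅ := hσ.le (l := y - x) (m := n) (by omega)
        have h₆ := hσ (y - x)
        have h₇ := hσ (y - (x + 1))
        have e' : y - (x + 1) + 1 = y - x := by ring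
        have e'' : y + 1 - x = y - x + 1 := by ring
        rw [e'] at h₇
        refine ⟨⟨Or.inl ⟨⟨by omega, by omega⟩, by omega⟩, ?_, ?_,
          Or.inl ⟨⟨h₁, h₂⟩, by rwa [e]⟩⟩, ⟨by omega, by omega⟩, by omega⟩
        · by_cases h : y = x + n
          · exact Or.inr (Or.inr (by omega))
          · exact Or.inl ⟨⟨by omega, by omega⟩, by rw [e'']; omega⟩
        · by_cases h : y = x + 1
          · exact Or.inr (Or.inl h)
          · exact Or.inl ⟨⟨by omega, by omega⟩, by omega⟩
      · exact absurd h hb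
  have hC : RestrictsToEquiv (D.restr (incl.{u} hKL)) (IsExactOn n) (IsExactOn n) := by
    -- An interior point before the section has `x < σ (y - x) ≤ σ 1` and `y ≤ x + n`, hence `x + y
    -- < 2 * σ 1 + n`.
    refine hD.restrictsToEquiv_ran hKL ?_ ?_ (2 * σ 1 + n) ?_
    · exact fun x y _ hK hb => absurd (Or.inr hb) hK
    · rintro x y - ⟨hi₁, hi₂⟩ (⟨-, h₀⟩ | h₀ | h₀)
      · have h₆ := hσ (y - x)
        have h₇ := hσ (y - (x + 1))
        have e : y + 1 - (x + 1) = y - x := by ring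
        have e' : y - (x + 1) + 1 = y - x := by ring
        have e'' : y + 1 - x = y - x + 1 := by ring
        rw [e'] at h₇
        refine ⟨Or.inl ⟨⟨hi₁, hi₂⟩, h₀⟩, ?_, ?_, Or.inl ⟨⟨by omega, by omega⟩, by rw [e]; omega⟩⟩
        · by_cases h : y = x + n
          · exact Or.inr (Or.inr (by omega))
          · exact Or.inl ⟨⟨by omega, by omega⟩, by rw [e'']; omega⟩
        · by_cases h : y = x + 1
          · exact Or.inr (Or.inl h)
          · exact Or.inl ⟨⟨by omega, by omega⟩, by omega⟩
      all_goals omega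
    · rintro x y ⟨hx, hy⟩ hK hb
      have h₁ : ¬ y = x := fun h => hb (Or.inl h)
      have h₂ : ¬ y = x + n + 1 := fun h => hb (Or.inr h)
      have h₃ : ¬ σ (y - x) ≤ x := fun h => hK (Or.inl ⟨⟨by omega, by omega⟩, h⟩)
      have h₄ := hσ.le (l := 1) (m := y - x) (by omega)
      refine ⟨⟨⟨?_, ?_⟩, ⟨?_, ?_⟩, ⟨?_, ?_⟩, ⟨?_, ?_⟩⟩, ⟨?_, ?_⟩, ?_⟩ <;> omega
  have key := ((hC.comp (hB.comp hA)).of_natIso (Functor.isoWhiskerLeft _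
    (D.restrComp (incl.{u} hST) (incl.{u} hTK)).symm ≪≫
      (D.restrComp (incl.{u} hST ⋙ incl.{u} hTK) (incl.{u} hKL)).symm)
    fun _ _ i hY => hY.of_iso i)
  -- A section contains neither boundary points nor whole unit squares, since opposite corners would
  -- lie on the same level. So exactness is no condition on its diagrams.
  refine ⟨fun _ _ => trivial, key.bijective, fun Y _ => key.surj Y
    ⟨fun x y h hb => ?_, fun x y h hi => ?_⟩⟩
  · obtain ⟨⟨h₁, h₂⟩, -⟩ := h
    rcases hb with hb | hb <;> omega
  · obtain ⟨⟨-, h₀⟩, -, -, ⟨-, h₁⟩⟩ := h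
    rw [show y + 1 - (x + 1) = y - x by ring] at h₁
    omega

end Prederivator


/-! ### The mesh category as the poset of points of the strip. -/

namespace Repetitive

variable {V : Type u} [Quiver.{u} V]

theorem heq_arr {k : ℤ} {a b : V} (hV : ∀ {a b : V} (α β : a ⟶ b), α = β) (α : a ⟶ b)
    {x y : Repetitive V} (g : x ⟶ y) (hx : x = ⟨k, a⟩) (hy : y = ⟨k, b⟩) : HEq g (arr k α) := by
  change Repetitive.Arrow _ _ at g
  cases g with
  | arr k' β =>
    obtain ⟨rfl, rfl⟩ := Repetitive.mk.inj hx
    obtain ⟨-, rfl⟩ := Repetitive.mk.inj hy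
    rw [hV α β]
    rfl
  | star k' β =>
    have h₁ := (Repetitive.mk.inj hx).1
    have h₂ := (Repetitive.mk.inj hy).1
    omega

theorem heq_star {k : ℤ} {a b : V} (hV : ∀ {a b : V} (α β : a ⟶ b), α = β) (α : a ⟶ b)
    {x y : Repetitive V} (g : x ⟶ y) (hx : x = ⟨k, b⟩) (hy : y = ⟨k + 1, a⟩) :
    HEq g (star k α) := by
  change Repetitive.Arrow _ _ at g
  cases g with
  | arr k' β =>
    have h₁ := (Repetitive.mk.inj hx).1
    have h₂ := (Repetitive.mk.inj hy).1
    omega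
  | star k' β =>
    obtain ⟨rfl, rfl⟩ := Repetitive.mk.inj hx
    obtain ⟨-, rfl⟩ := Repetitive.mk.inj hy
    rw [hV α β]
    rfl

/-- The repetitive quiver of a thin quiver is thin. -/
theorem hom_eq (hV : ∀ {a b : V} (α β : a ⟶ b), α = β) {x y : Repetitive V} (f g : x ⟶ y) :
    f = g := by
  change Repetitive.Arrow _ _ at f
  cases f with
  | arr k α => exact (eq_of_heq (heq_arr hV α g rfl rfl)).symm
  | star k α => exact (eq_of_heq (heq_star hV α g rfl rfl)).symm

/-- Arrows of the repetitive quiver of a thin quiver. -/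
theorem nonempty_hom_iff {x y : Repetitive V} : Nonempty (x ⟶ y) ↔
    (y.k = x.k ∧ Nonempty (x.q ⟶ y.q)) ∨ (y.k = x.k + 1 ∧ Nonempty (y.q ⟶ x.q)) := by
  constructor
  · rintro ⟨f⟩
    change Repetitive.Arrow _ _ at f
    cases f with
    | arr k α => exact Or.inl ⟨rfl, ⟨α⟩⟩
    | star k α => exact Or.inr ⟨rfl, ⟨α⟩⟩
  · obtain ⟨k, a⟩ := x
    obtain ⟨k', b⟩ := y
    rintro (⟨rfl, ⟨α⟩⟩ | ⟨rfl, ⟨α⟩⟩)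
    · exact ⟨arr _ α⟩
    · exact ⟨star _ α⟩

end Repetitive

namespace Linear

variable {m : ℕ}

theorem hom_eq {a b : Linear.{u} m} (α β : a ⟶ b) : α = β :=
  Subsingleton.elim (α := ULift.{u} (PLift (a.down.val + 1 = b.down.val))) α β

theorem nonempty_hom_iff {a b : Linear.{u} m} :
    Nonempty (a ⟶ b) ↔ a.down.val + 1 = b.down.val :=
  ⟨fun ⟨h⟩ => h.down.down, fun h => ⟨⟨⟨h⟩⟩⟩⟩

/-- Arrows of the repetitive quiver of a linear quiver. -/
theorem nonempty_hom_repetitive_iff {x y : Repetitive (Linear.{u} m)} : Nonempty (x ⟶ y) ↔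
    (y.k = x.k ∧ x.q.down.val + 1 = y.q.down.val) ∨
      (y.k = x.k + 1 ∧ y.q.down.val + 1 = x.q.down.val) := by
  rw [Repetitive.nonempty_hom_iff, nonempty_hom_iff, nonempty_hom_iff]

theorem repetitive_ext {x y : Repetitive (Linear.{u} m)} (h₁ : x.k = y.k)
    (h₂ : x.q.down.val = y.q.down.val) : x = y :=
  Repetitive.ext h₁ (ULift.ext _ _ (Fin.ext h₂))

/-- Both kinds of arrows raise `2k + l` by one, so parallel paths have equal length. -/
theorem length_eq {x y : Repetitive (Linear.{u} m)} (p : Quiver.Path x y) :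
    2 * x.k + x.q.down.val + p.length = 2 * y.k + y.q.down.val := by
  induction p with
  | nil => simp
  | cons p e ih =>
    have := nonempty_hom_repetitive_iff.mp ⟨e⟩
    rw [Quiver.Path.length_cons]
    push_cast
    omega

theorem le_of_path {x y : Repetitive (Linear.{u} m)} (p : Quiver.Path x y) :
    x.k ≤ y.k ∧ x.k + x.q.down.val ≤ y.k + y.q.down.val := by
  induction p with
  | nil => simp
  | cons p e ih =>
    have := nonempty_hom_repetitive_iff.mp ⟨e⟩
    omega

/-- Greedy choice: increase `l` while this is possible and `k + l` is below its target value.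
Otherwise use a starred arrow, which raises `k` and keeps `k + l`. -/
theorem nonempty_path (hm : 2 ≤ m) {x y : Repetitive (Linear.{u} m)} (h₁ : x.k ≤ y.k)
    (h₂ : x.k + x.q.down.val ≤ y.k + y.q.down.val) : Nonempty (Quiver.Path x y) := by
  obtain ⟨N, hN⟩ : ∃ N : ℕ, 2 * y.k + y.q.down.val - (2 * x.k + x.q.down.val) = N :=
    ⟨_, (Int.toNat_of_nonneg (by omega)).symm⟩
  induction N generalizing x with
  | zero =>
    obtain rfl : x = y := repetitive_ext (by omega) (by omega)
    exact ⟨.nil⟩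
  | succ N ih =>
    push_cast at hN
    have hx := x.q.down.isLt
    have hy := y.q.down.isLt
    have key : ∀ z : Repetitive (Linear.{u} m), Nonempty (x ⟶ z) → z.k ≤ y.k →
        z.k + z.q.down.val ≤ y.k + y.q.down.val →
        2 * y.k + y.q.down.val - (2 * z.k + z.q.down.val) = N → Nonempty (Quiver.Path x y) := by
      rintro z ⟨e⟩ h h' h''
      obtain ⟨p⟩ := ih h h' h''
      exact ⟨(Quiver.Hom.toPath e).comp p⟩
    by_cases h : x.q.down.val + 1 < m ∧ x.k + x.q.down.val < y.k + y.q.down.val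
    · refine key ⟨x.k, ⟨⟨x.q.down.val + 1, h.1⟩⟩⟩
        (nonempty_hom_repetitive_iff.mpr (Or.inl ⟨rfl, rfl⟩)) ?_ ?_ ?_ <;> dsimp only <;>
        push_cast <;> omega
    · refine key ⟨x.k + 1, ⟨⟨x.q.down.val - 1, by omega⟩⟩⟩
        (nonempty_hom_repetitive_iff.mpr (Or.inr ⟨rfl, ?_⟩)) ?_ ?_ ?_ <;> dsimp only <;>
        omega

end Linear

namespace Mesh

variable {n : ℕ}

/-- The class of a path in the mesh category. -/
abbrev ofPath {x y : Repetitive (Linear.{u} (n + 2))} (p : Quiver.Path x y) :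
    (proj n).obj x ⟶ (proj n).obj y :=
  (CategoryTheory.Quotient.functor (MeshRel (Linear.{u} (n + 2)))).map p

theorem ofPath_cons {x y z : Repetitive (Linear.{u} (n + 2))} (p : Quiver.Path x y) (e : y ⟶ z) :
    ofPath (p.cons e) = ofPath p ≫ (proj n).map e :=
  (CategoryTheory.Quotient.functor (MeshRel (Linear.{u} (n + 2)))).map_comp p
    (Quiver.Hom.toPath e)

/-- One of the two arrows into `b` is unstarred and the other starred, so they are the lower halves
of a mesh square; `w` is its initial vertex. -/
theorem exists_diamond {b c c' : Repetitive (Linear.{u} (n + 2))} (e : c ⟶ b) (e' : c' ⟶ b)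
    (h : b.k = c.k) (h' : b.k = c'.k + 1) : ∃ (w : Repetitive (Linear.{u} (n + 2)))
      (f : w ⟶ c) (f' : w ⟶ c'), w.k = c'.k ∧ w.q = b.q ∧
        (proj n).map f ≫ (proj n).map e = (proj n).map f' ≫ (proj n).map e' := by
  change Repetitive.Arrow _ _ at e e'
  cases e with
  | star k α =>
    dsimp only at h
    omega
  | arr k α =>
    cases e' with
    | arr _ β =>
      dsimp only at h'
      omega
    | star k γ => exact ⟨⟨k, _⟩, .star k α, .arr k γ, rfl, rfl, (square_comm k α γ).symm⟩

/-- Induction on the length. If the last arrows differ, they close up to a mesh square with initial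
vertex `w`. There is a path from `x` to `w`, and continuing it along both sides of the square
compares the two given paths. -/
theorem ofPath_eq {x y : Repetitive (Linear.{u} (n + 2))} (p q : Quiver.Path x y) :
    ofPath p = ofPath q := by
  obtain ⟨N, hN⟩ : ∃ N : ℕ, p.length = N := ⟨_, rfl⟩
  have hl := fun q : Quiver.Path x y => Linear.length_eq q
  induction N generalizing y with
  | zero =>
    have hq : q.length = 0 := by have := hl p; have := hl q; omega
    obtain rfl := Quiver.Path.eq_of_length_zero p hN
    rw [Quiver.Path.eq_nil_of_length_zero p hN, Quiver.Path.eq_nil_of_length_zero q hq]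
  | succ N ih =>
    have hq : q.length = N + 1 := by have := hl p; have := hl q; omega
    have key : ∀ {c c' : Repetitive (Linear.{u} (n + 2))} (p : Quiver.Path x c)
        (q : Quiver.Path x c') (e : c ⟶ y) (e' : c' ⟶ y), p.length = N → q.length = N →
          y.k = c.k → y.k = c'.k + 1 → ofPath (p.cons e) = ofPath (q.cons e') := by
      intro c c' p q e e' hp hq h h'
      obtain ⟨w, f, f', hw, hw', hf⟩ := exists_diamond e e' h h'
      have h₁ := Linear.le_of_path p
      have h₂ := Linear.le_of_path q
      have h₃ := Linear.nonempty_hom_repetitive_iff.mp ⟨e⟩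
      have h₄ := congrArg (fun t => t.down.val) hw'
      -- The bound on `k` comes from the path to `c'`, the bound on `k + l` from the path to `c`.
      obtain ⟨r⟩ := Linear.nonempty_path (Nat.le_add_left 2 n) (x := x) (y := w) (by omega) (by omega)
      rw [ofPath_cons, ofPath_cons, ih p (r.cons f) hp fun q => Linear.length_eq q,
        ih q (r.cons f') hq fun q => Linear.length_eq q, ofPath_cons, ofPath_cons, Category.assoc,
        Category.assoc, hf]
    cases p with
    | nil => simp at hN
    | @cons c _ p e =>
      cases q with
      | nil => simp at hq
      | @cons c' _ q e' =>
        rw [Quiver.Path.length_cons] at hN hq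
        have hN' : p.length = N := by omega
        have hq' : q.length = N := by omega
        have h₁ := Linear.nonempty_hom_repetitive_iff.mp ⟨e⟩
        have h₂ := Linear.nonempty_hom_repetitive_iff.mp ⟨e'⟩
        by_cases hc : c = c'
        · subst hc
          rw [Repetitive.hom_eq Linear.hom_eq e e', ofPath_cons, ofPath_cons,
            ih p q hN' fun q => Linear.length_eq q]
        · have hc' : ¬ (c.k = c'.k ∧ c.q.down.val = c'.q.down.val) :=
            fun h => hc (Linear.repetitive_ext h.1 h.2)
          by_cases h : y.k = c.k
          · exact key p q e e' hN' hq' h (by omega)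
          · exact (key q p e' e hq' hN' (by omega) (by omega)).symm

instance : Quiver.IsThin (Mesh.{u} n) := fun x y => ⟨fun f g => by
  obtain ⟨p, rfl⟩ := (CategoryTheory.Quotient.functor (MeshRel (Linear.{u} (n + 2)))).map_surjective f
  obtain ⟨q, rfl⟩ := (CategoryTheory.Quotient.functor (MeshRel (Linear.{u} (n + 2)))).map_surjective g
  exact ofPath_eq p q⟩

open Prederivator

/-- The point `(k, k + l)` of the strip. -/
abbrev toStrip (x : Repetitive (Linear.{u} (n + 2))) : Shape.{u} (StripShape n) :=
  Shape.pt x.k (x.k + x.q.down.val) ⟨by omega, by have := x.q.down.isLt; omega⟩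

theorem nonempty_hom_iff {x y : Repetitive (Linear.{u} (n + 2))} :
    Nonempty ((proj n).obj x ⟶ (proj n).obj y) ↔ toStrip x ≤ toStrip y := by
  constructor
  · rintro ⟨f⟩
    obtain ⟨p, -⟩ := (CategoryTheory.Quotient.functor (MeshRel (Linear.{u} (n + 2)))).map_surjective f
    exact Linear.le_of_path p
  · intro h
    obtain ⟨p⟩ := Linear.nonempty_path (Nat.le_add_left 2 n) (x := x) (y := y) h.1 h.2
    exact ⟨ofPath p⟩

/-- The mesh category is equivalent to the strip. -/
noncomputable def stripFunctor (n : ℕ) : Mesh.{u} n ⥤ Shape.{u} (StripShape n) where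
  obj x := toStrip x.as
  map f := homOfLE (nonempty_hom_iff.mp ⟨f⟩)

instance : (stripFunctor.{u} n).IsEquivalence where
  faithful := ⟨fun _ => Subsingleton.elim _ _⟩
  full := ⟨fun {x y} f => ⟨(nonempty_hom_iff.mpr (leOfHom f)).some, Subsingleton.elim _ _⟩⟩
  essSurj := ⟨fun ⟨⟨⟨x, y⟩, h⟩⟩ => ⟨(proj n).obj ⟨x, ⟨⟨(y - x).toNat, by
    have h₁ := h.1; have h₂ := h.2; dsimp only at h₁ h₂; omega⟩⟩⟩,
      ⟨eqToIso (ULift.ext _ _ (Subtype.ext (_root_.Prod.ext rfl (by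
        have h₁ := h.1
        change x + ((y - x).toNat : ℤ) = y
        dsimp only at h₁
        omega))))⟩⟩⟩

end Mesh


/-! ### Sections of the strip whose quiver is `Q`. -/

open Prederivator

/-- The points `(x q, x q + lev q)` form a section of the strip `x ≤ y ≤ x + n + 1`, whose quiver
is `Q`. -/
structure IsQuiverSection {Q : Type u} [Quiver.{u} Q] (n : ℕ) (x lev : Q → ℤ) : Prop where
  hom_eq : ∀ {a b : Q} (α β : a ⟶ b), α = β
  injective : Function.Injective lev
  mem : ∀ q, 1 ≤ lev q ∧ lev q ≤ n
  surj : ∀ l : ℤ, 1 ≤ l → l ≤ n → ∃ q, lev q = l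
  arrow : ∀ {a b : Q}, (a ⟶ b) →
    (x b = x a ∧ lev b = lev a + 1) ∨ (x b = x a + 1 ∧ lev a = lev b + 1)
  adj : ∀ a b, lev b = lev a + 1 → Nonempty (a ⟶ b) ∨ Nonempty (b ⟶ a)

namespace IsQuiverSection

variable {Q : Type u} [Quiver.{u} Q] {n : ℕ} {x lev : Q → ℤ} (h : IsQuiverSection n x lev)
include h

theorem exists_section (hn : 1 ≤ n) : ∃ σ : ℤ → ℤ, IsSection σ ∧ ∀ q, σ (lev q) = x q := by
  -- The section is extended to all integers by clamping the level to the interval from `1` to `n`,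
  -- so it is constant outside.
  choose g hg using h.surj
  obtain ⟨c, hcl⟩ : ∃ c : ℤ → ℤ, ∀ l, c l = max 1 (min l n) := ⟨_, fun _ => rfl⟩
  have hc : ∀ l, 1 ≤ c l ∧ c l ≤ n := fun l => by
    have := hcl l
    omega
  refine ⟨fun l => x (g (c l) (hc l).1 (hc l).2), fun l => ?_, fun q => ?_⟩
  · have hc₁ := hcl l
    have hc₂ := hcl (l + 1)
    by_cases hl : 1 ≤ l ∧ l + 1 ≤ n
    · rcases h.adj (g (c l) (hc l).1 (hc l).2) (g (c (l + 1)) (hc _).1 (hc _).2)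
        (by rw [hg, hg]; omega) with ⟨⟨α⟩⟩ | ⟨⟨α⟩⟩
      · have h₁ := h.arrow α
        rw [hg, hg] at h₁
        dsimp only
        omega
      · have h₁ := h.arrow α
        rw [hg, hg] at h₁
        dsimp only
        omega
    · have e : c (l + 1) = c l := by omega
      dsimp only
      simp only [e]
      omega
  · have h₁ := h.mem q
    have e : c (lev q) = lev q := by
      have := hcl (lev q)
      omega
    exact congrArg x (h.injective ((hg _ _ _).trans e))

theorem le_of_path {a b : Q} (p : Quiver.Path a b) :
    x a ≤ x b ∧ x a + lev a ≤ x b + lev b := by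
  induction p with
  | nil => exact ⟨le_rfl, le_rfl⟩
  | cons p e ih =>
    have := h.arrow e
    omega

/-- Going up in level, `x` weakly decreases and `x + lev` weakly increases. These inequalities
decide in which direction paths can run. -/
theorem le_or (hn : 1 ≤ n) (a b : Q) : (lev a ≤ lev b ∧ x b ≤ x a ∧ x a + lev a ≤ x b + lev b) ∨
    (lev b ≤ lev a ∧ x a ≤ x b ∧ x b + lev b ≤ x a + lev a) := by
  obtain ⟨σ, hσ, hx⟩ := h.exists_section hn
  rcases le_total (lev a) (lev b) with hab | hab
  · have := hσ.le hab
    rw [hx, hx] at this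
    omega
  · have := hσ.le hab
    rw [hx, hx] at this
    omega

/-- Move one level towards `b`. If the arrow to that neighbour pointed the other way, the assumed
inequalities would contradict `le_or`. -/
theorem nonempty_path (hn : 1 ≤ n) {a b : Q} (h₁ : x a ≤ x b)
    (h₂ : x a + lev a ≤ x b + lev b) : Nonempty (Quiver.Path a b) := by
  obtain ⟨N, hN⟩ : ∃ N : ℕ, 2 * x b + lev b - (2 * x a + lev a) = N :=
    ⟨_, (Int.toNat_of_nonneg (by omega)).symm⟩
  induction N generalizing a with
  | zero =>
    have h₃ := h.le_or hn a b
    obtain rfl : a = b := h.injective (by omega)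
    exact ⟨.nil⟩
  | succ N ih =>
    push_cast at hN
    have h₃ := h.le_or hn a b
    have ha := h.mem a
    have hb := h.mem b
    rcases lt_trichotomy (lev a) (lev b) with hab | hab | hab
    · obtain ⟨c, hc⟩ := h.surj (lev a + 1) (by omega) (by omega)
      have h₄ := h.le_or hn c b
      rcases h.adj a c hc with ⟨⟨α⟩⟩ | ⟨⟨α⟩⟩
      · have h₅ := h.arrow α
        obtain ⟨p⟩ := ih (a := c) (by omega) (by omega) (by omega)
        exact ⟨(Quiver.Hom.toPath α).comp p⟩
      · have h₅ := h.arrow α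
        omega
    · omega
    · obtain ⟨c, hc⟩ := h.surj (lev a - 1) (by omega) (by omega)
      have h₄ := h.le_or hn c b
      rcases h.adj c a (by omega) with ⟨⟨α⟩⟩ | ⟨⟨α⟩⟩
      · have h₅ := h.arrow α
        omega
      · have h₅ := h.arrow α
        obtain ⟨p⟩ := ih (a := c) (by omega) (by omega) (by omega)
        exact ⟨(Quiver.Hom.toPath α).comp p⟩

/-- The order relations leave only one level for the last vertex before the end, and a level
contains a single vertex. -/
theorem path_eq (hn : 1 ≤ n) {a b : Q} (p q : Quiver.Path a b) : p = q := by
  induction p with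
  | nil =>
    cases q with
    | nil => rfl
    | cons q e =>
      have h₁ := h.le_of_path q
      have h₂ := h.arrow e
      omega
  | @cons c b p e ih =>
    cases q with
    | nil =>
      have h₁ := h.le_of_path p
      have h₂ := h.arrow e
      omega
    | @cons c' _ q e' =>
      have h₁ := h.le_of_path p
      have h₂ := h.arrow e
      have h₃ := h.le_of_path q
      have h₄ := h.arrow e'
      have h₅ := h.le_or hn a b
      obtain rfl : c = c' := h.injective (by omega)
      rw [ih q, h.hom_eq e e']

/-- The free category on `Q` is equivalent to the section. -/
theorem exists_equivalence (hn : 1 ≤ n) {σ : ℤ → ℤ} (hσ : ∀ q, σ (lev q) = x q) :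
    ∃ G : Paths Q ⥤ Shape.{u} (SectionShape n σ), G.IsEquivalence ∧
      ∀ q : Q, (G.obj q).down.1 = (x q, x q + lev q) := by
  have hm : ∀ q, SectionShape n σ (x q) (x q + lev q) := fun q => by
    have := h.mem q
    refine ⟨⟨by omega, by omega⟩, ?_⟩
    rw [add_sub_cancel_left, hσ]
  let G : Paths Q ⥤ Shape.{u} (SectionShape n σ) :=
    { obj q := Shape.pt (x q) (x q + lev q) (hm q)
      map p := homOfLE (h.le_of_path p) }
  have hfull : G.Full := ⟨fun {a b} g => by
    obtain ⟨p⟩ := h.nonempty_path hn (leOfHom g).1 (leOfHom g).2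
    exact ⟨p, Subsingleton.elim _ _⟩⟩
  have hsurj : G.EssSurj := ⟨fun y => by
    obtain ⟨⟨⟨a, b⟩, hab⟩⟩ := y
    obtain ⟨⟨h₁, h₂⟩, h₃⟩ := hab
    dsimp only at h₁ h₂ h₃
    obtain ⟨q, hq⟩ := h.surj (b - a) (by omega) (by omega)
    have := hσ q
    rw [hq, ← h₃] at this
    exact ⟨q, ⟨eqToIso (ULift.ext _ _ (Subtype.ext (_root_.Prod.ext this.symm (by
      change x q + lev q = b
      omega))))⟩⟩⟩
  exact ⟨G, { faithful := ⟨fun _ => h.path_eq hn _ _⟩ }, fun q => rfl⟩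

end IsQuiverSection


/-! ### Isomorphisms between repetitive quivers of line quivers. -/

section

variable {V W : Type u} [Quiver.{u} V] [Quiver.{u} W]

namespace QuiverIso

theorem inv_obj (φ : QuiverIso V W) (x : V) : φ.inv.obj (φ.hom.obj x) = x :=
  congrArg (fun F => F.obj x) φ.hom_inv

theorem injective (φ : QuiverIso V W) : Function.Injective φ.hom.obj :=
  Function.LeftInverse.injective φ.inv_obj

theorem nonempty_hom_iff (φ : QuiverIso V W) (x y : V) :
    Nonempty (φ.hom.obj x ⟶ φ.hom.obj y) ↔ Nonempty (x ⟶ y) := by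
  refine ⟨fun ⟨f⟩ => ⟨?_⟩, fun ⟨f⟩ => ⟨φ.hom.map f⟩⟩
  have g := φ.inv.map f
  rwa [inv_obj, inv_obj] at g

/-- Isomorphisms of thin quivers. -/
theorem nonempty_of_equiv (hV : ∀ {a b : V} (f g : a ⟶ b), f = g)
    (hW : ∀ {a b : W} (f g : a ⟶ b), f = g) (e : V ≃ W)
    (h : ∀ a b, Nonempty (a ⟶ b) ↔ Nonempty (e a ⟶ e b)) : Nonempty (QuiverIso V W) := by
  have h' : ∀ a b, Nonempty (a ⟶ b) → Nonempty (e.symm a ⟶ e.symm b) := fun a b hab => by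
    rw [h, e.apply_symm_apply, e.apply_symm_apply]
    exact hab
  exact ⟨{
    hom := { obj := e, map f := ((h _ _).mp ⟨f⟩).some }
    inv := { obj := e.symm, map f := (h' _ _ ⟨f⟩).some }
    hom_inv := Prefunctor.ext e.symm_apply_apply fun _ _ _ => hV _ _
    inv_hom := Prefunctor.ext e.apply_symm_apply fun _ _ _ => hW _ _ }⟩

end QuiverIso

/-- A quiver whose underlying graph is a path. -/
structure IsLineQuiver {m : ℕ} (lab : V ≃ Fin m) : Prop where
  hom_eq : ∀ {a b : V} (f g : a ⟶ b), f = g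
  adj : ∀ {a b : V}, (a ⟶ b) → (lab a).val + 1 = (lab b).val ∨ (lab b).val + 1 = (lab a).val
  exists_hom : ∀ a b : V, (lab a).val + 1 = (lab b).val → Nonempty (a ⟶ b) ∨ Nonempty (b ⟶ a)
  asymm : ∀ a b : V, Nonempty (a ⟶ b) → ¬ Nonempty (b ⟶ a)

namespace IsLineQuiver

variable {m : ℕ} {lab : V ≃ Fin m} (h : IsLineQuiver lab)
include h

-- A height function: `c` stays constant across an arrow towards larger labels and drops by one
-- across an arrow towards smaller ones. Adding it to `k` turns the latter arrows into starred
-- arrows of the linear repetitive quiver.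
open Classical in
theorem exists_offset : ∃ c : ℕ → ℤ, ∀ a b : V, (lab a).val + 1 = (lab b).val →
    (Nonempty (a ⟶ b) → c (lab b) = c (lab a)) ∧
      (Nonempty (b ⟶ a) → c (lab b) = c (lab a) - 1) := by
  let c : ℕ → ℤ := fun l => Nat.rec 0 (fun l t => if ∃ a b : V, (lab a).val = l ∧
    (lab b).val = l + 1 ∧ Nonempty (a ⟶ b) then t else t - 1) l
  refine ⟨c, fun a b hab => ⟨fun hf => ?_, fun hf => ?_⟩⟩
  · rw [← hab]
    exact if_pos ⟨a, b, rfl, hab.symm, hf⟩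
  · rw [← hab]
    refine if_neg ?_
    rintro ⟨a', b', ha, hb, hf'⟩
    obtain rfl := lab.injective (Fin.ext ha)
    obtain rfl := lab.injective (Fin.ext (hb.trans hab))
    exact h.asymm _ _ hf hf'

/-- The repetitive quiver does not depend on the orientation. -/
theorem nonempty_iso : Nonempty (QuiverIso (Repetitive V) (Repetitive (Linear.{u} m))) := by
  obtain ⟨c, hc⟩ := h.exists_offset
  let e : Repetitive V ≃ Repetitive (Linear.{u} m) :=
    { toFun x := ⟨x.k + c (lab x.q), ⟨lab x.q⟩⟩
      invFun y := ⟨y.k - c y.q.down, lab.symm y.q.down⟩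
      left_inv x := by simp
      right_inv y := by
        simp only [Equiv.apply_symm_apply, sub_add_cancel]
        rfl }
  refine QuiverIso.nonempty_of_equiv (Repetitive.hom_eq h.hom_eq) (Repetitive.hom_eq Linear.hom_eq)
    e fun ⟨k, a⟩ ⟨k', b⟩ => ?_
  rw [Repetitive.nonempty_hom_iff, Linear.nonempty_hom_repetitive_iff]
  change _ ↔ (k' + c (lab b) = k + c (lab a) ∧ (lab a).val + 1 = (lab b).val) ∨
    (k' + c (lab b) = k + c (lab a) + 1 ∧ (lab b).val + 1 = (lab a).val)
  dsimp only
  have h₁ := hc a b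
  have h₂ := hc b a
  have h₃ := h.exists_hom a b
  have h₄ := h.exists_hom b a
  by_cases hab : Nonempty (a ⟶ b)
  · have hba := h.asymm a b hab
    have := h.adj hab.some
    simp only [hab, hba, true_implies, false_implies, and_true, and_false, or_false] at h₁ h₂ ⊢
    omega
  · by_cases hba : Nonempty (b ⟶ a)
    · have := h.adj hba.some
      simp only [hab, hba, true_implies, false_implies, and_true, true_and, and_false,
        false_or] at h₁ h₂ ⊢
      omega
    · simp only [hab, hba, and_false, or_false, false_iff, imp_false] at h₃ h₄ ⊢
      omega

end IsLineQuiver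

end

namespace TypeALabelling

variable {Q : Type u} [Quiver.{u} Q] {n : ℕ} (lab : TypeALabelling n Q)

theorem adj {a b : Q} (f : a ⟶ b) : (lab.label a).val + 1 = (lab.label b).val ∨
    (lab.label b).val + 1 = (lab.label a).val := by
  by_contra h
  rw [not_or] at h
  exact (lab.no_arrow a b h.1 h.2).false f

include lab in
theorem hom_eq {a b : Q} (f g : a ⟶ b) : f = g := by
  rcases lab.adj f with h | h
  · obtain ⟨_⟩ := lab.unique_arrow a b h
    exact Sum.inl_injective (Subsingleton.elim (Sum.inl f : (a ⟶ b) ⊕ (b ⟶ a)) (Sum.inl g))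
  · obtain ⟨_⟩ := lab.unique_arrow b a h
    exact Sum.inr_injective (Subsingleton.elim (Sum.inr f : (b ⟶ a) ⊕ (a ⟶ b)) (Sum.inr g))

theorem exists_hom (a b : Q) (h : (lab.label a).val + 1 = (lab.label b).val) :
    Nonempty (a ⟶ b) ∨ Nonempty (b ⟶ a) := by
  obtain ⟨⟨⟨f | f⟩, -⟩⟩ := lab.unique_arrow a b h
  · exact Or.inl ⟨f⟩
  · exact Or.inr ⟨f⟩

include lab in
theorem asymm (a b : Q) : Nonempty (a ⟶ b) → ¬ Nonempty (b ⟶ a) := by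
  rintro ⟨f⟩ ⟨g⟩
  rcases lab.adj f with h | h
  · obtain ⟨_⟩ := lab.unique_arrow a b h
    exact Sum.inl_ne_inr (Subsingleton.elim (Sum.inl f : (a ⟶ b) ⊕ (b ⟶ a)) (Sum.inr g))
  · obtain ⟨_⟩ := lab.unique_arrow b a h
    exact Sum.inr_ne_inl (Subsingleton.elim (Sum.inr f : (b ⟶ a) ⊕ (a ⟶ b)) (Sum.inl g))

variable (hn : 1 ≤ n)

/-- The labelling of the extended quiver. -/
def extLabel : Ext (lab.ends hn) ≃ Fin (n + 2) where
  toFun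
    | .old q => ⟨(lab.label q).val + 1, by omega⟩
    | .new 0 => 0
    | .new 1 => Fin.last _
  invFun i := if h₀ : i.val = 0 then .new 0 else if h₁ : i.val = n + 1 then .new 1 else
    .old (lab.label.symm ⟨i.val - 1, by omega⟩)
  left_inv x := by
    match x with
    | .old q =>
      have := (lab.label q).isLt
      simp [this.ne]
    | .new 0 => simp
    | .new 1 => simp
  right_inv i := by
    by_cases h₀ : i.val = 0
    · simp only [h₀, dif_pos]
      exact Fin.ext h₀.symm
    by_cases h₁ : i.val = n + 1
    · simp only [h₁, dif_pos]
      exact Fin.ext h₁.symm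
    · simp only [h₀, h₁, dif_neg, not_false_eq_true, Equiv.apply_symm_apply]
      exact Fin.ext (by dsimp only; omega)

theorem ends_zero : (lab.label (lab.ends hn 0)).val = 0 := by
  simp [ends]

theorem ends_one : (lab.label (lab.ends hn 1)).val = n - 1 := by
  simp [ends]

theorem isLineQuiver_ext : IsLineQuiver (lab.extLabel hn) where
  hom_eq {a b} f g := by
    match a, b, f, g with
    | .old a, .old b, f, g => exact lab.hom_eq (a := a) (b := b) f g
    | .old a, .new i, f, g => exact Subsingleton.elim (α := ULift.{u} (PLift _)) f g
    | .new _, _, f, _ => exact PEmpty.elim f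
  adj {a b} f := by
    match a, b, f with
    | .old a, .old b, f =>
      have := lab.adj (a := a) (b := b) f
      change (lab.label a).val + 1 + 1 = (lab.label b).val + 1 ∨
        (lab.label b).val + 1 + 1 = (lab.label a).val + 1
      omega
    | .old a, .new 0, f =>
      have h : a = lab.ends hn 0 := f.down.down
      have := lab.ends_zero hn
      rw [← h] at this
      refine Or.inr ?_
      change 0 + 1 = (lab.label a).val + 1
      omega
    | .old a, .new 1, f =>
      have h : a = lab.ends hn 1 := f.down.down
      have := lab.ends_one hn
      rw [← h] at this
      refine Or.inl ?_
      change (lab.label a).val + 1 + 1 = n + 1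
      omega
    | .new _, _, f => exact PEmpty.elim f
  exists_hom a b h := by
    match a, b, h with
    | .old a, .old b, h =>
      refine lab.exists_hom a b ?_
      change (lab.label a).val + 1 + 1 = (lab.label b).val + 1 at h
      omega
    | .old a, .new 0, h => exact absurd h (Nat.succ_ne_zero _)
    | .old a, .new 1, h =>
      change (lab.label a).val + 1 + 1 = n + 1 at h
      have := lab.ends_one hn
      exact Or.inl ⟨⟨⟨lab.label.injective (Fin.ext (by omega))⟩⟩⟩
    | .new 0, .old b, h =>
      change 0 + 1 = (lab.label b).val + 1 at h
      have := lab.ends_zero hn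
      exact Or.inr ⟨⟨⟨lab.label.injective (Fin.ext (by omega))⟩⟩⟩
    | .new 1, .old b, h =>
      change n + 1 + 1 = (lab.label b).val + 1 at h
      omega
    | .new 0, .new 0, h => exact absurd h (Nat.succ_ne_zero _)
    | .new 1, .new 0, h => exact absurd h (Nat.succ_ne_zero _)
    | .new 0, .new 1, h =>
      change 0 + 1 = n + 1 at h
      omega
    | .new 1, .new 1, h => exact absurd h (Nat.succ_ne_self _)
  asymm a b := by
    match a, b with
    | .old a, .old b => exact lab.asymm a b
    | .old a, .new _ => exact fun _ ⟨g⟩ => PEmpty.elim g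
    | .new _, _ => exact fun ⟨f⟩ => PEmpty.elim f

end TypeALabelling

/-! ### Every isomorphism of repetitive quivers maps `Q` to a section. -/

theorem Repetitive.exists_between {V : Type u} [Quiver.{u} V] (k : ℤ) {p q : V}
    (h : Nonempty (q ⟶ p) ∨ Nonempty (p ⟶ q)) : ∃ s : Repetitive V, s.q = p ∧
      Nonempty ((⟨k, q⟩ : Repetitive V) ⟶ s) ∧ Nonempty (s ⟶ ⟨k + 1, q⟩) := by
  rcases h with ⟨⟨f⟩⟩ | ⟨⟨f⟩⟩
  · exact ⟨⟨k, p⟩, rfl, ⟨.arr k f⟩, ⟨.star k f⟩⟩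
  · exact ⟨⟨k + 1, p⟩, rfl, ⟨.star k f⟩, ⟨.arr (k + 1) f⟩⟩

section

variable {V : Type u} [Quiver.{u} V] {m : ℕ}
  (φ : QuiverIso (Repetitive V) (Repetitive (Linear.{u} m)))

/-- Isomorphisms of repetitive quivers are compatible with translation at vertices with two
neighbours. -/
theorem QuiverIso.translate {p p' q : V} (hp : Nonempty (q ⟶ p) ∨ Nonempty (p ⟶ q))
    (hp' : Nonempty (q ⟶ p') ∨ Nonempty (p' ⟶ q)) (hne : p ≠ p') (k : ℤ) :
    (φ.hom.obj ⟨k + 1, q⟩).k = (φ.hom.obj ⟨k, q⟩).k + 1 ∧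
      (φ.hom.obj ⟨k + 1, q⟩).q = (φ.hom.obj ⟨k, q⟩).q ∧
        1 ≤ (φ.hom.obj ⟨k, q⟩).q.down.val ∧ (φ.hom.obj ⟨k, q⟩).q.down.val + 1 < m := by
  obtain ⟨s, hs, h₁, h₂⟩ := Repetitive.exists_between k hp
  obtain ⟨t, ht, h₃, h₄⟩ := Repetitive.exists_between k hp'
  -- The two neighbours give two paths of length two with the same ends and different midpoints. In
  -- the linear repetitive quiver this occurs only from `(k, l)` to `(k + 1, l)` with `l` strictly
  -- between the extreme values.
  have hst : φ.hom.obj s ≠ φ.hom.obj t := fun h => hne (by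
    rw [← hs, ← ht, φ.injective h])
  have hst' : ¬ ((φ.hom.obj s).k = (φ.hom.obj t).k ∧
      (φ.hom.obj s).q.down.val = (φ.hom.obj t).q.down.val) :=
    fun h => hst (Linear.repetitive_ext h.1 h.2)
  rw [← φ.nonempty_hom_iff, Linear.nonempty_hom_repetitive_iff] at h₁ h₂ h₃ h₄
  have hs' := (φ.hom.obj s).q.down.isLt
  have ht' := (φ.hom.obj t).q.down.isLt
  refine ⟨by omega, ULift.ext _ _ (Fin.ext (by omega)), by omega, by omega⟩

end

section

variable {Q : Type u} [Quiver.{u} Q] {n : ℕ} (lab : TypeALabelling n Q) (hn : 1 ≤ n)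
  (φ : QuiverIso (Repetitive (Ext (lab.ends hn))) (Repetitive (Linear.{u} (n + 2))))

/-- The two attached vertices supply the neighbours missing at the ends of `Q`; this is the purpose
of the extended quiver. -/
theorem TypeALabelling.exists_neighbours (q : Q) : ∃ p p' : Ext (lab.ends hn), p ≠ p' ∧
    (Nonempty (.old q ⟶ p) ∨ Nonempty (p ⟶ .old q)) ∧
      (Nonempty (.old q ⟶ p') ∨ Nonempty (p' ⟶ .old q)) := by
  have h := lab.isLineQuiver_ext hn
  let e := lab.extLabel hn
  have he : (e (.old q)).val = (lab.label q).val + 1 := rfl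
  have hq := (lab.label q).isLt
  refine ⟨e.symm ⟨(e (.old q)).val - 1, by omega⟩, e.symm ⟨(e (.old q)).val + 1, by omega⟩,
    fun hpp => ?_, ?_, ?_⟩
  · have := congrArg Fin.val (e.symm.injective hpp)
    dsimp only at this
    omega
  · refine (h.exists_hom _ _ ?_).symm
    change (e (e.symm _)).val + 1 = _
    rw [e.apply_symm_apply]
    dsimp only
    change _ = (e (.old q)).val
    omega
  · refine h.exists_hom _ _ ?_
    change _ = (e (e.symm _)).val
    rw [e.apply_symm_apply]

theorem TypeALabelling.translate (q : Q) (k : ℤ) :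
    (φ.hom.obj ⟨k, .old q⟩).k = k + (φ.hom.obj ⟨0, .old q⟩).k ∧
      (φ.hom.obj ⟨k, .old q⟩).q = (φ.hom.obj ⟨0, .old q⟩).q := by
  obtain ⟨p, p', hne, hp, hp'⟩ := lab.exists_neighbours hn q
  have h := fun k => φ.translate hp hp' hne k
  induction k with
  | zero => simp
  | succ k ih =>
    have := h k
    exact ⟨by omega, this.2.1.trans ih.2⟩
  | pred k ih =>
    have := h (-k - 1)
    rw [sub_add_cancel] at this
    exact ⟨by omega, this.2.1.symm.trans ih.2⟩

theorem TypeALabelling.translate_mem (q : Q) :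
    1 ≤ ((φ.hom.obj ⟨0, .old q⟩).q.down.val : ℤ) ∧
      ((φ.hom.obj ⟨0, .old q⟩).q.down.val : ℤ) ≤ n := by
  obtain ⟨p, p', hne, hp, hp'⟩ := lab.exists_neighbours hn q
  have := φ.translate hp hp' hne 0
  omega

/-- If the images of `(0, q)` and `(0, q')` have first coordinates `k`, `k'` and a common level,
then `(k', q)` and `(k, q')` have the same image. -/
theorem TypeALabelling.lev_injective :
    Function.Injective fun q => ((φ.hom.obj ⟨0, .old q⟩).q.down.val : ℤ) := by
  intro q q' h
  replace h : ((φ.hom.obj ⟨0, .old q⟩).q.down.val : ℤ) = (φ.hom.obj ⟨0, .old q'⟩).q.down.val := h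
  have h₁ := lab.translate hn φ q (φ.hom.obj ⟨0, .old q'⟩).k
  have h₂ := lab.translate hn φ q' (φ.hom.obj ⟨0, .old q⟩).k
  have h₃ := φ.injective (Linear.repetitive_ext
    (x := φ.hom.obj ⟨(φ.hom.obj ⟨0, .old q'⟩).k, .old q⟩)
    (y := φ.hom.obj ⟨(φ.hom.obj ⟨0, .old q⟩).k, .old q'⟩) (by omega) (by
      rw [h₁.2, h₂.2]
      exact_mod_cast h))
  exact Ext.old.inj (Repetitive.mk.inj h₃).2

theorem TypeALabelling.isQuiverSection : IsQuiverSection n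
    (fun q => (φ.hom.obj ⟨0, .old q⟩).k) (fun q => ((φ.hom.obj ⟨0, .old q⟩).q.down.val : ℤ)) where
  hom_eq := lab.hom_eq
  injective := lab.lev_injective hn φ
  mem q := lab.translate_mem hn φ q
  surj l h₁ h₂ := by
    -- Levels run from `1` to `n`, hence the shift by one; an injective self-map of a finite set is
    -- surjective.
    let f : Fin n → Fin n := fun i =>
      ⟨(φ.hom.obj ⟨0, .old (lab.label.symm i)⟩).q.down.val - 1, by
        have := lab.translate_mem hn φ (lab.label.symm i)
        omega⟩
    have hf : Function.Injective f := fun i j hij => by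
      have h₃ := lab.translate_mem hn φ (lab.label.symm i)
      have h₄ := lab.translate_mem hn φ (lab.label.symm j)
      have h₅ := congrArg Fin.val hij
      dsimp only [f] at h₅
      exact lab.label.symm.injective (lab.lev_injective hn φ (by dsimp only; omega))
    obtain ⟨i, hi⟩ := (Finite.injective_iff_surjective.mp hf) ⟨(l - 1).toNat, by omega⟩
    have h₃ := lab.translate_mem hn φ (lab.label.symm i)
    have h₅ := congrArg Fin.val hi
    dsimp only [f] at h₅
    exact ⟨lab.label.symm i, by omega⟩
  arrow {a b} f := by
    have := Linear.nonempty_hom_repetitive_iff.mp ⟨φ.hom.map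
      (Repetitive.arr 0 ((Ext.incl (lab.ends hn)).map f))⟩
    simp only [Ext.incl] at this
    omega
  adj a b h := by
    -- Translate `b` until its image has the same first coordinate as that of `a`. The images are
    -- then joined by an unstarred arrow, and `φ` reflects it to an arrow between `a` and `b` in one
    -- direction.
    have h₁ := lab.translate hn φ b ((φ.hom.obj ⟨0, .old a⟩).k - (φ.hom.obj ⟨0, .old b⟩).k)
    have h₂ := congrArg (fun t => t.down.val) h₁.2
    have h₃ := (Linear.nonempty_hom_repetitive_iff (x := φ.hom.obj ⟨0, .old a⟩)
      (y := φ.hom.obj ⟨(φ.hom.obj ⟨0, .old a⟩).k - (φ.hom.obj ⟨0, .old b⟩).k, .old b⟩)).mpr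
      (Or.inl ⟨by omega, by omega⟩)
    rw [φ.nonempty_hom_iff, Repetitive.nonempty_hom_iff] at h₃
    exact h₃.imp (fun h => h.2) fun h => h.2

end


/-! ### Restriction along `i_Q` is an equivalence. -/

open Prederivator

/-- Isomorphic functors induce isomorphic restriction functors. -/
noncomputable def Prederivator.restrIso (D : Prederivator.{u, v, w}) {A B : Type u} [Category.{u} A]
    [Category.{u} B] {f g : A ⥤ B} (i : f ≅ g) : D.restr f ≅ D.restr g :=
  have := D.isIso_restrTrans i.hom
  asIso (D.restrTrans i.hom)

section

variable {𝒞 : Type*} [Category 𝒞] {𝒟 : Type*} [Category 𝒟]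

theorem RestrictsToEquiv.isEquivalence {R : 𝒞 ⥤ 𝒟} {P : ObjectProperty 𝒞}
    (h : RestrictsToEquiv R P fun _ => True) : (P.ι ⋙ R).IsEquivalence where
  faithful := ⟨fun {X Y} f g hfg => P.ι.map_injective ((h.bijective _ _ X.2 Y.2).1 hfg)⟩
  full := ⟨fun {X Y} f => by
    obtain ⟨g, hg⟩ := (h.bijective _ _ X.2 Y.2).2 f
    exact ⟨ObjectProperty.homMk g, hg⟩⟩
  essSurj := ⟨fun Y => by
    obtain ⟨X, hX, ⟨i⟩⟩ := h.surj Y trivial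
    exact ⟨⟨X, hX⟩, ⟨i⟩⟩⟩

end

section

variable {D : Prederivator.{u, v, w}} {n : ℕ}

theorem Mesh.stripFunctor_vertex {x y : ℤ} (h : StripShape n x y) (l : Fin (n + 2))
    (hl : x + l.val = y) : (Mesh.stripFunctor.{u} n).obj (Mesh.vertex x l) = Shape.pt x y h := by
  subst hl
  rfl

theorem Mesh.square_stripFunctor_obj {x y : ℤ} (h : Shape.HasSquare (StripShape n) x y)
    {a b c : Linear.{u} (n + 2)} (α : a ⟶ b) (β : b ⟶ c) (hb : x + b.down.val = y) (s : Square.{u}) :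
    (Mesh.square x α β ⋙ Mesh.stripFunctor.{u} n).obj s = (Shape.square.{u} h).obj s := by
  have hα := α.down.down
  have hβ := β.down.down
  obtain ⟨⟨i, j⟩⟩ := s
  refine ULift.ext _ _ (Subtype.ext ?_)
  fin_cases i <;> fin_cases j <;> refine _root_.Prod.ext ?_ ?_
  · exact (add_zero x).symm
  · change x + (b.down.val : ℤ) = y + 0
    omega
  · rfl
  · change x + 1 + (a.down.val : ℤ) = y + 0
    omega
  · exact (add_zero x).symm
  · change x + (c.down.val : ℤ) = y + 1
    omega
  · rfl
  · change x + 1 + (b.down.val : ℤ) = y + 1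
    omega

theorem isCocartesian_mesh_square_iff (X : D.Diag (Shape.{u} (StripShape n))) {x y : ℤ}
    (h : Shape.HasSquare (StripShape n) x y) {a b c : Linear.{u} (n + 2)} (α : a ⟶ b) (β : b ⟶ c)
    (hb : x + b.down.val = y) :
    IsCocartesian ((D.restr (Mesh.square x α β)).obj ((D.restr (Mesh.stripFunctor n)).obj X)) ↔
      IsCocartesian ((D.restr (Shape.square h)).obj X) :=
  let i : (D.restr (Mesh.square x α β)).obj ((D.restr (Mesh.stripFunctor n)).obj X) ≅
      (D.restr (Shape.square h)).obj X :=
    ((D.restrComp (Mesh.square x α β) (Mesh.stripFunctor n)).symm ≪≫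
      D.restrIso (NatIso.ofComponents
        (fun s => eqToIso (Mesh.square_stripFunctor_obj h α β hb s))
        fun _ => Subsingleton.elim _ _)).app X
  ⟨fun H => H.of_iso i, fun H => H.of_iso i.symm⟩

/-- The two notions match square by square and boundary point by boundary point. The cartesian
condition on the mesh side is recovered from stability. -/
theorem isExactAR_restr_iff (hD : D.IsStableDerivator) (X : D.Diag (Shape.{u} (StripShape n))) :
    IsExactAR n ((D.restr (Mesh.stripFunctor n)).obj X) ↔ IsExactOn n X := by
  have hz : ∀ {x y : ℤ} (h : StripShape n x y) (l : Fin (n + 2)), x + l.val = y →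
      (Limits.IsZero ((D.eval (Mesh.vertex x l)).obj ((D.restr (Mesh.stripFunctor n)).obj X)) ↔
        Limits.IsZero ((D.eval (Shape.pt x y h)).obj X)) := fun h l hl => by
    rw [D.isZero_eval_restr_iff, Mesh.stripFunctor_vertex h l hl]
  constructor
  · intro H
    refine ⟨fun x y h hb => ?_, fun x y h hi => ?_⟩
    · rcases hb with hb | hb
      · exact (hz h 0 (by simp [hb])).mp (H.zero_bot x)
      · exact (hz h (Fin.last (n + 1)) (by simp [hb, add_assoc])).mp (H.zero_top x)
    · obtain ⟨h₁, h₂⟩ := hi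
      obtain ⟨l, rfl⟩ := Int.le.dest (show x ≤ y by omega)
      have hl : 1 ≤ l ∧ l ≤ n := by omega
      let a : Linear.{u} (n + 2) := ⟨⟨l - 1, by omega⟩⟩
      let b : Linear.{u} (n + 2) := ⟨⟨l, by omega⟩⟩
      let c : Linear.{u} (n + 2) := ⟨⟨l + 1, by omega⟩⟩
      let α : a ⟶ b := ⟨⟨Nat.sub_add_cancel hl.1⟩⟩
      let β : b ⟶ c := ⟨⟨rfl⟩⟩
      exact (isCocartesian_mesh_square_iff X h α β rfl).mp (H.cocartesian x α β)
  · intro H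
    have hc : ∀ (k : ℤ) {a b c : Linear.{u} (n + 2)} (α : a ⟶ b) (β : b ⟶ c), IsCocartesian
        ((D.restr (Mesh.square k α β)).obj ((D.restr (Mesh.stripFunctor n)).obj X)) := by
      intro k a b c α β
      have hα := α.down.down
      have hβ := β.down.down
      have hc := c.down.isLt
      have hs : Shape.HasSquare (StripShape n) k (k + b.down.val) := by
        refine ⟨⟨?_, ?_⟩, ⟨?_, ?_⟩, ⟨?_, ?_⟩, ⟨?_, ?_⟩⟩ <;> omega
      exact (isCocartesian_mesh_square_iff X hs α β rfl).mpr
        (H.cocartesian _ _ hs ⟨by omega, by omega⟩)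
    refine ⟨fun k => ?_, fun k => ?_, hc, fun k _ _ _ α β => (hD.cartesian_iff _).mpr (hc k α β)⟩
    · exact (hz (x := k) (y := k) ⟨by omega, by omega⟩ 0 (by simp)).mpr (H.zero _ _ _ (Or.inl rfl))
    · exact (hz (x := k) (y := k + n + 1) ⟨by omega, by omega⟩ (Fin.last (n + 1))
        (by simp [add_assoc])).mpr (H.zero _ _ _ (Or.inr rfl))

end

section

variable {n : ℕ} {Q : Type u} [Quiver.{u} Q] (lab : TypeALabelling n Q) (hn : 1 ≤ n)
  (φ : QuiverIso (Repetitive (Ext (lab.ends hn))) (Repetitive (Linear.{u} (n + 2))))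

theorem TypeALabelling.embedding_full : (embedding φ).Full where
  map_surjective {a b} f := by
    have h := (Mesh.nonempty_hom_iff (x := φ.hom.obj ⟨0, .old a⟩)
      (y := φ.hom.obj ⟨0, .old b⟩)).mp ⟨f⟩
    obtain ⟨p⟩ := (lab.isQuiverSection hn φ).nonempty_path hn h.1 h.2
    exact ⟨p, Subsingleton.elim _ _⟩

theorem TypeALabelling.embedding_faithful : (embedding φ).Faithful where
  map_injective {_ _} p q _ := (lab.isQuiverSection hn φ).path_eq hn p q

theorem TypeALabelling.embedding_injective : Function.Injective (embedding φ).obj := fun a b h => by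
  have h' : φ.hom.obj ⟨0, .old a⟩ = φ.hom.obj ⟨0, .old b⟩ :=
    congrArg (fun t : Mesh.{u} n => t.as) h
  exact Ext.old.inj (Repetitive.mk.inj (φ.injective h')).2

variable {D : Prederivator.{u, v, w}} (hD : D.IsStableDerivator)
include hD

/-- Up to isomorphism, `i_Q` followed by the equivalence of the mesh category with the strip is the
equivalence from `Paths Q` to a section followed by its inclusion. Inverting restriction along the
former equivalence reduces to `restrictsToEquiv_section`. -/
theorem TypeALabelling.restrictsToEquiv_embedding :
    RestrictsToEquiv (D.restr (embedding φ)) (IsExactAR n) fun _ => True := by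
  have hq := lab.isQuiverSection hn φ
  obtain ⟨σ, hσ, hσx⟩ := hq.exists_section hn
  obtain ⟨G, _, hG⟩ := hq.exists_equivalence hn hσx
  have hT : ∀ Y Y' : D.Diag (Paths Q), (Y ≅ Y') → True → True := fun _ _ _ _ => trivial
  let S := Mesh.stripFunctor.{u} n
  let I := Shape.incl.{u} fun x y (h : SectionShape n σ x y) => h.strip
  let i : G ⋙ I ≅ embedding φ ⋙ S := NatIso.ofComponents
    (fun q => eqToIso (ULift.ext _ _ (Subtype.ext (hG q)))) fun _ => Subsingleton.elim _ _
  have hGe := D.isEquivalence_restr G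
  have hSe := D.isEquivalence_restr S
  have h₁ : RestrictsToEquiv (D.restr I ⋙ D.restr G) (IsExactOn n) fun _ => True :=
    (hD.restrictsToEquiv_section hσ hn).comp
      (RestrictsToEquiv.of_isEquivalence (D.restr G) (fun _ => Iff.rfl) hT)
  have h₂ : RestrictsToEquiv (D.restr S).inv (IsExactAR n) (IsExactOn n) :=
    RestrictsToEquiv.of_isEquivalence _ (fun X => by
      rw [← isExactAR_restr_iff hD]
      exact ⟨fun h => h.of_iso ((D.restr S).asEquivalence.counitIso.app X).symm,
        fun h => h.of_iso ((D.restr S).asEquivalence.counitIso.app X)⟩)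
      fun _ _ i h => h.of_iso i
  refine (h₂.comp h₁).of_natIso ?_ hT
  exact Functor.isoWhiskerLeft _ ((D.restrComp G I).symm ≪≫ D.restrIso i ≪≫
      D.restrComp (embedding φ) S) ≪≫ (Functor.associator _ _ _).symm ≪≫
    Functor.isoWhiskerRight (D.restr S).asEquivalence.counitIso (D.restr (embedding φ)) ≪≫
    Functor.leftUnitor _

end

section

variable {D : Prederivator.{u, v, w}}

/-- For the converse, the map from a zero diagram is invertible at every object, hence invertible.
-/
theorem Prederivator.IsStableDerivator.isZero_iff (hD : D.IsStableDerivator) {A : Type u} [Category.{u} A]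
    (X : D.Diag A) : Limits.IsZero X ↔ ∀ a, Limits.IsZero ((D.eval a).obj X) := by
  refine ⟨fun h a => hD.toIsDerivator.isZero_restr _ h, fun h => ?_⟩
  obtain ⟨Z, hZ⟩ := hD.pointed
  have hZA := hD.toIsDerivator.isZero_restr (Functor.star.{u} A) hZ
  have : IsIso (hZA.to_ X) := hD.toIsDerivator.isIso_of_eval _ fun a =>
    isIso_of_isZero (hD.toIsDerivator.isZero_restr _ hZA) (h a) _
  exact hZA.of_iso (asIso (hZA.to_ X)).symm

variable {n : ℕ} {A : Type u} [Category.{u} A]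

def sectRSwapIso {B C : Type u} [Category.{u} B] [Category.{u} C] (f : B ⥤ C) (a : A) :
    Prod.sectR a B ⋙ (𝟭 A).prod f ⋙ CategoryTheory.Prod.swap A C ≅ f ⋙ Prod.sectL C a :=
  NatIso.ofComponents (fun _ => Iso.refl _) fun _ =>
    (Category.comp_id _).trans (Category.id_comp _).symm

noncomputable def restrSwapIso {B C : Type u} [Category.{u} B] [Category.{u} C] (f : B ⥤ C) (a : A)
    (X : D.Diag (C × A)) :
    (D.restr (Prod.sectR a B)).obj
      (((D.shift A).restr f).obj ((D.restr (CategoryTheory.Prod.swap A C)).obj X)) ≅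
      (D.restr f).obj ((D.restr (Prod.sectL C a)).obj X) :=
  (D.restr (Prod.sectR a B)).mapIso ((D.restrComp ((𝟭 A).prod f) (CategoryTheory.Prod.swap A C)).symm.app X) ≪≫
    ((D.restrComp _ _).symm ≪≫ D.restrIso (sectRSwapIso f a) ≪≫ D.restrComp _ _).app X

theorem isZero_eval_swap_iff (hD : D.IsStableDerivator) {C : Type u} [Category.{u} C] (c : C)
    (X : D.Diag (C × A)) :
    Limits.IsZero (((D.shift A).eval c).obj ((D.restr (CategoryTheory.Prod.swap A C)).obj X)) ↔
      ∀ a, Limits.IsZero ((D.eval c).obj ((D.restr (Prod.sectL C a)).obj X)) := by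
  refine (hD.isZero_iff (A := A × Pt.{u}) _).trans ⟨fun h a => ?_, fun h p => ?_⟩
  · have := (D.isZero_eval_restr_iff _ _ _).mp ((D.isZero_eval_restr_iff _ _ _).mp (h (a, ⟨⟨⟩⟩)))
    exact (D.isZero_eval_restr_iff _ _ _).mpr this
  · exact (D.isZero_eval_restr_iff _ _ _).mpr ((D.isZero_eval_restr_iff _ _ _).mpr
      ((D.isZero_eval_restr_iff (Prod.sectL C p.1) c X).mp (h p.1)))

/-- Vanishing and exactness of squares in `D.shift A` are tested at each `a`. The swap is needed
because the shift places `A` in the left factor. -/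
theorem isExactAR_shift_iff (hD : D.IsStableDerivator) (X : D.Diag (Mesh.{u} n × A)) :
    (∀ a, IsExactAR n ((D.restr (Prod.sectL (Mesh.{u} n) a)).obj X)) ↔
      IsExactAR (D := D.shift A) n ((D.restr (CategoryTheory.Prod.swap A (Mesh.{u} n))).obj X) := by
  constructor
  · intro h
    refine ⟨fun k => (isZero_eval_swap_iff hD _ X).mpr fun a => (h a).zero_bot k,
      fun k => (isZero_eval_swap_iff hD _ X).mpr fun a => (h a).zero_top k,
      fun k _ _ _ α β => (hD.toIsDerivator.shift_isCocartesian_iff A _).mpr fun a => ?_,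
      fun k _ _ _ α β => (hD.toIsDerivator.shift_isCartesian_iff A _).mpr fun a => ?_⟩
    · exact ((h a).cocartesian k α β).of_iso (restrSwapIso _ a X).symm
    · exact ((h a).cartesian k α β).of_iso (restrSwapIso _ a X).symm
  · intro h a
    refine ⟨fun k => (isZero_eval_swap_iff hD _ X).mp (h.zero_bot k) a,
      fun k => (isZero_eval_swap_iff hD _ X).mp (h.zero_top k) a, fun k _ _ _ α β => ?_,
      fun k _ _ _ α β => ?_⟩
    · exact ((hD.toIsDerivator.shift_isCocartesian_iff A _).mp (h.cocartesian k α β) a).of_iso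
        (restrSwapIso _ a X)
    · exact ((hD.toIsDerivator.shift_isCartesian_iff A _).mp (h.cartesian k α β) a).of_iso
        (restrSwapIso _ a X)

end

section

variable {n : ℕ} {Q : Type u} [Quiver.{u} Q] (lab : TypeALabelling n Q) (hn : 1 ≤ n)
  (φ : QuiverIso (Repetitive (Ext (lab.ends hn))) (Repetitive (Linear.{u} (n + 2))))

/-- The parameters in `A` are absorbed by applying the result without parameters to the stable
derivator `D.shift A`. -/
theorem TypeALabelling.restrictsToEquiv_embedding_prod {D : Prederivator.{u, v, w}}
    (hD : D.IsStableDerivator) (A : Type u) [Category.{u} A] :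
    RestrictsToEquiv (D.restr ((embedding φ).prod (𝟭 A)))
      (fun X => ∀ a, IsExactAR n ((D.restr (Prod.sectL (Mesh.{u} n) a)).obj X)) fun _ => True := by
  have := D.isEquivalence_restr (CategoryTheory.Prod.swap A (Mesh.{u} n))
  have := D.isEquivalence_restr (CategoryTheory.Prod.swap (Paths Q) A)
  have h₁ : RestrictsToEquiv (D.restr (CategoryTheory.Prod.swap A (Mesh.{u} n))) _
      (IsExactAR (D := D.shift A) n) :=
    RestrictsToEquiv.of_isEquivalence _ (isExactAR_shift_iff hD) fun _ _ i h => h.of_iso i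
  have h₂ : RestrictsToEquiv (D.restr ((𝟭 A).prod (embedding φ)))
      (IsExactAR (D := D.shift A) n) fun _ => True :=
    lab.restrictsToEquiv_embedding hn φ (hD.shift A)
  have h₃ : RestrictsToEquiv (D.restr (CategoryTheory.Prod.swap (Paths Q) A)) (fun _ => True) fun _ => True :=
    RestrictsToEquiv.of_isEquivalence _ (fun _ => Iff.rfl) fun _ _ _ _ => trivial
  refine (h₁.comp (h₂.comp h₃)).of_natIso ?_ fun _ _ _ _ => trivial
  exact Functor.isoWhiskerLeft _ (D.restrComp _ _).symm ≪≫ (D.restrComp _ _).symm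

theorem TypeALabelling.isEquivalence_restrAlong (D : StableDerivator.{u, v, w})
    (A : Cat.{u, u}ᵒᵖ) : (((restrAlong φ).app D).hom.app A).toFunctor.IsEquivalence :=
  (lab.restrictsToEquiv_embedding_prod hn φ D.isStable A.unop).isEquivalence
    (P := (arProp D.pre n).prop A)

end

end ARDerivator

theorem mainTheorem3 (n : ℕ) (hn : 1 ≤ n) (Q : Type u) [Quiver.{u} Q]
    (lab : ARDerivator.TypeALabelling n Q) :
    Nonempty (ARDerivator.QuiverIso (ARDerivator.Repetitive (ARDerivator.Ext (lab.ends hn)))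
      (ARDerivator.Repetitive (ARDerivator.Linear.{u} (n + 2)))) ∧
    (∀ D : ARDerivator.StableDerivator.{u, v, w},
      (D.pre.shift (Paths Q)).IsStableDerivator ∧ (D.pre.ar n).IsStableDerivator) ∧
    ∀ φ : ARDerivator.QuiverIso (ARDerivator.Repetitive (ARDerivator.Ext (lab.ends hn)))
        (ARDerivator.Repetitive (ARDerivator.Linear.{u} (n + 2))),
      (ARDerivator.embedding φ).Full ∧ (ARDerivator.embedding φ).Faithful ∧
      Function.Injective (ARDerivator.embedding φ).obj ∧
      ∃ e : Bicategory.Equivalence (ARDerivator.shiftFunctor.{u, v, w} (Paths Q))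
          (ARDerivator.arFunctor.{u, v, w} n),
        e.inv = ARDerivator.restrAlong.{u, v, w} φ := by
  obtain ⟨φ₀⟩ := (lab.isLineQuiver_ext hn).nonempty_iso
  refine ⟨⟨φ₀⟩, fun D => ⟨D.isStable.shift (Paths Q), ?_⟩, fun φ => ⟨lab.embedding_full hn φ,
    lab.embedding_faithful hn φ, lab.embedding_injective hn φ,
    ARDerivator.exists_pder_equivalence (ARDerivator.restrAlong φ)
      (lab.isEquivalence_restrAlong hn φ)⟩⟩
  -- Stability of the coherent Auslander–Reiten quivers is transported from `D^Q` along restriction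
  -- for the one isomorphism `φ₀`.
  exact ARDerivator.Prederivator.IsStableDerivator.of_equivalence
    ((ARDerivator.restrAlong φ₀).app D).hom
    (fun A _ => lab.isEquivalence_restrAlong hn φ₀ D (op (Cat.of A)))
    (D.isStable.shift (Paths Q))
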